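/- Let $\mathbf k$ be a field of characteristic zero, $H$ a cocommutative Hopf algebra over $\mathbf k$ with coproduct $\Delta$, and $\otimes=\otimes_{\mathbf k}$. For a left $H$-module $M$ form $H^{\otimes n}\otimes_H M$ by means of the right action of $H$ on $H^{\otimes n}$ through the iterated coproduct $\Delta^{n-1}$. For a permutation $\sigma$ of $\{1,\dots,n\}$ let $\sigma\otimes_H\mathrm{id}$ be the map of $H^{\otimes n}\otimes_H M$ which moves the tensor factor in position $s$ to position $\sigma(s)$; thus $(12)$ exchanges the first two factors. A *pseudoproduct* $B\colon M\otimes N\to H^{\otimes 2}\otimes_H P$ is an $H^{\otimes2}$-linear map. It is extended to $F\in H^{\otimes m}\otimes_H M$, $G\in H^{\otimes n}\otimes_H N$ by $$B(f\otimes_H v\,\otimes\, g\otimes_H w)=\sum (f\otimes g)\,(\Delta^{m-1}\otimes\Delta^{n-1})(y)\otimes_H c\in H^{\otimes (m+n)}\otimes_H P \quad\text{if } B(v\otimes w)=\sum y\otimes_H c ,$$ and $H^{\otimes n}$-linear maps $N^{\otimes n}\to H^{\otimes n}\otimes_H P$ are extended in the same way to an element of $H^{\otimes m}\otimes_H N$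 in the first argument. $H$-linear maps $T\colon M\to N$ are extended to $\mathrm{id}\otimes_H T$ on $H^{\otimes n}\otimes_H M$. A *Lie pseudoalgebra* is a left $H$-module $L$ with a pseudoproduct $[\,\cdot*\cdot\,]\colon L\otimes L\to H^{\otimes 2}\otimes_H L$ such that $[x*y]=-((12)\otimes_H\mathrm{id})[y*x]$ and $[x*[y*z]]=[[x*y]*z]+((12)\otimes_H\mathrm{id})[y*[x*z]]$. A *representation* of $L$ on $M$ is a pseudoproduct $\rho\colon L\otimes M\to H^{\otimes 2}\otimes_H M$ with $\rho([x*y]\otimes m)=\rho(x\otimes\rho(y\otimes m))-((12)\otimes_H\mathrm{id})\rho(y\otimes\rho(x\otimes m))$. A *matched pair of Lie pseudoalgebras* $(\mathfrak g,\mathfrak h;\rho,\eta)$ consists of Lie pseudoalgebras $\mathfrak g,\mathfrak h$, a representation $\rho\colon\mathfrak g\otimes\mathfrak h\to H^{\otimes2}\otimes_H\mathfrak h$ of $\mathfrak g$ on $\mathfrak h$ and a representation $\eta\colon\mathfrak h\otimes\mathfrak g\to H^{\otimes2}\otimes_H\mathfrak g$ of $\mathfrak h$ on $\mathfrak g$ such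 that, for $x,y\in\mathfrak g$, $u,v\in\mathfrak h$ and with $\tau$ the map $(h_1,h_2,h_3)\mapsto(h_2,h_3,h_1)$ on $H^{\otimes 3}$, $$\rho(x\otimes[u*v]_{\mathfrak h})=[\rho(x\otimes u)*v]_{\mathfrak h}+((12)\otimes_H\mathrm{id})\bigl([u*\rho(x\otimes v)]_{\mathfrak h}-\rho(\eta(u\otimes x)\otimes v)\bigr)+(\tau\otimes_H\mathrm{id})\,\rho(\eta(v\otimes x)\otimes u),$$ $$\eta(u\otimes[x*y]_{\mathfrak g})=[\eta(u\otimes x)*y]_{\mathfrak g}+((12)\otimes_H\mathrm{id})\bigl([x*\eta(u\otimes y)]_{\mathfrak g}-\eta(\rho(x\otimes u)\otimes y)\bigr)+(\tau\otimes_H\mathrm{id})\,\eta(\rho(y\otimes u)\otimes x).$$ A *deformation map* of the matched pair is an $H$-linear map $T\colon\mathfrak h\to\mathfrak g$ such that, for all $u,v\in\mathfrak h$, $$[T(u)*T(v)]_{\mathfrak g}+\eta(u\otimes T(v))-((12)\otimes_H\mathrm{id})\eta(v\otimes T(u))=T\bigl([u*v]_{\mathfrak h}+\rho(T(u)\otimes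 v)-((12)\otimes_H\mathrm{id})\rho(T(v)\otimes u)\bigr).$$ For $n\ge1$ let $C^n(\mathfrak h,\mathfrak g)$ be the space of $H^{\otimes n}$-linear maps $f\colon\mathfrak h^{\otimes n}\to H^{\otimes n}\otimes_H\mathfrak g$ that are skew-symmetric: $f(u_1\otimes\cdots\otimes u_n)=(-1)^\sigma(\sigma\otimes_H\mathrm{id})f(u_{\sigma(1)}\otimes\cdots\otimes u_{\sigma(n)})$ for all $\sigma\in S_n$. Its elements have degree $n$. An $H$-linear map $T\colon\mathfrak h\to\mathfrak g$ is identified with the element $u\mapsto 1\otimes_HT(u)$ of $C^1(\mathfrak h,\mathfrak g)$. In the formulas below, $(\cdot)^{\sim}$ means that $\sigma\otimes_H\mathrm{id}$ is applied, where $\sigma$ is the permutation which moves each tensor factor to the position of the argument it belongs to: if the arguments occur in the term in the order $u_{\sigma(1)},u_{\sigma(2)},\dots$, factor $s$ moves to position $\sigma(s)$. A hat means omission. $S(a,b)$, resp. $S(a,1,b)$, is the set of permutations of $a+b$, resp. $a+1+b$, letters that are increasing on the first $a$ and on the last $b$ places. For $f\in C^p(\mathfrak h,\mathfrak g)$ put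 $$\begin{aligned}d(f)(u_1\otimes\cdots\otimes u_{p+1})={}&\sum_{i=1}^{p+1}(-1)^{p+i}\,\eta\bigl(u_i\otimes f(u_1\otimes\cdots\widehat{u_i}\cdots\otimes u_{p+1})\bigr)^{\sim}\\&+\sum_{i<j}(-1)^{p+i+j-1}f\bigl([u_i*u_j]_{\mathfrak h}\otimes u_1\otimes\cdots\widehat{u_i}\cdots\widehat{u_j}\cdots\otimes u_{p+1}\bigr)^{\sim},\end{aligned}$$ and for $f_1\in C^p(\mathfrak h,\mathfrak g)$, $f_2\in C^q(\mathfrak h,\mathfrak g)$ put $$\begin{aligned}[[f_1,f_2]](u_1\otimes\cdots\otimes u_{p+q})={}&-\sum_{\sigma\in S(q,1,p-1)}(-1)^\sigma f_1\bigl(\rho(f_2(u_{\sigma(1)}\otimes\cdots\otimes u_{\sigma(q)})\otimes u_{\sigma(q+1)})\otimes u_{\sigma(q+2)}\otimes\cdots\otimes u_{\sigma(p+q)}\bigr)^{\sim}\\&+(-1)^{pq}\sum_{\sigma\in S(p,1,q-1)}(-1)^\sigma f_2\bigl(\rho(f_1(u_{\sigma(1)}\otimes\cdots\otimes u_{\sigma(p)})\otimes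 u_{\sigma(p+1)})\otimes u_{\sigma(p+2)}\otimes\cdots\otimes u_{\sigma(p+q)}\bigr)^{\sim}\\&-(-1)^{pq}\sum_{\sigma\in S(p,q)}(-1)^\sigma\bigl[f_1(u_{\sigma(1)}\otimes\cdots\otimes u_{\sigma(p)})*f_2(u_{\sigma(p+1)}\otimes\cdots\otimes u_{\sigma(p+q)})\bigr]_{\mathfrak g}^{\sim}.\end{aligned}$$ Let $(\mathfrak g,\mathfrak h;\rho,\eta)$ be a matched pair of Lie pseudoalgebras. Then: 1. These formulas define a linear map $d\colon C^p(\mathfrak h,\mathfrak g)\to C^{p+1}(\mathfrak h,\mathfrak g)$ and a bilinear map $[[\cdot,\cdot]]\colon C^p(\mathfrak h,\mathfrak g)\times C^q(\mathfrak h,\mathfrak g)\to C^{p+q}(\mathfrak h,\mathfrak g)$ for all $p,q\ge1$, and $\bigl(\bigoplus_{n\ge1}C^n(\mathfrak h,\mathfrak g),d,[[\cdot,\cdot]]\bigr)$ is a differential graded Lie algebra over $\mathbf k$ (graded skew-symmetric and Jacobi with respect to the degree $n$ of $C^n$, $d^2=0$, and $d$ a graded derivation of degree $1$). 2. Its Maurer–Cartan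 elements, i.e. the $f\in C^1(\mathfrak h,\mathfrak g)$ with $d(f)+\tfrac12[[f,f]]=0$, are exactly the deformation maps of the matched pair. 3. Let $T$ be a deformation map. Then $\bigl(\bigoplus_{n\ge1}C^n(\mathfrak h,\mathfrak g),d^T,[[\cdot,\cdot]]\bigr)$ with $d^T=d+[[T,\cdot]]$ is a differential graded Lie algebra; explicitly, for $f\in C^p(\mathfrak h,\mathfrak g)$, $$\begin{aligned}d^T(f)(u_1\otimes\cdots\otimes u_{p+1})={}&\sum_{i=1}^{p+1}(-1)^{p+i}\eta\bigl(u_i\otimes f(u_1\otimes\cdots\widehat{u_i}\cdots\otimes u_{p+1})\bigr)^{\sim}\\&+\sum_{i<j}(-1)^{p+i+j-1}f\bigl([u_i*u_j]_{\mathfrak h}\otimes u_1\otimes\cdots\widehat{u_i}\cdots\widehat{u_j}\cdots\otimes u_{p+1}\bigr)^{\sim}\\&+\sum_{i=1}^{p+1}(-1)^{p+i}\,T\bigl(\rho(f(u_1\otimes\cdots\widehat{u_i}\cdots\otimes u_{p+1})\otimes u_i)\bigr)^{\sim}\\&+\sum_{i<j}(-1)^{p+i+j-1}f\bigl(\bigl(\rho(T(u_i)\otimes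 u_j)-((12)\otimes_H\mathrm{id})\rho(T(u_j)\otimes u_i)\bigr)\otimes u_1\otimes\cdots\widehat{u_i}\cdots\widehat{u_j}\cdots\otimes u_{p+1}\bigr)^{\sim}\\&+\sum_{i=1}^{p+1}(-1)^{p+i}\bigl[T(u_i)*f(u_1\otimes\cdots\widehat{u_i}\cdots\otimes u_{p+1})\bigr]_{\mathfrak g}^{\sim}.\end{aligned}$$ The Maurer–Cartan elements of this differential graded Lie algebra are exactly the $H$-linear maps $T'\colon\mathfrak h\to\mathfrak g$ for which $T+T'$ is again a deformation map. -/

import Mathlib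

open scoped TensorProduct

noncomputable section

namespace LiePseudo

/-! ### The algebras `H^{⊗n}` and the iterated coproducts -/

section Tensor

variable (k H : Type*) [Field k] [Ring H] [Bialgebra k H]

/-- The `k`-algebra `H^{⊗n}`. -/
abbrev HT (n : ℕ) : Type _ := ⨂[k] _ : Fin n, H

variable {k H}

/-- `a ↦ 1 ⊗ ⋯ ⊗ a ⊗ ⋯ ⊗ 1`, with `a` in position `i`. -/
def slot {n : ℕ} (i : Fin n) : H →ₐ[k] HT k H n :=
  PiTensorProduct.singleAlgHom (R := k) (A := fun _ : Fin n => H) i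

theorem slot_commute {n : ℕ} {i j : Fin n} (hij : i ≠ j) (a b : H) :
    Commute (slot (k := k) i a) (slot (k := k) j b) := by
  change PiTensorProduct.tprod k _ * PiTensorProduct.tprod k _ =
    PiTensorProduct.tprod k _ * PiTensorProduct.tprod k _
  rw [PiTensorProduct.tprod_mul_tprod, PiTensorProduct.tprod_mul_tprod]
  exact congrArg _ (Pi.mulSingle_commute (f := fun _ : Fin n => H) hij a b)

theorem conv_commute [Coalgebra.IsCocomm k H] {A : Type*} [Ring A] [Algebra k A]
    (f g : H →ₗ[k] A) (hfg : ∀ a b, Commute (f a) (g b)) :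
    Commute (WithConv.toConv f) (WithConv.toConv g) := by
  ext x
  change LinearMap.mul' k A (TensorProduct.map f g (Coalgebra.comul x)) =
    LinearMap.mul' k A (TensorProduct.map g f (Coalgebra.comul x))
  have h2 : ∀ t : H ⊗[k] H, LinearMap.mul' k A (TensorProduct.map f g t) =
      LinearMap.mul' k A (TensorProduct.map g f (TensorProduct.comm k H H t)) := by
    intro t
    induction t with
    | zero => simp
    | tmul a b => simpa using (hfg a b).eq
    | add s t hs ht => simp only [map_add, hs, ht]
  rw [h2, Coalgebra.comm_comul]

theorem slot_conv_pairwise [Coalgebra.IsCocomm k H] {n : ℕ} (S : Finset (Fin n)) :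
    (S : Set (Fin n)).Pairwise (Function.onFun Commute
      (fun i => WithConv.toConv (slot (k := k) (H := H) i).toLinearMap)) :=
  fun _ _ _ _ hij => conv_commute _ _ fun a b => slot_commute hij a b

variable [Coalgebra.IsCocomm k H]

/-- The iterated coproduct with the factors in the positions belonging to `S` and `1` elsewhere:
for `S = {i₁, …, iₚ}` it sends `a` to `a₍₁₎` in position `i₁`, …, `a₍ₚ₎` in position `iₚ`
(and to `ε(a) 1` if `S` is empty).  It is the convolution product of the maps `slot i`, `i ∈ S`;
their order is irrelevant since `H` is cocommutative. -/
def copConv {n : ℕ} (S : Finset (Fin n)) : WithConv (H →ₗ[k] HT k H n) :=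
  S.noncommProd (fun i => WithConv.toConv (slot (k := k) (H := H) i).toLinearMap)
    (slot_conv_pairwise S)

theorem copConv_aux {n : ℕ} (S : Finset (Fin n)) :
    ∃ F : H →ₐ[k] HT k H n, WithConv.toConv F.toLinearMap = copConv S ∧
      ∀ j ∉ S, ∀ a b, Commute (slot (k := k) j a) (F b) := by
  induction S using Finset.induction_on with
  | empty =>
    refine ⟨(Algebra.ofId k (HT k H n)).comp (Bialgebra.counitAlgHom k H), rfl, ?_⟩
    intro j _ a b
    exact (Algebra.commutes (Coalgebra.counit (R := k) b) (slot (k := k) j a)).symm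
  | insert i S hi ih =>
    obtain ⟨F, hF, hc⟩ := ih
    have hcomm : ∀ x y, Commute (slot (k := k) i x) (F y) := hc i hi
    refine ⟨(Algebra.TensorProduct.lift (slot i) F hcomm).comp (Bialgebra.comulAlgHom k H),
      ?_, ?_⟩
    · rw [copConv, Finset.noncommProd_insert_of_notMem _ _ _ _ hi]
      change _ = _ * copConv S
      rw [← hF]
      ext x
      change Algebra.TensorProduct.lift (slot i) F hcomm (Coalgebra.comul x) =
        LinearMap.mul' k _ (TensorProduct.map (slot i).toLinearMap F.toLinearMap
          (Coalgebra.comul x))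
      generalize (Coalgebra.comul (R := k) x : H ⊗[k] H) = t
      induction t with
      | zero => simp
      | tmul a b => simp
      | add s t hs ht => simp only [map_add, hs, ht]
    · intro j hj a b
      rw [Finset.mem_insert, not_or] at hj
      change Commute _ (Algebra.TensorProduct.lift (slot i) F hcomm (Coalgebra.comul b))
      generalize (Coalgebra.comul (R := k) b : H ⊗[k] H) = t
      induction t with
      | zero => simp
      | tmul x y =>
        rw [Algebra.TensorProduct.lift_tmul]
        exact (slot_commute hj.1 a x).mul_right (hc j hj.2 a y)
      | add s t hs ht => rw [map_add]; exact hs.add_right ht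

/-- `copConv S` as a homomorphism of algebras `H → H^{⊗n}`. -/
def cop {n : ℕ} (S : Finset (Fin n)) : H →ₐ[k] HT k H n := (copConv_aux S).choose

theorem cop_toConv {n : ℕ} (S : Finset (Fin n)) :
    WithConv.toConv (cop (k := k) (H := H) S).toLinearMap = copConv S :=
  (copConv_aux S).choose_spec.1

/-- The iterated coproduct `Δ^{n-1} : H → H^{⊗n}`, `a ↦ a₍₁₎ ⊗ ⋯ ⊗ a₍ₙ₎`. -/
def iterCop (n : ℕ) : H →ₐ[k] HT k H n := cop Finset.univ

theorem cop_singleton {n : ℕ} (i : Fin n) : cop (k := k) (H := H) {i} = slot i := by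
  apply AlgHom.toLinearMap_injective
  apply WithConv.toConv_injective
  rw [cop_toConv, copConv, Finset.noncommProd_singleton]

theorem cop_commute {n : ℕ} {S T : Finset (Fin n)} (hST : Disjoint S T) (a b : H) :
    Commute (cop (k := k) S a) (cop (k := k) T b) := by
  induction T using Finset.induction_on generalizing b with
  | empty =>
    have h : cop (k := k) (H := H) (n := n) ∅ =
        (Algebra.ofId k (HT k H n)).comp (Bialgebra.counitAlgHom k H) := by
      apply AlgHom.toLinearMap_injective
      apply WithConv.toConv_injective
      rw [cop_toConv]; rfl
    rw [h]
    exact (Algebra.commutes (Coalgebra.counit (R := k) b) _).symm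
  | insert i T hi ih =>
    rw [Finset.disjoint_insert_right] at hST
    have hF := cop_toConv (k := k) (H := H) (insert i T)
    rw [copConv, Finset.noncommProd_insert_of_notMem _ _ _ _ hi] at hF
    change _ = _ * copConv T at hF
    rw [← cop_toConv T] at hF
    have hx : cop (k := k) (insert i T) b = LinearMap.mul' k _
        (TensorProduct.map (slot (k := k) i).toLinearMap (cop T).toLinearMap
          (Coalgebra.comul b)) :=
      congrArg (fun F : WithConv (H →ₗ[k] HT k H n) => F.ofConv b) hF
    rw [hx]
    generalize (Coalgebra.comul (R := k) b : H ⊗[k] H) = t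
    induction t with
    | zero => simp
    | tmul x y =>
      simp only [TensorProduct.map_tmul, LinearMap.mul'_apply]
      exact (((copConv_aux S).choose_spec.2 i hST.1 x a).symm).mul_right (ih hST.2 y)
    | add s t hs ht => simp only [map_add]; exact hs.add_right ht

/-- The homomorphism `H^{⊗n} → H^{⊗m}` which spreads the `i`-th tensor factor, by the iterated
coproduct, over the positions belonging to `S i` (the sets `S i` are pairwise disjoint). -/
def spread {n m : ℕ} (S : Fin n → Finset (Fin m))
    (hS : Pairwise (Function.onFun Disjoint S)) : HT k H n →ₐ[k] HT k H m :=
  PiTensorProduct.liftAlgHom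
    ((MultilinearMap.mkPiAlgebraFin k n (HT k H m)).compLinearMap
      fun i => (cop (k := k) (H := H) (S i)).toLinearMap)
    (by simp)
    (by
      intro x y
      simp only [MultilinearMap.compLinearMap_apply, MultilinearMap.mkPiAlgebraFin_apply,
        AlgHom.toLinearMap_apply, Pi.mul_apply, map_mul]
      have key : ∀ (p : ℕ) (u v : Fin p → HT k H m), (∀ i j, i ≠ j → Commute (u i) (v j)) →
          (List.ofFn fun i => u i * v i).prod = (List.ofFn u).prod * (List.ofFn v).prod := by
        intro p
        induction p with
        | zero => intro u v _; simp
        | succ p ih =>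
          intro u v huv
          simp only [List.ofFn_succ, List.prod_cons]
          rw [ih _ _ fun i j hij => huv _ _ fun h => hij (Fin.succ_injective _ h)]
          have hc : Commute (v 0) (List.ofFn fun i : Fin p => u i.succ).prod := by
            apply Commute.list_prod_right
            intro z hz
            obtain ⟨i, rfl⟩ := (List.mem_ofFn' _ _).mp hz
            exact (huv i.succ 0 (Fin.succ_ne_zero i)).symm
          calc _ = u 0 * (v 0 * (List.ofFn fun i : Fin p => u i.succ).prod) *
                (List.ofFn fun i : Fin p => v i.succ).prod := by simp only [mul_assoc]
            _ = _ := by rw [hc.eq]; simp only [mul_assoc]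
      exact key n _ _ fun i j hij => cop_commute (hS hij) _ _)

theorem spread_tprod {n m : ℕ} (S : Fin n → Finset (Fin m))
    (hS : Pairwise (Function.onFun Disjoint S)) (v : Fin n → H) :
    spread (k := k) S hS (PiTensorProduct.tprod k v) =
      (List.ofFn fun i => cop (k := k) (S i) (v i)).prod := by
  simp [spread]

theorem spread_slot {n m : ℕ} (S : Fin n → Finset (Fin m))
    (hS : Pairwise (Function.onFun Disjoint S)) (i : Fin n) (a : H) :
    spread (k := k) S hS (slot i a) = cop (S i) a := by
  change spread S hS (PiTensorProduct.tprod k (Pi.mulSingle i a)) = _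
  rw [spread_tprod]
  have key : ∀ (p : ℕ) (i : Fin p) (u : Fin p → HT k H m), (∀ j, j ≠ i → u j = 1) →
      (List.ofFn u).prod = u i := by
    intro p
    induction p with
    | zero => intro i; exact i.elim0
    | succ p ih =>
      intro i u hu
      rw [List.ofFn_succ, List.prod_cons]
      induction i using Fin.cases with
      | zero =>
        have : (fun j : Fin p => u j.succ) = fun _ => 1 :=
          funext fun j => hu _ (Fin.succ_ne_zero j)
        rw [this]; simp
      | succ i =>
        rw [hu 0 (Fin.succ_ne_zero i).symm, one_mul]
        exact ih i _ fun j hj => hu _ fun h => hj (Fin.succ_injective _ h)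
  rw [key n i _ fun j hj => by rw [Pi.mulSingle_eq_of_ne hj, map_one], Pi.mulSingle_eq_same]

theorem spread_cop {n m : ℕ} (S : Fin n → Finset (Fin m))
    (hS : Pairwise (Function.onFun Disjoint S)) (T : Finset (Fin n)) (a : H) :
    spread (k := k) S hS (cop T a) = cop (T.biUnion S) a := by
  have h : ∀ T : Finset (Fin n), WithConv.toConv ((spread (k := k) (H := H) S hS).toLinearMap ∘ₗ
      (copConv T).ofConv) = copConv (T.biUnion S) := by
    intro T
    induction T using Finset.induction_on with
    | empty =>
      ext x
      exact (spread (k := k) (H := H) S hS).commutes (Coalgebra.counit (R := k) x)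
    | insert i T hi ih =>
      have hd : Disjoint (S i) (T.biUnion S) := by
        rw [Finset.disjoint_biUnion_right]
        intro j hj
        exact hS fun h => hi (h ▸ hj)
      have h1 : copConv (k := k) (H := H) ((insert i T).biUnion S) =
          copConv (S i) * copConv (T.biUnion S) := by
        simp only [copConv, Finset.biUnion_insert]
        exact Finset.noncommProd_union_of_disjoint hd _ _
      have h2 : copConv (k := k) (H := H) (insert i T) =
          WithConv.toConv (slot i).toLinearMap * copConv T :=
        Finset.noncommProd_insert_of_notMem _ _ _ _ hi
      rw [h1, h2, ← ih, LinearMap.algHom_comp_convMul_distrib, WithConv.toConv_ofConv]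
      congr 1
      rw [← cop_toConv]
      congr 1
      ext x
      exact spread_slot S hS i x
  have h' := h T
  rw [← cop_toConv, ← cop_toConv] at h'
  exact congrArg (fun F : WithConv (H →ₗ[k] HT k H m) => F.ofConv a) h'

theorem spread_commute {n m : ℕ} (S : Fin n → Finset (Fin m))
    (hS : Pairwise (Function.onFun Disjoint S)) (y : HT k H m)
    (hy : ∀ i a, Commute (cop (k := k) (S i) a) y) (x : HT k H n) :
    Commute (spread (k := k) S hS x) y := by
  induction x using PiTensorProduct.induction_on with
  | smul_tprod r v =>
    rw [map_smul, spread_tprod]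
    refine Commute.smul_left (Commute.list_prod_left _ _ ?_) r
    intro z hz
    obtain ⟨i, rfl⟩ := (List.mem_ofFn' _ _).mp hz
    exact hy i _
  | add s t hs ht => rw [map_add]; exact hs.add_left ht

theorem place_pairwise {n m : ℕ} {j : Fin n → Fin m} (hj : Function.Injective j) :
    Pairwise (Function.onFun Disjoint fun i => ({j i} : Finset (Fin m))) := fun _ _ h => by
  simpa [Function.onFun] using fun e => h (hj e)

theorem fibre_pairwise {n m : ℕ} (p : Fin m → Fin n) :
    Pairwise (Function.onFun Disjoint fun i => Finset.univ.filter fun l => p l = i) := by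
  intro i j h
  rw [Function.onFun, Finset.disjoint_left]
  intro l hl hl'
  simp only [Finset.mem_filter, Finset.mem_univ, true_and] at hl hl'
  exact h (hl.symm.trans hl')

/-- The homomorphism `H^{⊗n} → H^{⊗m}` moving the `i`-th factor to position `j i` (with `1` in
the positions outside the image of `j`). -/
def place {n m : ℕ} (j : Fin n → Fin m) (hj : Function.Injective j) : HT k H n →ₐ[k] HT k H m :=
  spread (fun i => {j i}) (place_pairwise hj)

/-- The homomorphism `H^{⊗n} → H^{⊗m}` attached to `p : Fin m → Fin n` which spreads the `i`-th
factor, by the iterated coproduct, over the positions in `p⁻¹(i)`. -/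
def fibre {n m : ℕ} (p : Fin m → Fin n) : HT k H n →ₐ[k] HT k H m :=
  spread (fun i => Finset.univ.filter fun l => p l = i) (fibre_pairwise p)

theorem fibre_slot {n m : ℕ} (p : Fin m → Fin n) (i : Fin n) (a : H) :
    fibre (k := k) p (slot i a) = cop (Finset.univ.filter fun l => p l = i) a :=
  spread_slot _ _ _ _

theorem fibre_iterCop {n m : ℕ} (p : Fin m → Fin n) (a : H) :
    fibre (k := k) p (iterCop n a) = iterCop m a := by
  refine (spread_cop _ (fibre_pairwise p) Finset.univ a).trans ?_
  rw [iterCop]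
  congr 2
  ext l
  simp

theorem place_iterCop {n m : ℕ} (j : Fin n → Fin m) (hj : Function.Injective j) (a : H) :
    place (k := k) j hj (iterCop n a) = cop (Finset.univ.image j) a := by
  refine (spread_cop _ (place_pairwise hj) Finset.univ a).trans ?_
  congr 2
  ext l
  simp [eq_comm]

theorem place_commute {n m : ℕ} (j : Fin n → Fin m) (hj : Function.Injective j)
    (T : Finset (Fin m)) (hT : ∀ i, j i ∉ T) (x : HT k H n) (a : H) :
    Commute (place j hj x) (cop T a) :=
  spread_commute _ _ _ (fun i _ => cop_commute (by simpa using hT i) _ _) x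

end Tensor

/-! ### The spaces `H^{⊗n} ⊗_H M` -/

section PT

variable (k H : Type*) [Field k] [Ring H] [Bialgebra k H] [Coalgebra.IsCocomm k H]
variable (M N P : Type*) [AddCommGroup M] [Module k M] [Module H M]
variable [AddCommGroup N] [Module k N] [Module H N]
variable [AddCommGroup P] [Module k P] [Module H P]

/-- The relations `x Δ^{n-1}(a) ⊗ m = x ⊗ a m`. -/
def balanced (n : ℕ) : Submodule k (HT k H n ⊗[k] M) :=
  Submodule.span k {t | ∃ (x : HT k H n) (a : H) (m : M),
    t = (x * iterCop n a) ⊗ₜ[k] m - x ⊗ₜ[k] (a • m)}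

/-- The space `H^{⊗n} ⊗_H M`, where `H` acts on `H^{⊗n}` from the right through the iterated
coproduct. -/
def PT (n : ℕ) : Type _ := (HT k H n ⊗[k] M) ⧸ balanced k H M n

instance (n : ℕ) : AddCommGroup (PT k H M n) :=
  inferInstanceAs (AddCommGroup ((HT k H n ⊗[k] M) ⧸ balanced k H M n))

instance (n : ℕ) : Module k (PT k H M n) :=
  inferInstanceAs (Module k ((HT k H n ⊗[k] M) ⧸ balanced k H M n))

/-- The projection `H^{⊗n} ⊗ M → H^{⊗n} ⊗_H M`. -/
def PT.proj (n : ℕ) : (HT k H n ⊗[k] M) →ₗ[k] PT k H M n := (balanced k H M n).mkQ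

variable {k H M N P}

/-- The element `x ⊗_H m` of `H^{⊗n} ⊗_H M`. -/
def PT.mk {n : ℕ} (x : HT k H n) (m : M) : PT k H M n := PT.proj k H M n (x ⊗ₜ[k] m)

theorem PT.mk_bal {n : ℕ} (x : HT k H n) (a : H) (m : M) :
    PT.mk (x * iterCop n a) m = PT.mk x (a • m) := by
  rw [← sub_eq_zero, PT.mk, PT.mk, ← map_sub]
  refine (Submodule.Quotient.mk_eq_zero _).mpr ?_
  exact Submodule.subset_span ⟨x, a, m, rfl⟩

theorem PT.mk_add_left {n : ℕ} (x y : HT k H n) (m : M) :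
    PT.mk (x + y) m = PT.mk x m + PT.mk y m := by
  rw [PT.mk, PT.mk, PT.mk, TensorProduct.add_tmul, map_add]

theorem PT.mk_add_right {n : ℕ} (x : HT k H n) (m m' : M) :
    PT.mk x (m + m') = PT.mk x m + PT.mk x m' := by
  rw [PT.mk, PT.mk, PT.mk, TensorProduct.tmul_add, map_add]

theorem PT.mk_smul_left {n : ℕ} (c : k) (x : HT k H n) (m : M) :
    PT.mk (c • x) m = c • PT.mk x m := by
  rw [PT.mk, PT.mk, ← TensorProduct.smul_tmul', map_smul]

theorem PT.mk_smul_right {n : ℕ} (c : k) (x : HT k H n) (m : M) :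
    PT.mk x (c • m) = c • PT.mk x m := by
  rw [PT.mk, PT.mk, TensorProduct.tmul_smul, map_smul]

theorem PT.induction {n : ℕ} {p : PT k H M n → Prop} (zero : p 0)
    (mk : ∀ x m, p (PT.mk x m)) (add : ∀ s t, p s → p t → p (s + t)) (t : PT k H M n) : p t := by
  obtain ⟨y, rfl⟩ : ∃ y, PT.proj k H M n y = t := Submodule.mkQ_surjective _ t
  induction y with
  | zero => rw [map_zero]; exact zero
  | tmul x m => exact mk x m
  | add y z hy hz => rw [map_add]; exact add _ _ hy hz

/-- A balanced `k`-bilinear map induces a linear map on `H^{⊗n} ⊗_H M`. -/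
def PT.lift {Q : Type*} [AddCommGroup Q] [Module k Q] {n : ℕ}
    (F : HT k H n →ₗ[k] M →ₗ[k] Q)
    (hF : ∀ x a m, F (x * iterCop n a) m = F x (a • m)) : PT k H M n →ₗ[k] Q :=
  (balanced k H M n).liftQ (TensorProduct.lift F) (by
    rw [balanced, Submodule.span_le]
    rintro _ ⟨x, a, m, rfl⟩
    simp [hF])

@[simp] theorem PT.lift_mk {Q : Type*} [AddCommGroup Q] [Module k Q] {n : ℕ}
    (F : HT k H n →ₗ[k] M →ₗ[k] Q)
    (hF : ∀ x a m, F (x * iterCop n a) m = F x (a • m)) (x : HT k H n) (m : M) :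
    PT.lift F hF (PT.mk x m) = F x m :=
  (Submodule.liftQ_apply _ _ _).trans (TensorProduct.lift.tmul _ _)

theorem PT.hom_ext {Q : Type*} [AddCommGroup Q] [Module k Q] {n : ℕ}
    {F G : PT k H M n →ₗ[k] Q} (h : ∀ x m, F (PT.mk x m) = G (PT.mk x m)) : F = G := by
  refine LinearMap.ext fun t => ?_
  induction t using PT.induction with
  | zero => rw [map_zero, map_zero]
  | mk x m => exact h x m
  | add s t hs ht => rw [map_add, map_add, hs, ht]

/-- For an algebra homomorphism `θ : H^{⊗n} → H^{⊗m}` compatible with the iterated coproducts,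
and `z ∈ H^{⊗m}`, the map `x ⊗_H m ↦ z θ(x) ⊗_H m`. -/
def PT.push {n m : ℕ} (θ : HT k H n →ₐ[k] HT k H m) (hθ : ∀ a, θ (iterCop n a) = iterCop m a)
    (z : HT k H m) (t : PT k H M n) : PT k H M m :=
  PT.lift (M := M) (Q := PT k H M m)
    (LinearMap.mk₂ k (fun x v => PT.mk (z * θ x) v)
      (fun x y v => by rw [map_add, mul_add, PT.mk_add_left])
      (fun c x v => by rw [map_smul, mul_smul_comm, PT.mk_smul_left])
      (fun x v w => PT.mk_add_right _ _ _)
      (fun c x v => PT.mk_smul_right _ _ _))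
    (fun x a v => by
      simp only [LinearMap.mk₂_apply]
      rw [map_mul, hθ, ← mul_assoc, PT.mk_bal]) t

section push

variable {n m : ℕ} (θ : HT k H n →ₐ[k] HT k H m) (hθ : ∀ a, θ (iterCop n a) = iterCop m a)

theorem PT.push_mk (z : HT k H m) (x : HT k H n) (v : M) :
    PT.push θ hθ z (PT.mk x v) = PT.mk (z * θ x) v := by
  rw [PT.push, PT.lift_mk, LinearMap.mk₂_apply]

theorem PT.push_add (z : HT k H m) (s t : PT k H M n) :
    PT.push θ hθ z (s + t) = PT.push θ hθ z s + PT.push θ hθ z t := map_add _ s t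

theorem PT.push_smul (z : HT k H m) (c : k) (t : PT k H M n) :
    PT.push θ hθ z (c • t) = c • PT.push θ hθ z t := map_smul _ c t

theorem PT.push_zero (z : HT k H m) : PT.push θ hθ z (0 : PT k H M n) = 0 := map_zero _

theorem PT.push_add_left (z z' : HT k H m) (t : PT k H M n) :
    PT.push θ hθ (z + z') t = PT.push θ hθ z t + PT.push θ hθ z' t := by
  induction t using PT.induction with
  | zero => simp only [PT.push_zero, add_zero]
  | mk x v => simp only [PT.push_mk, add_mul, PT.mk_add_left]
  | add s t hs ht => simp only [PT.push_add, hs, ht]; abel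

theorem PT.push_smul_left (c : k) (z : HT k H m) (t : PT k H M n) :
    PT.push θ hθ (c • z) t = c • PT.push θ hθ z t := by
  induction t using PT.induction with
  | zero => simp only [PT.push_zero, smul_zero]
  | mk x v => simp only [PT.push_mk, smul_mul_assoc, PT.mk_smul_left]
  | add s t hs ht => simp only [PT.push_add, hs, ht, smul_add]

end push

theorem id_iterCop {n : ℕ} (a : H) :
    AlgHom.id k (HT k H n) (iterCop n a) = iterCop n a := rfl

/-- The left action of `H^{⊗n}` on `H^{⊗n} ⊗_H M`: `z • (x ⊗_H m) = z x ⊗_H m`. -/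
def PT.act {n : ℕ} (z : HT k H n) (t : PT k H M n) : PT k H M n :=
  PT.push (AlgHom.id k (HT k H n)) id_iterCop z t

/-- `(e ⊗_H id)`: the tensor factor in position `i` is moved to position `e i`. -/
def PT.reindex {n m : ℕ} (e : Fin n ≃ Fin m) (t : PT k H M n) : PT k H M m :=
  PT.push (fibre e.symm) (fibre_iterCop _) 1 t

theorem fibre_symm_slot {n m : ℕ} (e : Fin n ≃ Fin m) (i : Fin n) (a : H) :
    fibre (k := k) e.symm (slot i a) = slot (e i) a := by
  rw [fibre_slot, ← cop_singleton]
  congr 2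
  ext l
  simp [Equiv.symm_apply_eq]

/-- `(id ⊗_H T)`, for an `H`-linear map `T : M → N`. -/
def PT.map [IsScalarTower k H M] [IsScalarTower k H N] {n : ℕ} (T : M →ₗ[H] N)
    (t : PT k H M n) : PT k H N n :=
  PT.lift (M := M) (Q := PT k H N n)
    (LinearMap.mk₂ k (fun x v => PT.mk x (T v))
      (fun x y v => PT.mk_add_left _ _ _)
      (fun c x v => PT.mk_smul_left _ _ _)
      (fun x v w => by rw [map_add, PT.mk_add_right])
      (fun c x v => by
        rw [← algebraMap_smul H c v, map_smul, algebraMap_smul, PT.mk_smul_right]))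
    (fun x a v => by simp only [LinearMap.mk₂_apply, map_smul, PT.mk_bal]) t

/-- An element of `M`, seen in `H ⊗_H M`. -/
def PT.unit (v : M) : PT k H M 1 := PT.mk 1 v

/-! ### Pseudoproducts and their compositions -/

variable (k H M N P) in
/-- `H^{⊗2}`-linear maps `M ⊗ N → H^{⊗2} ⊗_H P`. -/
structure Pseudoproduct where
  /-- the underlying `k`-bilinear map -/
  toFun : M →ₗ[k] N →ₗ[k] PT k H P 2
  map_smul' : ∀ (a b : H) (x : M) (y : N),
    toFun (a • x) (b • y) = PT.act (slot 0 a * slot 1 b) (toFun x y)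

instance : CoeFun (Pseudoproduct k H M N P) fun _ => M → N → PT k H P 2 where
  coe B x y := B.toFun x y

/-- The map `Fin (m + n) → Fin 2` with fibres the first `m` and the last `n` indices. -/
def block₂ (m n : ℕ) : Fin (m + n) → Fin 2 := Fin.addCases (fun _ => 0) (fun _ => 1)

/-- The map `Fin (m + n) → Fin (n + 1)` sending the first `m` indices to `0` and the following
ones to `1, …, n`. -/
def block₁ (m n : ℕ) : Fin (m + n) → Fin (n + 1) := Fin.addCases (fun _ => 0) Fin.succ

theorem PT.act_mk {n : ℕ} (z x : HT k H n) (v : M) : PT.act z (PT.mk x v) = PT.mk (z * x) v :=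
  PT.push_mk _ _ _ _ _

theorem PT.act_add {n : ℕ} (z : HT k H n) (s t : PT k H M n) :
    PT.act z (s + t) = PT.act z s + PT.act z t := PT.push_add _ _ _ _ _

theorem PT.act_zero {n : ℕ} (z : HT k H n) : PT.act z (0 : PT k H M n) = 0 := PT.push_zero _ _ _

theorem PT.push_act {n m : ℕ} (θ : HT k H n →ₐ[k] HT k H m)
    (hθ : ∀ a, θ (iterCop n a) = iterCop m a) (z : HT k H m) (y : HT k H n) (t : PT k H M n) :
    PT.push θ hθ z (PT.act y t) = PT.push θ hθ (z * θ y) t := by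
  induction t using PT.induction with
  | zero => rw [PT.act_zero, PT.push_zero, PT.push_zero]
  | mk x v => rw [PT.act_mk, PT.push_mk, PT.push_mk, map_mul, mul_assoc]
  | add s t hs ht => rw [PT.act_add, PT.push_add, PT.push_add, hs, ht]

theorem block₂_castAdd (m n : ℕ) (i : Fin m) : block₂ m n (Fin.castAdd n i) = 0 := by
  simp [block₂]

theorem block₂_natAdd (m n : ℕ) (i : Fin n) : block₂ m n (Fin.natAdd m i) = 1 := by
  simp [block₂]

theorem image_castAdd (m n : ℕ) : (Finset.univ.image (Fin.castAdd n : Fin m → Fin (m + n))) =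
    Finset.univ.filter fun l => block₂ m n l = 0 := by
  ext l
  simp only [Finset.mem_image, Finset.mem_univ, true_and, Finset.mem_filter]
  refine Fin.addCases (fun i => ?_) (fun i => ?_) l
  · simp [block₂_castAdd]
  · simp only [block₂_natAdd, one_ne_zero, iff_false, not_exists]
    intro x h
    have := congrArg Fin.val h
    simp at this
    omega

theorem image_natAdd (m n : ℕ) : (Finset.univ.image (Fin.natAdd m : Fin n → Fin (m + n))) =
    Finset.univ.filter fun l => block₂ m n l = 1 := by
  ext l
  simp only [Finset.mem_image, Finset.mem_univ, true_and, Finset.mem_filter]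
  refine Fin.addCases (fun i => ?_) (fun i => ?_) l
  · simp only [block₂_castAdd, zero_ne_one, iff_false, not_exists]
    intro x h
    have := congrArg Fin.val h
    simp at this
    omega
  · simp [block₂_natAdd]

theorem filter_block₁ (m n : ℕ) : (Finset.univ.filter fun l => block₁ m n l = 0) =
    Finset.univ.image (Fin.castAdd n : Fin m → Fin (m + n)) := by
  rw [image_castAdd]
  ext l
  simp only [Finset.mem_univ, true_and, Finset.mem_filter]
  refine Fin.addCases (fun i => ?_) (fun i => ?_) l
  · simp [block₁, block₂]
  · simp [block₁, block₂, Fin.succ_ne_zero]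

/-- The composition `B(F, G) ∈ H^{⊗(m+n)} ⊗_H P` of a pseudoproduct `B` with `F ∈ H^{⊗m} ⊗_H M`
and `G ∈ H^{⊗n} ⊗_H N`: if `B(v, w) = ∑ y ⊗_H c` then
`B(f ⊗_H v, g ⊗_H w) = ∑ (f ⊗ g) (Δ^{m-1} ⊗ Δ^{n-1})(y) ⊗_H c`. -/
def Pseudoproduct.comp (B : Pseudoproduct k H M N P) {m n : ℕ} (F : PT k H M m) (G : PT k H N n) :
    PT k H P (m + n) :=
  PT.lift (M := M) (Q := PT k H N n →ₗ[k] PT k H P (m + n))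
    (LinearMap.mk₂ k
      (fun f v => PT.lift (M := N) (Q := PT k H P (m + n))
        (LinearMap.mk₂ k
          (fun g w => PT.push (fibre (block₂ m n)) (fibre_iterCop _)
            (place (Fin.castAdd n) (Fin.castAdd_injective m n) f *
              place (Fin.natAdd m) (Fin.natAdd_injective n m) g) (B.toFun v w))
          (fun g g' w => by rw [map_add, mul_add, PT.push_add_left])
          (fun c g w => by rw [map_smul, mul_smul_comm, PT.push_smul_left])
          (fun g w w' => by rw [map_add, PT.push_add])
          (fun c g w => by rw [map_smul, PT.push_smul]))
        (fun g b w => by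
          have h := B.map_smul' 1 b v w
          rw [one_smul, map_one, one_mul] at h
          simp only [LinearMap.mk₂_apply]
          rw [h, PT.push_act, map_mul (place _ _), place_iterCop, fibre_slot, image_natAdd,
            mul_assoc]))
      (fun f f' v => by
        refine PT.hom_ext fun g w => ?_
        simp only [PT.lift_mk, LinearMap.mk₂_apply, map_add, add_mul, LinearMap.add_apply,
          PT.push_add_left])
      (fun c f v => by
        refine PT.hom_ext fun g w => ?_
        simp only [PT.lift_mk, LinearMap.mk₂_apply, map_smul, smul_mul_assoc,
          LinearMap.smul_apply, PT.push_smul_left])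
      (fun f v v' => by
        refine PT.hom_ext fun g w => ?_
        simp only [PT.lift_mk, LinearMap.mk₂_apply, map_add, LinearMap.add_apply, PT.push_add])
      (fun c f v => by
        refine PT.hom_ext fun g w => ?_
        simp only [PT.lift_mk, LinearMap.mk₂_apply, map_smul, LinearMap.smul_apply,
          PT.push_smul]))
    (fun f a v => by
      refine PT.hom_ext fun g w => ?_
      have h := B.map_smul' a 1 v w
      rw [one_smul, map_one, mul_one] at h
      simp only [PT.lift_mk, LinearMap.mk₂_apply]
      rw [h, PT.push_act, map_mul (place _ _), place_iterCop, fibre_slot, image_castAdd,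
        mul_assoc, mul_assoc]
      congr 2
      refine (place_commute _ _ _ (fun i => ?_) g a).eq.symm
      simp [block₂_natAdd]) F G

theorem Pseudoproduct.comp_mk (B : Pseudoproduct k H M N P) {m n : ℕ} (f : HT k H m) (v : M)
    (g : HT k H n) (w : N) :
    B.comp (PT.mk f v) (PT.mk g w) = PT.push (fibre (block₂ m n)) (fibre_iterCop _)
      (place (Fin.castAdd n) (Fin.castAdd_injective m n) f *
        place (Fin.natAdd m) (Fin.natAdd_injective n m) g) (B.toFun v w) := by
  rw [Pseudoproduct.comp, PT.lift_mk, LinearMap.mk₂_apply, PT.lift_mk, LinearMap.mk₂_apply]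

/-! ### Cochains -/

variable (k H M N) in
/-- `C^n(M, N)`: the `H^{⊗n}`-linear maps `f : M^{⊗n} → H^{⊗n} ⊗_H N` which are skew-symmetric,
`f(u₁, …, uₙ) = (-1)^σ (σ ⊗_H id) f(u_{σ(1)}, …, u_{σ(n)})`. -/
def Cochain (n : ℕ) : Submodule k (MultilinearMap k (fun _ : Fin n => M) (PT k H N n)) where
  carrier := {f |
    (∀ (u : Fin n → M) (i : Fin n) (a : H),
      f (Function.update u i (a • u i)) = PT.act (slot i a) (f u)) ∧
    (∀ (σ : Equiv.Perm (Fin n)) (u : Fin n → M),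
      f u = ((Equiv.Perm.sign σ : ℤ) : k) • PT.reindex σ (f fun s => u (σ s)))}
  add_mem' := by
    rintro f g ⟨hf, hf'⟩ ⟨hg, hg'⟩
    refine ⟨fun u i a => ?_, fun σ u => ?_⟩
    · change f _ + g _ = PT.act _ (f u + g u)
      rw [hf, hg]
      exact (PT.push_add _ _ _ _ _).symm
    · change f u + g u = _ • PT.reindex σ (f _ + g _)
      rw [PT.reindex, PT.push_add, smul_add]
      exact congrArg₂ (· + ·) (hf' σ u) (hg' σ u)
  zero_mem' :=
    ⟨fun u i a => (PT.push_zero _ _ _).symm, fun σ u =>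
      ((congrArg _ (PT.push_zero _ _ _)).trans (smul_zero _)).symm⟩
  smul_mem' := by
    rintro c f ⟨hf, hf'⟩
    refine ⟨fun u i a => ?_, fun σ u => ?_⟩
    · change c • f _ = PT.act _ (c • f u)
      rw [hf]
      exact (PT.push_smul _ _ _ _ _).symm
    · change c • f u = _ • PT.reindex σ (c • f _)
      rw [PT.reindex, PT.push_smul, smul_comm]
      exact congrArg (c • ·) (hf' σ u)

instance {n : ℕ} : CoeFun (Cochain k H M N n) fun _ => (Fin n → M) → PT k H N n where
  coe f := f.1

/-- `f(F, v₁, …, vₙ) ∈ H^{⊗(m+n)} ⊗_H N` for `f ∈ C^{n+1}(M, N)` and `F ∈ H^{⊗m} ⊗_H M`: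
if `f(w, v₁, …, vₙ) = ∑ y ⊗_H c` then
`f(g ⊗_H w, v₁, …, vₙ) = ∑ (g ⊗ 1^{⊗n}) (Δ^{m-1} ⊗ id^{⊗n})(y) ⊗_H c`. -/
def Cochain.insert {n : ℕ} (f : Cochain k H M N (n + 1)) {m : ℕ} (F : PT k H M m)
    (v : Fin n → M) : PT k H N (m + n) :=
  PT.lift (M := M) (Q := PT k H N (m + n))
    (LinearMap.mk₂ k
      (fun g w => PT.push (fibre (block₁ m n)) (fibre_iterCop _)
        (place (Fin.castAdd n) (Fin.castAdd_injective m n) g) (f.1 (Fin.cons w v)))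
      (fun g g' w => by rw [map_add, PT.push_add_left])
      (fun c g w => by rw [map_smul, PT.push_smul_left])
      (fun g w w' => by rw [MultilinearMap.cons_add, PT.push_add])
      (fun c g w => by rw [MultilinearMap.cons_smul, PT.push_smul]))
    (fun g a w => by
      have h := f.2.1 (Fin.cons w v) 0 a
      rw [Fin.cons_zero, Fin.update_cons_zero] at h
      simp only [LinearMap.mk₂_apply]
      rw [h, PT.push_act, map_mul, place_iterCop, fibre_slot, filter_block₁])
    F

/-- An `H`-linear map `T : M → N` as the element `u ↦ 1 ⊗_H T(u)` of `C¹(M, N)`. -/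
def Cochain.ofHom [IsScalarTower k H M] [IsScalarTower k H N] (T : M →ₗ[H] N) :
    Cochain k H M N 1 :=
  ⟨{ toFun := fun u => PT.unit (T (u 0))
     map_update_add' := fun u i x y => by
       obtain rfl := Subsingleton.elim i 0
       simp [PT.unit, PT.mk_add_right]
     map_update_smul' := fun u i c x => by
       obtain rfl := Subsingleton.elim i 0
       simp only [PT.unit, Function.update_self]
       rw [← algebraMap_smul H c x, map_smul, algebraMap_smul, PT.mk_smul_right] },
   fun u i a => by
      obtain rfl := Subsingleton.elim i 0
      change PT.unit (T (Function.update u 0 (a • u 0) 0)) = PT.act _ (PT.unit (T (u 0)))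
      rw [Function.update_self, map_smul, PT.unit, PT.unit, PT.act_mk, ← PT.mk_bal, one_mul,
        mul_one, iterCop, ← cop_singleton]
      rfl,
   fun σ u => by
      obtain rfl := Subsingleton.elim σ 1
      change PT.unit (T (u 0)) = _ • PT.reindex 1 (PT.unit (T (u 0)))
      simp [PT.unit, PT.reindex, PT.push_mk]⟩

end PT

/-! ### Lie pseudoalgebras and matched pairs -/

section Lie

variable (k H : Type*) [Field k] [Ring H] [Bialgebra k H] [Coalgebra.IsCocomm k H]

/-- A Lie pseudobracket on the `H`-module `L`. -/
structure LiePseudoalgebra (L : Type*) [AddCommGroup L] [Module k L] [Module H L] where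
  /-- the pseudobracket `[x * y]` -/
  bracket : Pseudoproduct k H L L L
  skew : ∀ x y, bracket x y = -PT.reindex (Equiv.swap 0 1) (bracket y x)
  jacobi : ∀ x y z,
    bracket.comp (PT.unit x) (bracket y z) =
      bracket.comp (bracket x y) (PT.unit z) +
        PT.reindex (Equiv.swap (0 : Fin 3) 1) (bracket.comp (PT.unit y) (bracket x z))

variable {k H}
variable {𝔤 𝔥 : Type*} [AddCommGroup 𝔤] [Module k 𝔤] [Module H 𝔤]
variable [AddCommGroup 𝔥] [Module k 𝔥] [Module H 𝔥]

/-- `B` is a representation of the Lie pseudoalgebra `L` on `M`. -/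
def IsRepresentation {L M : Type*} [AddCommGroup L] [Module k L] [Module H L]
    [AddCommGroup M] [Module k M] [Module H M]
    (𝓛 : LiePseudoalgebra k H L) (B : Pseudoproduct k H L M M) : Prop :=
  ∀ x y m, B.comp (𝓛.bracket x y) (PT.unit m) =
    B.comp (PT.unit x) (B y m) -
      PT.reindex (Equiv.swap (0 : Fin 3) 1) (B.comp (PT.unit y) (B x m))

/-- The permutation `(h₁, h₂, h₃) ↦ (h₂, h₃, h₁)` of positions: `0 ↦ 2`, `1 ↦ 0`, `2 ↦ 1`. -/
def cyc : Equiv.Perm (Fin 3) := (finRotate 3).symm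

/-- A matched pair `(𝔤, 𝔥; ρ, η)` of Lie pseudoalgebras. -/
structure MatchedPair (𝓰 : LiePseudoalgebra k H 𝔤) (𝓱 : LiePseudoalgebra k H 𝔥) where
  /-- the action of `𝔤` on `𝔥` -/
  ρ : Pseudoproduct k H 𝔤 𝔥 𝔥
  /-- the action of `𝔥` on `𝔤` -/
  η : Pseudoproduct k H 𝔥 𝔤 𝔤
  rep_ρ : IsRepresentation 𝓰 ρ
  rep_η : IsRepresentation 𝓱 η
  compat_ρ : ∀ x u v,
    ρ.comp (PT.unit x) (𝓱.bracket u v) =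
      𝓱.bracket.comp (ρ x u) (PT.unit v) +
        PT.reindex (Equiv.swap (0 : Fin 3) 1)
          (𝓱.bracket.comp (PT.unit u) (ρ x v) - ρ.comp (η u x) (PT.unit v)) +
        PT.reindex cyc (ρ.comp (η v x) (PT.unit u))
  compat_η : ∀ u x y,
    η.comp (PT.unit u) (𝓰.bracket x y) =
      𝓰.bracket.comp (η u x) (PT.unit y) +
        PT.reindex (Equiv.swap (0 : Fin 3) 1)
          (𝓰.bracket.comp (PT.unit x) (η u y) - η.comp (ρ x u) (PT.unit y)) +
        PT.reindex cyc (η.comp (ρ y u) (PT.unit x))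

/-! ### Permutations of the arguments -/

/-- The permutation `σ` with `σ 0 = i` which is increasing on the other positions. -/
def front {n : ℕ} (i : Fin (n + 1)) : Equiv.Perm (Fin (n + 1)) :=
  (finSuccEquiv' 0).trans (finSuccEquiv' i).symm

/-- The permutation `σ` with `σ (last) = i` which is increasing on the other positions. -/
def back {n : ℕ} (i : Fin (n + 1)) : Equiv.Perm (Fin (n + 1)) :=
  (finSuccEquiv' (Fin.last n)).trans (finSuccEquiv' i).symm

/-- For `i` and `j = i.succAbove j'`, the permutation `σ` with `σ 0 = i`, `σ 1 = j` which is
increasing on the other positions. -/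
def front₂ {n : ℕ} (i : Fin (n + 2)) (j' : Fin (n + 1)) : Equiv.Perm (Fin (n + 2)) :=
  (finSuccEquiv' 0).trans ((front j').optionCongr.trans (finSuccEquiv' i).symm)

/-- The permutations of `n` letters which are increasing on the first `a` positions and on the
positions `≥ b`.  For `n = p + q` and `a = b = p` these are the `(p, q)`-unshuffles `S(p, q)`;
for `a = q`, `b = q + 1` they form `S(q, 1, p - 1)`. -/
def unshuffles (n a b : ℕ) : Finset (Equiv.Perm (Fin n)) :=
  Finset.univ.filter fun σ =>
    (∀ i j : Fin n, i < j → (j : ℕ) < a → σ i < σ j) ∧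
    (∀ i j : Fin n, i < j → b ≤ (i : ℕ) → σ i < σ j)

/-- The sign `(-1)^σ` in `k`. -/
def sgn (k : Type*) [Field k] {n : ℕ} (σ : Equiv.Perm (Fin n)) : k :=
  ((Equiv.Perm.sign σ : ℤ) : k)

/-- `σ ⊗_H id`: the tensor factor in position `s` is moved to position `σ s`. -/
def PT.perm {m n : ℕ} (h : m = n) (σ : Equiv.Perm (Fin n)) (t : PT k H 𝔤 m) : PT k H 𝔤 n :=
  PT.reindex ((finCongr h).trans σ) t

/-! ### Differential graded Lie algebras -/

/-- A differential graded Lie algebra structure on a graded vector space `⨁_{n ≥ 1} Vₙ`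
concentrated in positive degrees, where `V p` is the component of degree `p + 1`. -/
structure IsDGLieAlgebra {V : ℕ → Type*} [∀ n, AddCommGroup (V n)] [∀ n, Module k (V n)]
    (d : ∀ p, V p →ₗ[k] V (p + 1)) (br : ∀ p q, V p →ₗ[k] V q →ₗ[k] V (p + q + 1)) : Prop where
  d_d : ∀ p (x : V p), d (p + 1) (d p x) = 0
  skew : ∀ p q (x : V p) (y : V q),
    DirectSum.of V _ (br p q x y) =
      -((-1 : k) ^ ((p + 1) * (q + 1)) • DirectSum.of V _ (br q p y x))
  leibniz : ∀ p q (x : V p) (y : V q),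
    DirectSum.of V _ (d _ (br p q x y)) =
      DirectSum.of V _ (br _ q (d p x) y) +
        (-1 : k) ^ (p + 1) • DirectSum.of V _ (br p _ x (d q y))
  jacobi : ∀ p q r (x : V p) (y : V q) (z : V r),
    DirectSum.of V _ (br p _ x (br q r y z)) =
      DirectSum.of V _ (br _ r (br p q x y) z) +
        (-1 : k) ^ ((p + 1) * (q + 1)) • DirectSum.of V _ (br q _ y (br p r x z))

/-- The Maurer–Cartan equation `dx + ½ [x, x] = 0`, for `x` of degree `1`. -/
def IsMaurerCartan {V : ℕ → Type*} [∀ n, AddCommGroup (V n)] [∀ n, Module k (V n)]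
    (d : ∀ p, V p →ₗ[k] V (p + 1)) (br : ∀ p q, V p →ₗ[k] V q →ₗ[k] V (p + q + 1))
    (x : V 0) : Prop :=
  d 0 x + (1 / 2 : k) • br 0 0 x x = 0

/-! ### The controlling algebra of a matched pair -/

variable (k H 𝔤 𝔥) in
/-- The graded space `⨁_{n ≥ 1} Cⁿ(𝔥, 𝔤)`: the component of degree `n + 1` is `C^{n+1}(𝔥, 𝔤)`. -/
abbrev CochainSpace (n : ℕ) : Type _ := Cochain k H 𝔥 𝔤 (n + 1)

namespace MatchedPair

variable {𝓰 : LiePseudoalgebra k H 𝔤} {𝓱 : LiePseudoalgebra k H 𝔥} (P : MatchedPair 𝓰 𝓱)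

/-- Deformation maps of the matched pair:
`[T(u) * T(v)] + η(u ⊗ T(v)) - (12) η(v ⊗ T(u)) = T([u * v] + ρ(T(u) ⊗ v) - (12) ρ(T(v) ⊗ u))`. -/
def IsDeformationMap [IsScalarTower k H 𝔤] [IsScalarTower k H 𝔥] (T : 𝔥 →ₗ[H] 𝔤) : Prop :=
  ∀ u v, 𝓰.bracket (T u) (T v) + P.η u (T v) - PT.reindex (Equiv.swap 0 1) (P.η v (T u)) =
    PT.map T (𝓱.bracket u v + P.ρ (T u) v - PT.reindex (Equiv.swap 0 1) (P.ρ (T v) u))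

/-- `∑_{i<j} (-1)^{p+i+j-1} (σ_{i,j} ⊗_H id) f(K(u_i, u_j) ⊗ u₁ ⊗ ⋯ û_i ⋯ û_j ⋯ ⊗ u_{p+1})` for
`f ∈ C^p`, `p = n + 1`; here `j = i.succAbove j'`, and the indices are counted from `0`. -/
def pairSum {n : ℕ} (K : 𝔥 → 𝔥 → PT k H 𝔥 2) (f : Cochain k H 𝔥 𝔤 (n + 1))
    (u : Fin (n + 2) → 𝔥) : PT k H 𝔤 (n + 2) :=
  ∑ i : Fin (n + 2), ∑ j' : Fin (n + 1),
    if i < i.succAbove j' then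
      (-1 : k) ^ ((n + 1) + ((i : ℕ) + 1) + ((i.succAbove j' : ℕ) + 1) - 1) •
        PT.perm (by omega) (front₂ i j')
          (Cochain.insert f (K (u i) (u (i.succAbove j'))) fun s => u (i.succAbove (j'.succAbove s)))
    else 0

/-- The formula for the differential `d : C^p(𝔥, 𝔤) → C^{p+1}(𝔥, 𝔤)`, `p = n + 1`. -/
def dFormula {n : ℕ} (f : Cochain k H 𝔥 𝔤 (n + 1)) (u : Fin (n + 2) → 𝔥) : PT k H 𝔤 (n + 2) :=
  (∑ i : Fin (n + 2), (-1 : k) ^ ((n + 1) + ((i : ℕ) + 1)) •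
    PT.perm (by omega) (front i)
      (P.η.comp (PT.unit (u i)) (f fun s => u (i.succAbove s)))) +
  pairSum (fun v w => 𝓱.bracket v w) f u

/-- The formula for the bracket `C^p(𝔥, 𝔤) × C^q(𝔥, 𝔤) → C^{p+q}(𝔥, 𝔤)`, with `p = a + 1` and
`q = b + 1`. -/
def bracketFormula {a b : ℕ} (f₁ : Cochain k H 𝔥 𝔤 (a + 1)) (f₂ : Cochain k H 𝔥 𝔤 (b + 1))
    (u : Fin (a + b + 2) → 𝔥) : PT k H 𝔤 (a + b + 2) :=
  -(∑ σ ∈ unshuffles (a + b + 2) (b + 1) (b + 2), sgn k σ • PT.perm (by omega) σ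
      (Cochain.insert f₁
        (P.ρ.comp (f₂ fun s : Fin (b + 1) => u (σ ⟨s, by omega⟩))
          (PT.unit (u (σ ⟨b + 1, by omega⟩))))
        fun s : Fin a => u (σ ⟨b + 2 + s, by omega⟩))) +
  (-1 : k) ^ ((a + 1) * (b + 1)) •
    (∑ σ ∈ unshuffles (a + b + 2) (a + 1) (a + 2), sgn k σ • PT.perm (by omega) σ
      (Cochain.insert f₂
        (P.ρ.comp (f₁ fun s : Fin (a + 1) => u (σ ⟨s, by omega⟩))
          (PT.unit (u (σ ⟨a + 1, by omega⟩))))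
        fun s : Fin b => u (σ ⟨a + 2 + s, by omega⟩))) -
  (-1 : k) ^ ((a + 1) * (b + 1)) •
    (∑ σ ∈ unshuffles (a + b + 2) (a + 1) (a + 1), sgn k σ • PT.perm (by omega) σ
      (𝓰.bracket.comp
        (f₁ fun s : Fin (a + 1) => u (σ ⟨s, by omega⟩))
        (f₂ fun s : Fin (b + 1) => u (σ ⟨a + 1 + s, by omega⟩))))

/-- The formula for the twisted differential `d^T : C^p(𝔥, 𝔤) → C^{p+1}(𝔥, 𝔤)`, `p = n + 1`. -/
def dTwistFormula [IsScalarTower k H 𝔤] [IsScalarTower k H 𝔥] (T : 𝔥 →ₗ[H] 𝔤) {n : ℕ}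
    (f : Cochain k H 𝔥 𝔤 (n + 1)) (u : Fin (n + 2) → 𝔥) : PT k H 𝔤 (n + 2) :=
  (∑ i : Fin (n + 2), (-1 : k) ^ ((n + 1) + ((i : ℕ) + 1)) •
    PT.perm (by omega) (front i)
      (P.η.comp (PT.unit (u i)) (f fun s => u (i.succAbove s)))) +
  pairSum (fun v w => 𝓱.bracket v w) f u +
  (∑ i : Fin (n + 2), (-1 : k) ^ ((n + 1) + ((i : ℕ) + 1)) •
    PT.perm (by omega) (back i)
      (PT.map T (P.ρ.comp (f fun s => u (i.succAbove s)) (PT.unit (u i))))) +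
  pairSum (fun v w => P.ρ (T v) w - PT.reindex (Equiv.swap 0 1) (P.ρ (T w) v)) f u +
  (∑ i : Fin (n + 2), (-1 : k) ^ ((n + 1) + ((i : ℕ) + 1)) •
    PT.perm (by omega) (front i)
      (𝓰.bracket.comp (PT.unit (T (u i))) (f fun s => u (i.succAbove s))))

end MatchedPair

end Lie

end LiePseudo

end

/-! The complex is realised inside the cochains of one larger module, where the differential graded
Lie structure becomes formal. Put W = 𝔤 × 𝔥. On ⨁ C^{n+1}(W, W) there is the Nijenhuis–Richardson
product f ∘ g (`circ`): insert g into the first argument of f, alternate over all arguments, and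
divide by the factorials that count repetitions. In (f ∘ g) ∘ q − f ∘ (g ∘ q) only those terms
survive in which g and q occupy two different arguments of f, so the associator is graded symmetric
in g and q (`circ_assoc_symm`). Thus ∘ is a graded right-symmetric pre-Lie product, and its graded
commutator satisfies the Jacobi identity (`lie_jacobi`).

The matched pair defines a skew pseudoproduct on W, that of the bicrossed product
(`MatchedPair.total`). Its square under ∘ is minus its Jacobiator (`circ_ofPseudo_self`), and the
components of the Jacobi identity are the axioms of the two Lie pseudoalgebras, the two
representation identities and the two compatibility conditions. Hence the structure cochain squares
to zero. It is a sum Y + X, with Y made of the bracket of 𝔥 and η, and X of the bracket of 𝔤 and ρ.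
Each summand comes from a degenerate matched pair, so [Y, Y] = 0 and [X, X] = 0, and therefore [Y,
X] = 0 as well.

Restricting arguments along W → 𝔥 and extending values along 𝔤 → W embeds C^n(𝔥, 𝔤) in C^n(W, W)
(`hat`). Products of two elements of the image vanish, because values lie in 𝔤 while arguments only
see 𝔥. Under these circumstances [Y, ·] and the derived bracket (-1)^a [[X, x], y] make the image a
differential graded Lie algebra (`isDGLieAlgebra_of_derived`). The derived bracket raises the
commutator degree by one, which is why a cochain with n arguments has degree n and not n − 1. The
stated formulas follow by evaluating ∘ on embedded cochains and collapsing alternations to sums over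
coset representatives (`differential_formula`, `bracket_formula`, `twistedDifferential_formula`).

In degree one, H ⊗_H M ≅ M identifies C¹(𝔥, 𝔤) with the H-linear maps, and the Maurer–Cartan
equation evaluated on two arguments is the deformation equation (`isMaurerCartan_iff`). The twisted
differential is the commutator with Y + [X, T]; the Maurer–Cartan equation of T is what makes this
element square to zero, and it always commutes with X (`lie_twist`). Expanding the Maurer–Cartan
equation at T + T' yields the one of T' for the twisted differential (`isMaurerCartan_add`). -/

open scoped TensorProduct

noncomputable section

namespace LiePseudo

/-! ### Calculus of the homomorphisms that place and spread tensor factors -/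

section Spread

variable {k H : Type*} [Field k] [Ring H] [Bialgebra k H]

/-- The single-factor elements generate `H^{⊗n}` as an algebra. Every identity between placements
and spreadings below is reduced by this to an identity of position sets. -/
theorem HT.algHom_ext {n : ℕ} {A : Type*} [Ring A] [Algebra k A] {θ θ' : HT k H n →ₐ[k] A}
    (h : ∀ i a, θ (slot i a) = θ' (slot i a)) : θ = θ' :=
  PiTensorProduct.algHom_ext fun i => AlgHom.ext fun a => h i a

variable [Coalgebra.IsCocomm k H]

theorem place_slot {n m : ℕ} (j : Fin n → Fin m) (hj : Function.Injective j) (i : Fin n) (a : H) :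
    place (k := k) j hj (slot i a) = slot (j i) a := by
  rw [place, spread_slot, cop_singleton]

/-- On one factor both sides are the iterated coproduct over the preimage of its position under `p ∘
q`; `spread_cop` packages coassociativity and cocommutativity. So `p ↦ fibre p` is a contravariant
functor. -/
theorem fibre_comp {l m n : ℕ} (p : Fin m → Fin n) (q : Fin l → Fin m) (x : HT k H n) :
    fibre q (fibre p x) = fibre (p ∘ q) x := by
  have : ((fibre q).comp (fibre p) : HT k H n →ₐ[k] HT k H l) = fibre (p ∘ q) := by
    refine HT.algHom_ext fun i a => ?_
    simp only [AlgHom.comp_apply, fibre_slot]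
    rw [fibre, spread_cop]
    congr 2
    ext x
    simp
  exact DFunLike.congr_fun this x

theorem fibre_id {n : ℕ} (x : HT k H n) : fibre (fun i => i) x = x := by
  have : (fibre (fun i => i) : HT k H n →ₐ[k] HT k H n) = AlgHom.id k _ := by
    refine HT.algHom_ext fun i a => ?_
    rw [fibre_slot, AlgHom.id_apply, ← cop_singleton]
    congr 2
    ext x
    simp
  exact DFunLike.congr_fun this x

theorem place_place {l m n : ℕ} (i : Fin l → Fin m) (hi : Function.Injective i)
    (j : Fin m → Fin n) (hj : Function.Injective j) (x : HT k H l) :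
    place j hj (place i hi x) = place (j ∘ i) (hj.comp hi) x := by
  have : ((place j hj).comp (place i hi) : HT k H l →ₐ[k] HT k H n) =
      place (j ∘ i) (hj.comp hi) := by
    refine HT.algHom_ext fun s a => ?_
    simp only [AlgHom.comp_apply, place_slot, Function.comp]
  exact DFunLike.congr_fun this x

/-- Spreading after placing is placing after spreading. -/
theorem fibre_place {l m m' n : ℕ} (p : Fin n → Fin m) (j : Fin l → Fin m)
    (hj : Function.Injective j) (j' : Fin m' → Fin n) (hj' : Function.Injective j')
    (p' : Fin m' → Fin l) (h : ∀ s, p (j' s) = j (p' s))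
    (hr : ∀ t s, p t = j s → ∃ r, j' r = t) (x : HT k H l) :
    fibre p (place j hj x) = place j' hj' (fibre p' x) := by
  have : ((fibre p).comp (place j hj) : HT k H l →ₐ[k] HT k H n) =
      (place j' hj').comp (fibre p') := by
    refine HT.algHom_ext fun i a => ?_
    simp only [AlgHom.comp_apply, place_slot, fibre_slot]
    rw [place, spread_cop]
    congr 2
    ext t
    simp only [Finset.mem_filter, Finset.mem_univ, true_and, Finset.mem_biUnion,
      Finset.mem_singleton]
    constructor
    · intro ht
      obtain ⟨r, rfl⟩ := hr t i ht
      exact ⟨r, hj ((h r).symm.trans ht), rfl⟩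
    · rintro ⟨r, rfl, rfl⟩
      exact h r
  exact DFunLike.congr_fun this x

theorem fibre_place_eq_place {l m n : ℕ} (p : Fin n → Fin m) (j : Fin l → Fin m)
    (hj : Function.Injective j) (j' : Fin l → Fin n) (hj' : Function.Injective j')
    (h : ∀ s, p (j' s) = j s) (hr : ∀ t s, p t = j s → j' s = t) (x : HT k H l) :
    fibre p (place j hj x) = place j' hj' x := by
  rw [fibre_place p j hj j' hj' (fun i => i) h fun t s e => ⟨s, hr t s e⟩, fibre_id]

theorem fibre_symm_place {l m n : ℕ} (e : Fin m ≃ Fin n) (j : Fin l → Fin m)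
    (hj : Function.Injective j) (x : HT k H l) :
    fibre e.symm (place j hj x) = place (e ∘ j) (e.injective.comp hj) x :=
  fibre_place_eq_place _ _ _ _ _ (fun s => by simp) (fun t s h => by simp [← h]) x

theorem fibre_symm_eq_place {m n : ℕ} (e : Fin m ≃ Fin n) (x : HT k H m) :
    fibre e.symm x = place e e.injective x := by
  have : (fibre e.symm : HT k H m →ₐ[k] HT k H n) = place e e.injective :=
    HT.algHom_ext fun i a => by rw [place_slot, fibre_symm_slot]
  rw [this]

theorem place_congr {n m : ℕ} {j j' : Fin n → Fin m} (h : j = j') (hj : Function.Injective j)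
    (hj' : Function.Injective j') (x : HT k H n) : place j hj x = place j' hj' x := by
  subst h; rfl

/-- `H` need not be commutative, so reordering coefficients is allowed only because they sit in
disjoint positions. -/
theorem place_place_commute {l m n : ℕ} (i : Fin l → Fin n) (hi : Function.Injective i)
    (j : Fin m → Fin n) (hj : Function.Injective j) (h : ∀ s t, i s ≠ j t)
    (x : HT k H l) (y : HT k H m) : Commute (place i hi x) (place j hj y) := by
  refine spread_commute _ _ _ (fun s a => ?_) x
  refine (spread_commute _ _ _ (fun t b => ?_) y).symm
  exact cop_commute (by simpa using (h s t).symm) _ _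

end Spread

/-! ### Linear operations on `H^{⊗n} ⊗_H M` -/

section PT

variable {k H : Type*} [Field k] [Ring H] [Bialgebra k H] [Coalgebra.IsCocomm k H]
variable {M N P : Type*} [AddCommGroup M] [Module k M] [Module H M]
variable [AddCommGroup N] [Module k N] [Module H N]
variable [AddCommGroup P] [Module k P] [Module H P]

/-- `x ⊗_H m ↦ z p^*(x) ⊗_H m`, where `p^*` spreads the factors over the fibres of `p`. -/
def PT.spr {n m : ℕ} (p : Fin m → Fin n) (z : HT k H m) : PT k H M n →ₗ[k] PT k H M m where
  toFun t := PT.push (fibre p) (fibre_iterCop p) z t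
  map_add' := PT.push_add _ _ _
  map_smul' := PT.push_smul _ _ _

theorem PT.spr_mk {n m : ℕ} (p : Fin m → Fin n) (z : HT k H m) (x : HT k H n) (v : M) :
    PT.spr p z (PT.mk x v) = PT.mk (z * fibre p x) v :=
  PT.push_mk _ (fibre_iterCop p) _ _ _

/-- Reindexing, the left action and the pieces of all compositions are instances of `PT.spr`. With
this rule an identity between them becomes one equality of maps of positions and one of
coefficients. -/
theorem PT.spr_spr {l m n : ℕ} (p : Fin m → Fin n) (q : Fin l → Fin m) (z : HT k H m)
    (y : HT k H l) (t : PT k H M n) :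
    PT.spr q y (PT.spr p z t) = PT.spr (p ∘ q) (y * fibre q z) t := by
  induction t using PT.induction with
  | zero => simp
  | mk x v => simp only [PT.spr_mk, map_mul, fibre_comp, mul_assoc]
  | add s t hs ht => simp only [map_add, hs, ht]

theorem PT.spr_add_left {n m : ℕ} (p : Fin m → Fin n) (z z' : HT k H m) (t : PT k H M n) :
    PT.spr p (z + z') t = PT.spr p z t + PT.spr p z' t :=
  PT.push_add_left _ (fibre_iterCop p) _ _ _

theorem PT.spr_smul_left {n m : ℕ} (p : Fin m → Fin n) (c : k) (z : HT k H m) (t : PT k H M n) :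
    PT.spr p (c • z) t = c • PT.spr p z t :=
  PT.push_smul_left _ (fibre_iterCop p) _ _ _

theorem PT.spr_id {n : ℕ} (t : PT k H M n) : PT.spr (fun i => i) 1 t = t := by
  induction t using PT.induction with
  | zero => simp
  | mk x v => rw [PT.spr_mk, fibre_id, one_mul]
  | add s t hs ht => simp only [map_add, hs, ht]

theorem PT.act_eq_spr {n : ℕ} (z : HT k H n) (t : PT k H M n) :
    PT.act z t = PT.spr (fun i => i) z t := by
  induction t using PT.induction with
  | zero => rw [PT.act_zero, map_zero]
  | mk x v => rw [PT.act_mk, PT.spr_mk, fibre_id]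
  | add s t hs ht => rw [PT.act_add, map_add, hs, ht]

theorem PT.spr_act {n m : ℕ} (p : Fin m → Fin n) (z : HT k H m) (y : HT k H n)
    (t : PT k H M n) : PT.spr p z (PT.act y t) = PT.spr p (z * fibre p y) t := by
  rw [PT.act_eq_spr, PT.spr_spr]; rfl

theorem PT.act_spr {n m : ℕ} (p : Fin m → Fin n) (z y : HT k H m) (t : PT k H M n) :
    PT.act y (PT.spr p z t) = PT.spr p (y * z) t := by
  rw [PT.act_eq_spr, PT.spr_spr, fibre_id]; rfl

theorem PT.act_smul {n : ℕ} (z : HT k H n) (c : k) (t : PT k H M n) :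
    PT.act z (c • t) = c • PT.act z t := by
  rw [PT.act_eq_spr, PT.act_eq_spr, map_smul]

theorem PT.act_sum {n : ℕ} (z : HT k H n) {ι : Type*} (s : Finset ι) (t : ι → PT k H M n) :
    PT.act z (∑ i ∈ s, t i) = ∑ i ∈ s, PT.act z (t i) := by
  simp only [PT.act_eq_spr, map_sum]

/-- `PT.reindex` as a linear map. -/
def PT.rx {n m : ℕ} (e : Fin n ≃ Fin m) : PT k H M n →ₗ[k] PT k H M m := PT.spr e.symm 1

theorem PT.rx_mk {n m : ℕ} (e : Fin n ≃ Fin m) (x : HT k H n) (v : M) :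
    PT.rx e (PT.mk x v) = PT.mk (fibre e.symm x) v := by
  rw [PT.rx, PT.spr_mk, one_mul]

theorem PT.reindex_eq {n m : ℕ} (e : Fin n ≃ Fin m) (t : PT k H M n) :
    PT.reindex e t = PT.rx e t := rfl

theorem PT.rx_rx {l m n : ℕ} (e : Fin n ≃ Fin m) (e' : Fin m ≃ Fin l) (t : PT k H M n) :
    PT.rx e' (PT.rx e t) = PT.rx (e.trans e') t := by
  rw [PT.rx, PT.rx, PT.spr_spr, map_one, mul_one]; rfl

theorem PT.rx_spr {l m n : ℕ} (p : Fin m → Fin n) (e : Fin m ≃ Fin l) (z : HT k H m)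
    (t : PT k H M n) :
    PT.rx e (PT.spr p z t) = PT.spr (p ∘ e.symm) (fibre e.symm z) t := by
  rw [PT.rx, PT.spr_spr, one_mul]

theorem PT.spr_rx {l m n : ℕ} (e : Fin n ≃ Fin m) (p : Fin l → Fin m) (z : HT k H l)
    (t : PT k H M n) :
    PT.spr p z (PT.rx e t) = PT.spr (e.symm ∘ p) z t := by
  rw [PT.rx, PT.spr_spr, map_one, mul_one]

theorem PT.rx_refl {n : ℕ} (t : PT k H M n) : PT.rx (Equiv.refl _) t = t := PT.spr_id t

theorem PT.rx_one {n : ℕ} (t : PT k H M n) : PT.rx (1 : Equiv.Perm (Fin n)) t = t := PT.spr_id t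

theorem PT.rx_mul {n : ℕ} (σ τ : Equiv.Perm (Fin n)) (t : PT k H M n) :
    PT.rx (σ * τ) t = PT.rx σ (PT.rx τ t) := by
  rw [PT.rx_rx]; rfl

theorem PT.act_slot_rx {n m : ℕ} (e : Fin n ≃ Fin m) (i : Fin n) (a : H) (t : PT k H M n) :
    PT.rx e (PT.act (slot i a) t) = PT.act (slot (e i) a) (PT.rx e t) := by
  rw [PT.rx, PT.spr_act, PT.act_spr, fibre_symm_slot, mul_one, one_mul]

theorem PT.perm_eq {m n : ℕ} (h : m = n) (σ : Equiv.Perm (Fin n)) (t : PT k H M m) :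
    PT.perm h σ t = PT.rx σ (PT.rx (finCongr h) t) := by
  rw [PT.rx_rx]; rfl

theorem PT.spr_congr {n m : ℕ} {p q : Fin m → Fin n} {z y : HT k H m} (h : p = q) (h' : z = y)
    (t : PT k H M n) : PT.spr p z t = PT.spr q y t := by rw [h, h']

section map

variable [IsScalarTower k H M] [IsScalarTower k H N] [IsScalarTower k H P]

/-- `PT.map` as a linear map. -/
def PT.mp {n : ℕ} (T : M →ₗ[H] N) : PT k H M n →ₗ[k] PT k H N n where
  toFun := PT.map T
  map_add' s t := by rw [PT.map, PT.map, PT.map, map_add]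
  map_smul' c t := by rw [PT.map, PT.map, map_smul]; rfl

theorem PT.map_eq {n : ℕ} (T : M →ₗ[H] N) (t : PT k H M n) : PT.map T t = PT.mp T t := rfl

theorem PT.mp_mk {n : ℕ} (T : M →ₗ[H] N) (x : HT k H n) (v : M) :
    PT.mp T (PT.mk x v) = PT.mk x (T v) := by
  change PT.map T (PT.mk x v) = _
  rw [PT.map, PT.lift_mk]; rfl

theorem PT.mp_spr {n m : ℕ} (T : M →ₗ[H] N) (p : Fin m → Fin n) (z : HT k H m)
    (t : PT k H M n) : PT.mp T (PT.spr p z t) = PT.spr p z (PT.mp T t) := by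
  induction t using PT.induction with
  | zero => simp
  | mk x v => simp only [PT.spr_mk, PT.mp_mk]
  | add s t hs ht => simp only [map_add, hs, ht]

theorem PT.mp_rx {n m : ℕ} (T : M →ₗ[H] N) (e : Fin n ≃ Fin m)
    (t : PT k H M n) : PT.mp T (PT.rx e t) = PT.rx e (PT.mp T t) := PT.mp_spr _ _ _ _

theorem PT.mp_act {n : ℕ} (T : M →ₗ[H] N) (z : HT k H n) (t : PT k H M n) :
    PT.mp T (PT.act z t) = PT.act z (PT.mp T t) := by
  rw [PT.act_eq_spr, PT.act_eq_spr, PT.mp_spr]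

theorem PT.mp_mp {n : ℕ} (S : N →ₗ[H] P) (T : M →ₗ[H] N) (t : PT k H M n) :
    PT.mp S (PT.mp T t) = PT.mp (S ∘ₗ T) t := by
  induction t using PT.induction with
  | zero => simp
  | mk x v => simp only [PT.mp_mk]; rfl
  | add s t hs ht => simp only [map_add, hs, ht]

theorem PT.mp_id {n : ℕ} (t : PT k H M n) : PT.mp (LinearMap.id : M →ₗ[H] M) t = t := by
  induction t using PT.induction with
  | zero => simp
  | mk x v => simp only [PT.mp_mk]; rfl
  | add s t hs ht => simp only [map_add, hs, ht]

theorem PT.mp_zero {n : ℕ} (t : PT k H M n) : PT.mp (0 : M →ₗ[H] N) t = 0 := by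
  induction t using PT.induction with
  | zero => simp
  | mk x v => rw [PT.mp_mk, LinearMap.zero_apply, PT.mk, TensorProduct.tmul_zero, map_zero]
  | add s t hs ht => simp only [map_add, hs, ht, add_zero]

theorem PT.mp_unit (T : M →ₗ[H] N) (v : M) : PT.mp (k := k) T (PT.unit v) = PT.unit (T v) :=
  PT.mp_mk _ _ _

end map

end PT

/-! ### Permutations acting on consecutive blocks of positions -/

section Blocks

/-- The equivalence which is `e` on the first block and `e'` on the second one. -/
def blockEquiv {m m' n n' : ℕ} (e : Fin m ≃ Fin m') (e' : Fin n ≃ Fin n') :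
    Fin (m + n) ≃ Fin (m' + n') :=
  finSumFinEquiv.symm.trans ((Equiv.sumCongr e e').trans finSumFinEquiv)

variable {m m' n n' : ℕ} (e : Fin m ≃ Fin m') (e' : Fin n ≃ Fin n')

@[simp] theorem blockEquiv_castAdd (i : Fin m) :
    blockEquiv e e' (Fin.castAdd n i) = Fin.castAdd n' (e i) := by
  simp [blockEquiv]

@[simp] theorem blockEquiv_natAdd (i : Fin n) :
    blockEquiv e e' (Fin.natAdd m i) = Fin.natAdd m' (e' i) := by
  simp [blockEquiv]

theorem blockEquiv_symm : (blockEquiv e e').symm = blockEquiv e.symm e'.symm := rfl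

theorem sign_blockEquiv (σ : Equiv.Perm (Fin m)) (τ : Equiv.Perm (Fin n)) :
    Equiv.Perm.sign (blockEquiv σ τ) = Equiv.Perm.sign σ * Equiv.Perm.sign τ := by
  rw [← Equiv.Perm.sign_sumCongr, ← Equiv.Perm.sign_permCongr finSumFinEquiv]
  rfl

/-- The permutation fixing `0` which is `τ` on the other positions. -/
def shiftPerm {n : ℕ} (τ : Equiv.Perm (Fin n)) : Equiv.Perm (Fin (n + 1)) :=
  (finSuccEquiv n).trans (τ.optionCongr.trans (finSuccEquiv n).symm)

@[simp] theorem shiftPerm_zero {n : ℕ} (τ : Equiv.Perm (Fin n)) : shiftPerm τ 0 = 0 := by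
  simp [shiftPerm]

@[simp] theorem shiftPerm_succ {n : ℕ} (τ : Equiv.Perm (Fin n)) (i : Fin n) :
    shiftPerm τ i.succ = (τ i).succ := by
  simp [shiftPerm]

theorem sign_shiftPerm {n : ℕ} (τ : Equiv.Perm (Fin n)) :
    Equiv.Perm.sign (shiftPerm τ) = Equiv.Perm.sign τ := by
  rw [← Equiv.optionCongr_sign τ, ← Equiv.Perm.sign_permCongr (finSuccEquiv n).symm]
  rfl

theorem block₁_castAdd (m n : ℕ) (i : Fin m) : block₁ m n (Fin.castAdd n i) = 0 := by
  simp [block₁]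

theorem block₁_natAdd (m n : ℕ) (i : Fin n) : block₁ m n (Fin.natAdd m i) = i.succ := by
  simp [block₁]

theorem castAdd_ne_natAdd (i : Fin m) (j : Fin n) : Fin.castAdd n i ≠ Fin.natAdd m j := by
  intro h
  have := congrArg Fin.val h
  simp at this
  omega

end Blocks

/-! ### Insertion into the first argument of a cochain -/

section Insert

variable {k H : Type*} [Field k] [Ring H] [Bialgebra k H] [Coalgebra.IsCocomm k H]
variable {M N P : Type*} [AddCommGroup M] [Module k M] [Module H M]
variable [AddCommGroup N] [Module k N] [Module H N]
variable [AddCommGroup P] [Module k P] [Module H P]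

theorem cochain_slot_smul {n : ℕ} (f : Cochain k H M N n) (u : Fin n → M) (i : Fin n) (a : H) :
    f (Function.update u i (a • u i)) = PT.act (slot i a) (f u) := f.2.1 u i a

theorem cochain_skew {n : ℕ} (f : Cochain k H M N n) (σ : Equiv.Perm (Fin n)) (u : Fin n → M) :
    f u = sgn k σ • PT.rx σ (f fun s => u (σ s)) := f.2.2 σ u

/-- Insertion into the first argument of a cochain, as a linear map. -/
def ins {n : ℕ} (f : Cochain k H M N (n + 1)) {m : ℕ} (v : Fin n → M) :
    PT k H M m →ₗ[k] PT k H N (m + n) where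
  toFun F := Cochain.insert f F v
  map_add' F G := by simp only [Cochain.insert, map_add]
  map_smul' c F := by simp only [Cochain.insert, map_smul, RingHom.id_apply]

theorem insert_eq {n : ℕ} (f : Cochain k H M N (n + 1)) {m : ℕ} (F : PT k H M m)
    (v : Fin n → M) : Cochain.insert f F v = ins f v F := rfl

theorem ins_mk {n : ℕ} (f : Cochain k H M N (n + 1)) {m : ℕ} (g : HT k H m) (w : M)
    (v : Fin n → M) : ins f v (PT.mk g w) =
      PT.spr (block₁ m n) (place (Fin.castAdd n) (Fin.castAdd_injective m n) g)
        (f (Fin.cons w v)) := by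
  rw [← insert_eq, Cochain.insert, PT.lift_mk]; rfl

theorem ins_add {n : ℕ} (f f' : Cochain k H M N (n + 1)) {m : ℕ} (v : Fin n → M)
    (F : PT k H M m) : ins (f + f') v F = ins f v F + ins f' v F := by
  induction F using PT.induction with
  | zero => simp
  | mk x w => simp only [ins_mk]; exact map_add _ _ _
  | add s t hs ht => simp only [map_add, hs, ht]; abel

theorem ins_smul {n : ℕ} (c : k) (f : Cochain k H M N (n + 1)) {m : ℕ} (v : Fin n → M)
    (F : PT k H M m) : ins (c • f) v F = c • ins f v F := by
  induction F using PT.induction with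
  | zero => simp
  | mk x w => simp only [ins_mk]; exact map_smul _ _ _
  | add s t hs ht => simp only [map_add, hs, ht, smul_add]

theorem ins_update_add {n : ℕ} (f : Cochain k H M N (n + 1)) {m : ℕ} (v : Fin n → M)
    (i : Fin n) (x y : M) (F : PT k H M m) :
    ins f (Function.update v i (x + y)) F =
      ins f (Function.update v i x) F + ins f (Function.update v i y) F := by
  induction F using PT.induction with
  | zero => simp
  | mk g w =>
    simp only [ins_mk, Fin.cons_update]
    rw [MultilinearMap.map_update_add, map_add]
  | add s t hs ht => simp only [map_add, hs, ht]; abel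

theorem ins_update_smul {n : ℕ} (f : Cochain k H M N (n + 1)) {m : ℕ} (v : Fin n → M)
    (i : Fin n) (c : k) (x : M) (F : PT k H M m) :
    ins f (Function.update v i (c • x)) F = c • ins f (Function.update v i x) F := by
  induction F using PT.induction with
  | zero => simp
  | mk g w =>
    simp only [ins_mk, Fin.cons_update]
    rw [MultilinearMap.map_update_smul, map_smul]
  | add s t hs ht => simp only [map_add, hs, ht, smul_add]

/-- A coefficient of the inserted element is never spread: it stays in the first `m` positions. -/
theorem ins_act {n : ℕ} (f : Cochain k H M N (n + 1)) {m : ℕ} (v : Fin n → M)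
    (z : HT k H m) (F : PT k H M m) :
    ins f v (PT.act z F) =
      PT.act (place (Fin.castAdd n) (Fin.castAdd_injective m n) z) (ins f v F) := by
  induction F using PT.induction with
  | zero => simp only [PT.act_zero, map_zero]
  | mk g w => simp only [PT.act_mk, ins_mk, map_mul, PT.act_spr]
  | add s t hs ht => simp only [PT.act_add, map_add, hs, ht]

theorem ins_slot_smul {n : ℕ} (f : Cochain k H M N (n + 1)) {m : ℕ} (v : Fin n → M)
    (i : Fin n) (a : H) (F : PT k H M m) :
    ins f (Function.update v i (a • v i)) F = PT.act (slot (Fin.natAdd m i) a) (ins f v F) := by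
  induction F using PT.induction with
  | zero => simp only [PT.act_zero, map_zero]
  | mk g w =>
    have h := cochain_slot_smul f (Fin.cons w v) i.succ a
    rw [Fin.cons_succ, ← Fin.cons_update] at h
    simp only [ins_mk, h, PT.spr_act, PT.act_spr]
    congr 1
    have e : fibre (k := k) (block₁ m n) (slot i.succ a) = slot (Fin.natAdd m i) a := by
      rw [fibre_slot, ← cop_singleton]
      congr 2
      ext l
      refine Fin.addCases (fun s => ?_) (fun s => ?_) l
      · simp [block₁_castAdd, castAdd_ne_natAdd, (Fin.succ_ne_zero i).symm]
      · simp [block₁_natAdd]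
    rw [e, ← cop_singleton]
    congr 1
    refine (place_commute _ _ _ (fun s => ?_) g a).eq
    simp [castAdd_ne_natAdd]
  | add s t hs ht => simp only [PT.act_add, map_add, hs, ht]

theorem ins_rx {n : ℕ} (f : Cochain k H M N (n + 1)) {m m' : ℕ} (e : Fin m ≃ Fin m')
    (v : Fin n → M) (F : PT k H M m) :
    ins f v (PT.rx e F) = PT.rx (blockEquiv e (Equiv.refl _)) (ins f v F) := by
  induction F using PT.induction with
  | zero => simp only [map_zero]
  | mk g w =>
    rw [PT.rx_mk, ins_mk, ins_mk, PT.rx_spr]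
    refine PT.spr_congr ?_ ?_ _
    · ext l : 1
      rw [Function.comp, blockEquiv_symm]
      refine Fin.addCases (fun s => ?_) (fun s => ?_) l
      · rw [blockEquiv_castAdd, block₁_castAdd, block₁_castAdd]
      · rw [blockEquiv_natAdd, block₁_natAdd, block₁_natAdd]; rfl
    · rw [fibre_symm_place, fibre_symm_eq_place, place_place]
      refine place_congr ?_ _ _ _
      ext s : 1
      simp
  | add s t hs ht => simp only [map_add, hs, ht]

theorem sgn_mul {n : ℕ} (σ τ : Equiv.Perm (Fin n)) : sgn k (σ * τ) = sgn k σ * sgn k τ := by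
  simp [sgn]

theorem sgn_one {n : ℕ} : sgn k (1 : Equiv.Perm (Fin n)) = 1 := by simp [sgn]

theorem sgn_inv {n : ℕ} (σ : Equiv.Perm (Fin n)) : sgn k σ⁻¹ = sgn k σ := by simp [sgn]

theorem sgn_mul_self {n : ℕ} (σ : Equiv.Perm (Fin n)) : sgn k σ * sgn k σ = 1 := by
  rw [← sgn_mul, sgn]; simp

theorem sgn_shiftPerm {n : ℕ} (τ : Equiv.Perm (Fin n)) : sgn k (shiftPerm τ) = sgn k τ := by
  simp [sgn, sign_shiftPerm]

theorem sgn_blockEquiv {m n : ℕ} (σ : Equiv.Perm (Fin m)) (τ : Equiv.Perm (Fin n)) :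
    sgn k (blockEquiv σ τ) = sgn k σ * sgn k τ := by
  simp [sgn, sign_blockEquiv]

/-- Skew-symmetry of `f` under the permutations that fix its first argument survives the insertion,
because those permutations do not touch the fibre over that argument. -/
theorem ins_skew {n : ℕ} (f : Cochain k H M N (n + 1)) {m : ℕ}
    (τ : Equiv.Perm (Fin n)) (v : Fin n → M) (F : PT k H M m) :
    ins f v F = sgn k τ • PT.rx (blockEquiv (Equiv.refl _) τ) (ins f (fun s => v (τ s)) F) := by
  induction F using PT.induction with
  | zero => simp only [map_zero, smul_zero]
  | mk g w =>
    have h := cochain_skew f (shiftPerm τ) (Fin.cons w v)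
    have e : (fun s => (Fin.cons w v : Fin (n + 1) → M) (shiftPerm τ s)) =
        Fin.cons w fun s => v (τ s) := by
      ext s
      cases s using Fin.cases <;> simp
    rw [e, sgn_shiftPerm] at h
    rw [ins_mk, ins_mk, h, map_smul, PT.spr_rx, PT.rx_spr]
    congr 1
    refine PT.spr_congr ?_ ?_ _
    · ext l : 1
      simp only [Function.comp, blockEquiv_symm]
      refine Fin.addCases (fun s => ?_) (fun s => ?_) l
      · rw [blockEquiv_castAdd, block₁_castAdd, block₁_castAdd, Equiv.symm_apply_eq,
          shiftPerm_zero]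
      · rw [blockEquiv_natAdd, block₁_natAdd, block₁_natAdd, Equiv.symm_apply_eq,
          shiftPerm_succ, Equiv.apply_symm_apply]
    · rw [fibre_symm_place]
      refine place_congr ?_ _ _ _
      ext s : 1
      simp
  | add s t hs ht =>
    rw [map_add, map_add, map_add, smul_add, ← hs, ← ht]

end Insert

/-! ### Numerical descriptions of block maps and cycles -/

section Blocks

/-- Truncated subtraction produces the value 0 on the whole first block, so both cases share one
arithmetic expression. -/
theorem block₁_val (m n : ℕ) (l : Fin (m + n)) : (block₁ m n l : ℕ) = (l : ℕ) + 1 - m := by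
  refine Fin.addCases (fun s => ?_) (fun s => ?_) l
  · rw [block₁_castAdd]
    simp
  · rw [block₁_natAdd]
    simp
    omega

theorem cycleRange_val {n : ℕ} (t i : Fin n) :
    (t.cycleRange i : ℕ) = if i < t then (i : ℕ) + 1 else if i = t then 0 else (i : ℕ) := by
  split_ifs with h h'
  · exact Fin.coe_cycleRange_of_lt h
  · have : NeZero n := ⟨fun h => by subst h; exact t.elim0⟩
    rw [h', Fin.cycleRange_self]; rfl
  · rw [Fin.cycleRange_of_gt (lt_of_le_of_ne (not_lt.mp h) (Ne.symm h'))]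

theorem cycleRange_symm_val {n : ℕ} (t i : Fin (n + 1)) :
    (t.cycleRange.symm i : ℕ) = if i = 0 then (t : ℕ) else if i ≤ t then (i : ℕ) - 1 else (i : ℕ) := by
  cases i using Fin.cases with
  | zero => simp
  | succ i =>
    rw [Fin.cycleRange_symm_succ, if_neg (Fin.succ_ne_zero i), Fin.succAbove]
    simp only [Fin.lt_def, Fin.le_def, Fin.val_castSucc, Fin.val_succ]
    split_ifs <;> simp <;> omega

theorem swap_val {n : ℕ} (i : Fin (n + 2)) :
    (Equiv.swap (0 : Fin (n + 2)) 1 i : ℕ) =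
      if (i : ℕ) = 0 then 1 else if (i : ℕ) = 1 then 0 else (i : ℕ) := by
  rw [Equiv.swap_apply_def]
  simp only [Fin.ext_iff, Fin.val_zero, Fin.val_one]
  split_ifs <;> simp_all

/-- The map `Fin (m + l + n) → Fin (n + 2)` with value `0` on the first block, `1` on the second
one and `2, …, n + 1` on the last one. -/
def block₃ (m l n : ℕ) : Fin (m + l + n) → Fin (n + 2) :=
  Fin.addCases (Fin.addCases (fun _ => 0) fun _ => 1) fun s => s.succ.succ

theorem block₃_first (m l n : ℕ) (i : Fin m) :
    block₃ m l n (Fin.castAdd n (Fin.castAdd l i)) = 0 := by simp [block₃]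

theorem block₃_mid (m l n : ℕ) (i : Fin l) :
    block₃ m l n (Fin.castAdd n (Fin.natAdd m i)) = 1 := by simp [block₃]

theorem block₃_last (m l n : ℕ) (i : Fin n) :
    block₃ m l n (Fin.natAdd (m + l) i) = i.succ.succ := by simp [block₃]

theorem addCases₃ {m l n : ℕ} {motive : Fin (m + l + n) → Prop}
    (h₁ : ∀ i, motive (Fin.castAdd n (Fin.castAdd l i)))
    (h₂ : ∀ i, motive (Fin.castAdd n (Fin.natAdd m i)))
    (h₃ : ∀ i, motive (Fin.natAdd (m + l) i)) (i : Fin (m + l + n)) : motive i :=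
  Fin.addCases (Fin.addCases h₁ h₂) h₃ i

theorem block₃_val (m l n : ℕ) (i : Fin (m + l + n)) :
    (block₃ m l n i : ℕ) = if (i : ℕ) < m then 0 else
      if (i : ℕ) < m + l then 1 else (i : ℕ) + 2 - (m + l) := by
  induction i using addCases₃ with
  | h₁ i => simp [block₃_first]
  | h₂ i => simp [block₃_mid]
  | h₃ i =>
    simp only [block₃_last, Fin.val_succ, Fin.val_natAdd]
    split_ifs <;> omega

theorem castAdd_castAdd_injective (m l n : ℕ) :
    Function.Injective fun i : Fin m => Fin.castAdd n (Fin.castAdd l i) :=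
  (Fin.castAdd_injective _ _).comp (Fin.castAdd_injective _ _)

theorem castAdd_natAdd_injective (m l n : ℕ) :
    Function.Injective fun i : Fin l => Fin.castAdd n (Fin.natAdd m i) :=
  (Fin.castAdd_injective _ _).comp (Fin.natAdd_injective _ _)

theorem finAddFlip_val {m n : ℕ} (i : Fin (m + n)) :
    ((finAddFlip i : Fin (n + m)) : ℕ) = if (i : ℕ) < m then (i : ℕ) + n else (i : ℕ) - m := by
  refine Fin.addCases (fun s => ?_) (fun s => ?_) i
  · simp [finAddFlip_apply_castAdd]; omega
  · simp [finAddFlip_apply_natAdd]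

end Blocks

/-! ### Inserting two elements at once, and nested insertions -/

section Insert

variable {k H : Type*} [Field k] [Ring H] [Bialgebra k H] [Coalgebra.IsCocomm k H]
variable {L M N P : Type*} [AddCommGroup M] [Module k M] [Module H M]
variable [AddCommGroup L] [Module k L] [Module H L]
variable [AddCommGroup N] [Module k N] [Module H N]
variable [AddCommGroup P] [Module k P] [Module H P]

theorem PT.rx_spr_of {l m n : ℕ} {p : Fin m → Fin n} {e : Fin m ≃ Fin l} {q : Fin l → Fin n}
    {z : HT k H m} {y : HT k H l} (h : ∀ i, q (e i) = p i) (hz : fibre e.symm z = y)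
    (t : PT k H M n) : PT.rx e (PT.spr p z t) = PT.spr q y t := by
  rw [PT.rx_spr]
  refine PT.spr_congr ?_ hz t
  ext i : 1
  simp [← h]

theorem PT.spr_rx_of {l m n : ℕ} {e : Fin n ≃ Fin m} {p : Fin l → Fin m} {q : Fin l → Fin n}
    (h : ∀ i, e (q i) = p i) (z : HT k H l) (t : PT k H M n) :
    PT.spr p z (PT.rx e t) = PT.spr q z t := by
  rw [PT.spr_rx]
  refine PT.spr_congr ?_ rfl t
  ext i : 1
  simp [← h]

/-- `f(F, G, v₁, …, vₙ)` for `F ∈ H^{⊗m} ⊗_H M` and `G ∈ H^{⊗l} ⊗_H M`. -/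
def ins₂ {m l n : ℕ} (f : Cochain k H M N (n + 2)) (v : Fin n → M) (F : PT k H M m) :
    PT k H M l →ₗ[k] PT k H N (m + l + n) :=
  -- `F` is inserted first, with `w` as the following argument. Then the position of `w` is spread
  -- over the second block and multiplied by `y`.
  PT.lift (LinearMap.mk₂ k (fun y w => PT.spr
      (Fin.addCases (Fin.addCases (Fin.castAdd (n + 1)) fun _ => Fin.natAdd m 0)
        fun s => Fin.natAdd m s.succ)
      (place _ (castAdd_natAdd_injective m l n) y) (ins f (Fin.cons w v) F))
      (fun y y' w => by rw [map_add, PT.spr_add_left])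
      (fun c y w => by rw [map_smul, PT.spr_smul_left])
      (fun y w w' => by
        rw [← map_add]
        have := ins_update_add f (Fin.cons w v) 0 w w' F
        rw [Fin.update_cons_zero, Fin.update_cons_zero, Fin.update_cons_zero] at this
        rw [this])
      (fun c y w => by
        rw [← map_smul]
        have := ins_update_smul f (Fin.cons w v) 0 c w F
        rw [Fin.update_cons_zero, Fin.update_cons_zero] at this
        rw [this]))
    (fun y a w => by
      have := ins_slot_smul f (Fin.cons w v) 0 a F
      rw [Fin.cons_zero, Fin.update_cons_zero] at this
      simp only [LinearMap.mk₂_apply]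
      rw [this, PT.spr_act, map_mul, place_iterCop, fibre_slot]
      congr 5
      ext i
      simp only [Finset.mem_filter, Finset.mem_univ, true_and, Finset.mem_image]
      induction i using addCases₃ with
      | h₁ i => simp [Fin.ext_iff]; omega
      | h₂ i => simp [Fin.ext_iff]
      | h₃ i => simp [Fin.ext_iff]; omega)

/-- The definition treats the two inserted elements asymmetrically. On generators the outcome is
symmetric, since the two coefficients occupy disjoint blocks and commute. -/
theorem ins₂_mk {m l n : ℕ} (f : Cochain k H M N (n + 2)) (v : Fin n → M) (x : HT k H m) (w : M)
    (y : HT k H l) (w' : M) : ins₂ f v (PT.mk x w) (PT.mk y w') =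
      PT.spr (block₃ m l n) (place _ (castAdd_castAdd_injective m l n) x *
        place _ (castAdd_natAdd_injective m l n) y) (f (Fin.cons w (Fin.cons w' v))) := by
  rw [ins₂, PT.lift_mk, LinearMap.mk₂_apply, ins_mk, PT.spr_spr]
  rw [fibre_place_eq_place _ _ _ _ (castAdd_castAdd_injective m l n) (fun i => by simp)]
  · refine PT.spr_congr ?_ ?_ _
    · ext i
      rw [block₃_val, Function.comp, block₁_val]
      induction i using addCases₃ with
      | h₁ i => simp
      | h₂ i => simp
      | h₃ i =>
        simp only [Fin.addCases_right, Fin.val_natAdd, Fin.val_succ]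
        split_ifs <;> omega
    · refine (place_place_commute _ _ _ _ (fun s t h => ?_) _ _).eq
      have := congrArg Fin.val h
      simp at this
      omega
  · intro t s h
    induction t using addCases₃ with
    | h₁ i => simp at h; rw [h]
    | h₂ i => simp [Fin.ext_iff] at h; omega
    | h₃ i => simp [Fin.ext_iff] at h; omega

theorem ins₂_add_left {m l n : ℕ} (f : Cochain k H M N (n + 2)) (v : Fin n → M)
    (F F' : PT k H M m) (G : PT k H M l) :
    ins₂ f v (F + F') G = ins₂ f v F G + ins₂ f v F' G := by
  induction G using PT.induction with
  | zero => simp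
  | mk x w => simp only [ins₂, PT.lift_mk, LinearMap.mk₂_apply, map_add]
  | add s t hs ht => simp only [map_add, hs, ht]; abel

theorem ins₂_zero_left {m l n : ℕ} (f : Cochain k H M N (n + 2)) (v : Fin n → M)
    (G : PT k H M l) : ins₂ f v (0 : PT k H M m) G = 0 := by
  have := ins₂_add_left f v (0 : PT k H M m) 0 G
  rwa [add_zero, left_eq_add] at this

/-- Induction over two elements at once, for biadditive statements. -/
theorem PT.induction₂ {m n : ℕ} {p : PT k H M m → PT k H N n → Prop}
    (zero_left : ∀ G, p 0 G) (zero_right : ∀ F, p F 0)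
    (mk : ∀ x v y w, p (PT.mk x v) (PT.mk y w))
    (add_left : ∀ F F' G, p F G → p F' G → p (F + F') G)
    (add_right : ∀ F G G', p F G → p F G' → p F (G + G')) (F : PT k H M m) (G : PT k H N n) :
    p F G := by
  induction F using PT.induction with
  | zero => exact zero_left G
  | mk x v =>
    induction G using PT.induction with
    | zero => exact zero_right _
    | mk y w => exact mk x v y w
    | add s t hs ht => exact add_right _ _ _ hs ht
  | add s t hs ht => exact add_left _ _ _ hs ht

theorem cochain_swap {n : ℕ} (f : Cochain k H M N (n + 2)) (w w' : M) (v : Fin n → M) :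
    f (Fin.cons w (Fin.cons w' v)) =
      -PT.rx (Equiv.swap 0 1) (f (Fin.cons w' (Fin.cons w v))) := by
  have h := cochain_skew f (Equiv.swap 0 1) (Fin.cons w (Fin.cons w' v))
  have e : (fun s => (Fin.cons w (Fin.cons w' v) : Fin (n + 2) → M) (Equiv.swap 0 1 s)) =
      Fin.cons w' (Fin.cons w v) := by
    ext s
    cases s using Fin.cases with
    | zero => rw [Equiv.swap_apply_left]; rfl
    | succ s =>
      cases s using Fin.cases with
      | zero =>
        change (Fin.cons w (Fin.cons w' v) : Fin (n + 2) → M) (Equiv.swap 0 1 1) = _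
        rw [Equiv.swap_apply_right]; rfl
      | succ s =>
        rw [Equiv.swap_apply_of_ne_of_ne]
        · rfl
        · exact Fin.succ_ne_zero _
        · simp [Fin.ext_iff]
  rw [e] at h
  rw [h, sgn, Equiv.Perm.sign_swap (by simp)]
  simp

/-- The sign comes from exchanging the first two arguments of `f`; the reindexing moves the two
blocks of tensor factors past each other. -/
theorem ins₂_swap {m l n : ℕ} (f : Cochain k H M N (n + 2)) (v : Fin n → M)
    (F : PT k H M m) (G : PT k H M l) :
    ins₂ f v F G = -PT.rx (blockEquiv finAddFlip (Equiv.refl _)) (ins₂ f v G F) := by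
  induction F, G using PT.induction₂ with
  | zero_left G => rw [ins₂_zero_left, map_zero, map_zero, neg_zero]
  | zero_right F => rw [ins₂_zero_left, map_zero, map_zero, neg_zero]
  | mk x w y w' =>
    rw [ins₂_mk, ins₂_mk, cochain_swap, map_neg, neg_inj]
    rw [PT.spr_rx]
    refine (PT.rx_spr_of (fun i => ?_) ?_ _).symm
    · ext
      rw [Function.comp, Equiv.symm_swap]
      induction i using addCases₃ with
      | h₁ i => simp [block₃_first, block₃_mid]
      | h₂ i => simp [block₃_first, block₃_mid]
      | h₃ i =>
        rw [blockEquiv_natAdd, block₃_last, Equiv.refl_apply, block₃_last,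
          Equiv.swap_apply_of_ne_of_ne]
        · exact Fin.succ_ne_zero _
        · simp [Fin.ext_iff]
    · rw [map_mul, fibre_symm_place, fibre_symm_place]
      refine ((place_place_commute _ _ _ _ (fun s t h => ?_) _ _).eq).trans ?_
      · have := congrArg Fin.val h
        simp at this
        omega
      · congr 1
        · refine place_congr ?_ _ _ _
          ext s : 1
          simp
        · refine place_congr ?_ _ _ _
          ext s : 1
          simp
  | add_left F F' G h h' => simp only [ins₂_add_left, map_add, h, h']; abel
  | add_right F G G' h h' => simp only [ins₂_add_left, map_add, h, h']; abel

/-- Spreading the first argument of the inner cochain of a nested insertion. -/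
theorem spr_ins {a b c r : ℕ} (h : b + 1 + a = r + 1) (h' : c + b + a = c + r)
    (f : Cochain k H M N (a + 1)) (v : Fin a → M) (x : HT k H c) (G : PT k H M (b + 1)) :
    PT.spr (block₁ c r) (place _ (Fin.castAdd_injective c r) x)
        (PT.rx (finCongr h) (ins f v G)) =
      PT.rx (finCongr h') (ins f v
        (PT.spr (block₁ c b) (place _ (Fin.castAdd_injective c b) x) G)) := by
  induction G using PT.induction with
  | zero => simp
  | mk y w =>
    rw [ins_mk, PT.spr_mk, ins_mk, PT.rx_spr, PT.spr_spr, PT.rx_spr]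
    refine PT.spr_congr ?_ ?_ _
    · ext l
      simp only [Function.comp, block₁_val, finCongr_symm, finCongr_apply, Fin.val_cast]
      omega
    · rw [map_mul, map_mul, place_place, fibre_symm_place, fibre_symm_place, fibre_symm_place]
      congr 1
      refine fibre_place _ _ _ _ _ _ (fun s => ?_) (fun t s e => ?_) y
      · ext
        simp [block₁_val]
      · have := congrArg Fin.val e
        simp [block₁_val] at this
        refine ⟨⟨t, by omega⟩, ?_⟩
        ext
        simp
  | add s t hs ht => simp only [map_add, hs, ht]

/-- Spreading an outer argument of a nested insertion. -/
theorem spr_ins_cons {c l n r : ℕ} (h : l + (n + 1) = r + 1) (hl : l < r + 1)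
    (h' : c + l + n = c + r) (f : Cochain k H M N (n + 2)) (v : Fin n → M) (x : HT k H c) (w : M)
    (G : PT k H M l) :
    PT.spr (block₁ c r) (place _ (Fin.castAdd_injective c r) x)
        (PT.rx ((finCongr h).trans (Fin.cycleRange ⟨l, hl⟩)) (ins f (Fin.cons w v) G)) =
      -PT.rx (finCongr h') (ins₂ f v (PT.mk x w) G) := by
  induction G using PT.induction with
  | zero => simp
  | mk y w' =>
    -- The argument `w` sits second in `f`, behind `G`. Exchanging the first two arguments of `f`
    -- brings it in front and is the source of the minus sign.
    rw [ins_mk, ins₂_mk, cochain_swap, map_neg, map_neg, map_neg, neg_inj, PT.rx_spr,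
      PT.spr_spr, PT.rx_spr]
    have key : ∀ i : Fin (c + r), ((((finCongr h).trans (Fin.cycleRange ⟨l, hl⟩)).symm
        (block₁ c r i) : Fin (l + (n + 1))) : ℕ) =
        if (i : ℕ) < c then l else if (i : ℕ) < c + l then i - c else i + 1 - c := by
      intro i
      have e1 : ((block₁ c r i : Fin (r + 1)) = 0) = ((i : ℕ) < c) := by
        rw [Fin.ext_iff, block₁_val, Fin.val_zero]
        exact propext (by omega)
      simp only [Equiv.symm_trans_apply, finCongr_symm, finCongr_apply, Fin.val_cast,
        cycleRange_symm_val, e1, block₁_val, Fin.le_def]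
      split_ifs <;> omega
    rw [PT.spr_rx_of (q := block₃ c l n ∘ (finCongr h').symm)]
    · refine PT.spr_congr rfl ?_ _
      rw [map_mul, fibre_symm_place, fibre_symm_place, fibre_symm_place]
      congr 1
      refine fibre_place_eq_place _ _ _ _ _ (fun s => ?_) (fun t s e => ?_) y
      · ext
        have hs : (⟨s, by omega⟩ : Fin (r + 1)) < ⟨l, hl⟩ := s.2
        refine Eq.trans ?_ (Fin.coe_cycleRange_of_lt hs).symm
        simp [block₁_val]
        omega
      · have hs : (⟨s, by omega⟩ : Fin (r + 1)) < ⟨l, hl⟩ := s.2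
        have := (congrArg Fin.val e).trans (Fin.coe_cycleRange_of_lt hs)
        rw [block₁_val] at this
        ext
        simp at this ⊢
        omega
    · intro i
      ext
      simp only [swap_val, Function.comp, block₃_val, block₁_val, key, finCongr_symm,
        finCongr_apply, Fin.val_cast]
      by_cases h1 : (i : ℕ) < c
      · simp [h1]
      · by_cases h2 : (i : ℕ) < c + l
        · simp only [h1, h2, if_true, if_false]
          norm_num
          omega
        · simp only [h1, h2, if_false]
          rw [if_neg (by omega), if_neg (by omega)]
          omega
  | add s t hs ht => simp only [map_add, hs, ht, neg_add]

end Insert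

/-! ### Coset decompositions of sums over the symmetric group -/

section Perm

theorem front_eq {n : ℕ} (i : Fin (n + 1)) : front i = i.cycleRange.symm := by
  ext s : 1
  cases s using Fin.cases with
  | zero => simp [front]
  | succ s =>
    have h : finSuccEquiv' (0 : Fin (n + 1)) s.succ = some s := by
      have := finSuccEquiv'_succAbove (0 : Fin (n + 1)) s
      rwa [Fin.succAbove_zero] at this
    rw [Fin.cycleRange_symm_succ, front, Equiv.trans_apply, h, finSuccEquiv'_symm_some]

@[simp] theorem front_zero {n : ℕ} (i : Fin (n + 1)) : front i 0 = i := by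
  rw [front_eq, Fin.cycleRange_symm_zero]

@[simp] theorem front_succ {n : ℕ} (i : Fin (n + 1)) (s : Fin n) :
    front i s.succ = i.succAbove s := by
  rw [front_eq, Fin.cycleRange_symm_succ]

/-- These products represent the left cosets of the stabiliser of 0: the index `i` is the image of
0, and injectivity plus a count of `(n + 1)!` gives bijectivity. -/
theorem sum_perm_succ {A : Type*} [AddCommMonoid A] {n : ℕ} (T : Equiv.Perm (Fin (n + 1)) → A) :
    ∑ σ, T σ = ∑ i, ∑ τ : Equiv.Perm (Fin n), T (front i * shiftPerm τ) := by
  rw [← Fintype.sum_prod_type']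
  symm
  refine Function.Bijective.sum_comp (e := fun x : Fin (n + 1) × Equiv.Perm (Fin n) =>
    front x.1 * shiftPerm x.2) ?_ T
  rw [Fintype.bijective_iff_injective_and_card]
  constructor
  · rintro ⟨i, τ⟩ ⟨i', τ'⟩ h
    have h0 := DFunLike.congr_fun h 0
    simp only [Equiv.Perm.mul_apply, shiftPerm_zero, front_zero] at h0
    subst h0
    have h1 : shiftPerm τ = shiftPerm τ' := mul_left_cancel h
    congr 1
    ext s
    have := DFunLike.congr_fun h1 s.succ
    rw [shiftPerm_succ, shiftPerm_succ, Fin.succ_inj] at this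
    rw [this]
  · simp [Fintype.card_perm, Nat.factorial_succ]

theorem shiftPerm_inv {n : ℕ} (τ : Equiv.Perm (Fin n)) : (shiftPerm τ)⁻¹ = shiftPerm τ⁻¹ := by
  rw [inv_eq_iff_mul_eq_one]
  ext s : 1
  cases s using Fin.cases <;> simp

/-- The inverse decomposition. Now `i` is the position sent to 0, so it records where the first
argument ends up; the pre-Lie computation sorts terms by this position. -/
theorem sum_perm_succ_inv {A : Type*} [AddCommMonoid A] {n : ℕ}
    (T : Equiv.Perm (Fin (n + 1)) → A) :
    ∑ σ, T σ = ∑ τ : Equiv.Perm (Fin n), ∑ i : Fin (n + 1), T (shiftPerm τ * i.cycleRange) := by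
  rw [← Equiv.sum_comp (Equiv.inv (Equiv.Perm (Fin (n + 1)))), sum_perm_succ, Finset.sum_comm,
    ← Equiv.sum_comp (Equiv.inv (Equiv.Perm (Fin n)))]
  refine Finset.sum_congr rfl fun τ _ => Finset.sum_congr rfl fun i _ => ?_
  congr 1
  rw [Equiv.inv_apply, Equiv.inv_apply, mul_inv_rev, shiftPerm_inv, inv_inv, front_eq]
  rfl

theorem exists_strictMono_comp {A B : Type*} [LinearOrder A] [Fintype A] [LinearOrder B]
    (f : A → B) (hf : Function.Injective f) : ∃ α : Equiv.Perm A, StrictMono fun s => f (α s) := by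
  let e : Fin (Fintype.card A) ≃o A := Fintype.orderIsoFinOfCardEq A rfl
  refine ⟨e.toEquiv.permCongr (Tuple.sort (f ∘ e)), ?_⟩
  have h1 : StrictMono ((f ∘ e) ∘ Tuple.sort (f ∘ e)) :=
    (Tuple.monotone_sort _).strictMono_of_injective
      ((hf.comp e.injective).comp (Equiv.injective _))
  intro s t h
  exact h1 (e.symm.strictMono h)

/-- The two rearrangements differ by an order automorphism of a finite linear order, which can only
be the identity. -/
theorem eq_of_strictMono_comp {A B : Type*} [LinearOrder A] [Fintype A] [LinearOrder B]
    {f g : A → B} (hf : StrictMono f) (hg : StrictMono g) {α β : Equiv.Perm A}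
    (h : ∀ s, f (α s) = g (β s)) : α = β := by
  have h' : ∀ x, f (α (β.symm x)) = g x := fun x => by rw [h, Equiv.apply_symm_apply]
  have hmono : StrictMono (β.symm.trans α) := fun s t hst => by
    rw [← hf.lt_iff_lt]
    change f (α (β.symm s)) < f (α (β.symm t))
    rw [h', h']
    exact hg hst
  let e : A ≃o A := hmono.orderIsoOfSurjective _ (Equiv.surjective _)
  have he : e = OrderIso.refl A := Subsingleton.elim _ _
  ext s
  have := DFunLike.congr_fun he (β s)
  change α (β.symm (β s)) = β s at this
  rwa [Equiv.symm_apply_apply] at this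

/-- Every permutation factors uniquely as an unshuffle followed on the right by a permutation of the
first `a` positions and one of the positions from `b` on. Positions between `a` and `b` are left
free, which covers both kinds of shuffles in the bracket. -/
theorem sum_unshuffles {A : Type*} [AddCommMonoid A] {n a b : ℕ} (ha : a ≤ b) (hb : b ≤ n)
    (T : Equiv.Perm (Fin n) → A)
    (h₁ : ∀ σ π, (∀ s : Fin n, a ≤ (s : ℕ) → π s = s) → T (σ * π) = T σ)
    (h₂ : ∀ σ π, (∀ s : Fin n, (s : ℕ) < b → π s = s) → T (σ * π) = T σ) :
    ∑ σ, T σ = (a.factorial * (n - b).factorial) • ∑ σ ∈ unshuffles n a b, T σ := by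
  have hA : ∀ (α : Equiv.Perm {s : Fin n // (s : ℕ) < a}) (s : Fin n), a ≤ (s : ℕ) →
      Equiv.Perm.ofSubtype α s = s := fun α s hs =>
    Equiv.Perm.ofSubtype_apply_of_not_mem α (not_lt.mpr hs)
  have hB : ∀ (β : Equiv.Perm {s : Fin n // b ≤ (s : ℕ)}) (s : Fin n), (s : ℕ) < b →
      Equiv.Perm.ofSubtype β s = s := fun β s hs =>
    Equiv.Perm.ofSubtype_apply_of_not_mem β (not_le.mpr hs)
  let F : unshuffles n a b × Equiv.Perm {s : Fin n // (s : ℕ) < a} ×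
      Equiv.Perm {s : Fin n // b ≤ (s : ℕ)} → Equiv.Perm (Fin n) := fun x =>
    x.1.1 * Equiv.Perm.ofSubtype x.2.1 * Equiv.Perm.ofSubtype x.2.2
  have hFA : ∀ x (s : {s : Fin n // (s : ℕ) < a}), F x s = x.1.1 (x.2.1 s : Fin n) := by
    intro x s
    simp only [F, Equiv.Perm.mul_apply]
    rw [hB _ _ (lt_of_lt_of_le s.2 ha), Equiv.Perm.ofSubtype_apply_coe]
  have hFB : ∀ x (s : {s : Fin n // b ≤ (s : ℕ)}), F x s = x.1.1 (x.2.2 s : Fin n) := by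
    intro x s
    simp only [F, Equiv.Perm.mul_apply]
    rw [Equiv.Perm.ofSubtype_apply_coe, hA _ _ (ha.trans (x.2.2 s).2)]
  have hmA : ∀ σ : unshuffles n a b,
      StrictMono fun s : {s : Fin n // (s : ℕ) < a} => σ.1 s := fun σ s t hst =>
    (Finset.mem_filter.mp σ.2).2.1 s t hst t.2
  have hmB : ∀ σ : unshuffles n a b,
      StrictMono fun s : {s : Fin n // b ≤ (s : ℕ)} => σ.1 s := fun σ s t hst =>
    (Finset.mem_filter.mp σ.2).2.2 s t hst s.2
  have hF : Function.Bijective F := by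
    constructor
    · intro x y hxy
      have e1 : x.2.1 = y.2.1 := eq_of_strictMono_comp (hmA x.1) (hmA y.1) fun s => by
        rw [← hFA, ← hFA, hxy]
      have e2 : x.2.2 = y.2.2 := eq_of_strictMono_comp (hmB x.1) (hmB y.1) fun s => by
        rw [← hFB, ← hFB, hxy]
      have e3 : x.1 = y.1 := by
        apply Subtype.ext
        simp only [F, e1, e2] at hxy
        exact mul_right_cancel (mul_right_cancel hxy)
      exact Prod.ext e3 (Prod.ext e1 e2)
    · intro σ
      obtain ⟨α, hα⟩ := exists_strictMono_comp (fun s : {s : Fin n // (s : ℕ) < a} => σ s)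
        (σ.injective.comp Subtype.val_injective)
      obtain ⟨β, hβ⟩ := exists_strictMono_comp (fun s : {s : Fin n // b ≤ (s : ℕ)} => σ s)
        (σ.injective.comp Subtype.val_injective)
      -- Sorting the values of `σ` on the two blocks gives the unshuffle; the inverses of the
      -- sorting permutations are the block factors.
      refine ⟨⟨⟨σ * Equiv.Perm.ofSubtype β * Equiv.Perm.ofSubtype α, ?_⟩, α⁻¹, β⁻¹⟩, ?_⟩
      · refine Finset.mem_filter.mpr ⟨Finset.mem_univ _, fun i j hij hj => ?_, fun i j hij hi => ?_⟩
        · have hi : (i : ℕ) < a := lt_trans hij hj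
          have := @hα ⟨i, hi⟩ ⟨j, hj⟩ hij
          simp only [Equiv.Perm.mul_apply]
          rw [Equiv.Perm.ofSubtype_apply_of_mem α hi, Equiv.Perm.ofSubtype_apply_of_mem α hj,
            hB _ _ (lt_of_lt_of_le (α ⟨i, hi⟩).2 ha), hB _ _ (lt_of_lt_of_le (α ⟨j, hj⟩).2 ha)]
          exact this
        · have hj : b ≤ (j : ℕ) := le_trans hi (le_of_lt hij)
          have := @hβ ⟨i, hi⟩ ⟨j, hj⟩ hij
          simp only [Equiv.Perm.mul_apply]
          rw [hA _ _ (ha.trans hi), hA _ _ (ha.trans hj),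
            Equiv.Perm.ofSubtype_apply_of_mem β hi, Equiv.Perm.ofSubtype_apply_of_mem β hj]
          exact this
      · simp only [F, map_inv]
        group
  rw [← hF.sum_comp T]
  have hT : ∀ x, T (F x) = T x.1.1 := fun x => by
    simp only [F]
    rw [h₂ _ _ (hB _), h₁ _ _ (hA _)]
  simp only [hT]
  have cA : Fintype.card {s : Fin n // (s : ℕ) < a} = a := by
    rw [Fintype.card_subtype, Fin.card_filter_val_lt, min_eq_right (ha.trans hb)]
  have cB : Fintype.card {s : Fin n // b ≤ (s : ℕ)} = n - b := by
    have := Fintype.card_subtype_compl fun s : Fin n => (s : ℕ) < b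
    simp only [not_lt] at this
    rw [this, Fintype.card_fin, Fintype.card_subtype, Fin.card_filter_val_lt, min_eq_right hb]
  rw [Fintype.sum_prod_type, ← Finset.sum_coe_sort (unshuffles n a b), Finset.smul_sum]
  refine Finset.sum_congr rfl fun σ _ => ?_
  change ∑ _y, T σ.1 = _
  rw [Finset.sum_const, Finset.card_univ, Fintype.card_prod, Fintype.card_perm, Fintype.card_perm,
    cA, cB]

end Perm

/-! ### Alternation over the arguments -/

section Alt

variable {k H : Type*} [Field k] [Ring H] [Bialgebra k H] [Coalgebra.IsCocomm k H]
variable {M N : Type*}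
variable [AddCommGroup N] [Module k N] [Module H N]

/-- The summand of `alt` belonging to the permutation `σ`. -/
def altTerm {m n : ℕ} (h : m = n) (E : (Fin m → M) → PT k H N m) (u : Fin n → M)
    (σ : Equiv.Perm (Fin n)) : PT k H N n :=
  sgn k σ • PT.rx ((finCongr h).trans σ) (E fun s => u (σ (Fin.cast h s)))

/-- Alternation over all permutations of the arguments. -/
def alt {m n : ℕ} (h : m = n) (E : (Fin m → M) → PT k H N m) (u : Fin n → M) : PT k H N n :=
  ∑ σ, altTerm h E u σ

/-- `E` changes by the sign under the permutation `π` of its arguments. -/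
def SkewUnder {m : ℕ} (E : (Fin m → M) → PT k H N m) (π : Equiv.Perm (Fin m)) : Prop :=
  ∀ u, E u = sgn k π • PT.rx π (E fun s => u (π s))

theorem SkewUnder.one {m : ℕ} (E : (Fin m → M) → PT k H N m) : SkewUnder E 1 := fun u => by
  rw [sgn_one, one_smul, PT.rx_one]; rfl

theorem SkewUnder.mul {m : ℕ} {E : (Fin m → M) → PT k H N m} {π ρ : Equiv.Perm (Fin m)}
    (hπ : SkewUnder E π) (hρ : SkewUnder E ρ) : SkewUnder E (π * ρ) := fun u => by
  rw [hπ u, hρ fun s => u (π s), map_smul, smul_smul, sgn_mul, PT.rx_mul]; rfl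

/-- Skewness is closed under products and transpositions generate, so it suffices to know it for the
transpositions inside `B`. -/
theorem SkewUnder.of_swaps {m : ℕ} {E : (Fin m → M) → PT k H N m} {B : Fin m → Prop}
    (h : ∀ s t, s ≠ t → B s → B t → SkewUnder E (Equiv.swap s t)) {π : Equiv.Perm (Fin m)}
    (hπ : ∀ s, ¬ B s → π s = s) : SkewUnder E π := by
  classical
  have hB : ∀ s, B (π s) ↔ B s := fun s => by
    by_cases hs : B s
    · refine ⟨fun _ => hs, fun _ => ?_⟩
      by_contra hc
      have := π.injective (hπ _ hc)
      exact hc (this.symm ▸ hs)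
    · rw [hπ s hs]
  rw [← Equiv.Perm.ofSubtype_subtypePerm hB fun s hs => by_contra fun hc => hs (hπ s hc)]
  induction π.subtypePerm hB using Equiv.Perm.swap_induction_on with
  | one => rw [map_one]; exact .one E
  | swap_mul f x y hxy ih =>
    rw [map_mul, Equiv.Perm.ofSubtype_swap_eq]
    exact (h _ _ (fun e => hxy (Subtype.ext e)) x.2 y.2).mul ih

/-- The sign produced by the skewness of `E` cancels the factor `sgn π` of `sgn (σ * π)`. Hence
summands are constant on cosets of the symmetry group of `E`. -/
theorem altTerm_mul {m n : ℕ} (h : m = n) {E : (Fin m → M) → PT k H N m}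
    {π : Equiv.Perm (Fin n)} (hπ : SkewUnder E ((finCongr h).symm.permCongr π)) (u : Fin n → M)
    (σ : Equiv.Perm (Fin n)) : altTerm h E u (σ * π) = altTerm h E u σ := by
  subst h
  have h1 : (finCongr (rfl : m = m)).symm.permCongr π = π := rfl
  rw [h1] at hπ
  rw [altTerm, altTerm, hπ fun s => u (σ (Fin.cast rfl s)), map_smul, smul_smul, sgn_mul]
  congr 1
  rw [PT.rx_rx]
  rfl

/-- Left translation by `τ` permutes the summands of the alternation. -/
theorem alt_skew {m n : ℕ} (h : m = n) (E : (Fin m → M) → PT k H N m) (τ : Equiv.Perm (Fin n)) :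
    SkewUnder (alt h E) τ := fun u => by
  rw [alt, alt, map_sum, Finset.smul_sum, ← Equiv.sum_comp (Equiv.mulLeft τ)]
  refine Finset.sum_congr rfl fun σ _ => ?_
  rw [altTerm, altTerm, map_smul, smul_smul, Equiv.coe_mulLeft, sgn_mul, PT.rx_rx]
  rfl

theorem alt_sum {ι : Type*} {m n : ℕ} (h : m = n) (s : Finset ι)
    (E : ι → (Fin m → M) → PT k H N m) (u : Fin n → M) :
    alt h (fun v => ∑ i ∈ s, E i v) u = ∑ i ∈ s, alt h (E i) u := by
  simp only [alt, altTerm, map_sum, Finset.smul_sum]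
  exact Finset.sum_comm

theorem alt_add {m n : ℕ} (h : m = n) (E E' : (Fin m → M) → PT k H N m) (u : Fin n → M) :
    alt h (fun v => E v + E' v) u = alt h E u + alt h E' u := by
  simp only [alt, altTerm, map_add, smul_add, Finset.sum_add_distrib]

theorem alt_smul {m n : ℕ} (h : m = n) (c : k) (E : (Fin m → M) → PT k H N m) (u : Fin n → M) :
    alt h (fun v => c • E v) u = c • alt h E u := by
  simp only [alt, altTerm, map_smul, Finset.smul_sum, smul_comm c]

theorem alt_neg {m n : ℕ} (h : m = n) (E : (Fin m → M) → PT k H N m) (u : Fin n → M) :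
    alt h (fun v => -E v) u = -alt h E u := by
  simp only [alt, altTerm, map_neg, smul_neg, Finset.sum_neg_distrib]

/-- Permuting the arguments before alternating only contributes the sign. -/
theorem alt_perm {m n : ℕ} (h : m = n) (E : (Fin m → M) → PT k H N m) (π : Equiv.Perm (Fin m))
    (u : Fin n → M) :
    alt h (fun v => PT.rx π (E fun s => v (π s))) u = sgn k π • alt h E u := by
  subst h
  rw [alt, alt, Finset.smul_sum, ← Equiv.sum_comp (Equiv.mulRight π⁻¹)]
  refine Finset.sum_congr rfl fun σ _ => ?_
  rw [altTerm, altTerm, Equiv.coe_mulRight, sgn_mul, sgn_inv, PT.rx_rx, smul_smul, mul_comm]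
  congr 1
  have : ((finCongr (rfl : m = m)).trans σ) = π.trans ((finCongr rfl).trans (σ * π⁻¹)) := by
    ext s
    simp
  rw [this]
  congr 2
  ext s
  simp

/-- Alternating a function of a different size which agrees up to the obvious identification. -/
theorem alt_cast {l m n : ℕ} (h : m = n) (h' : l = m) (E : (Fin l → M) → PT k H N l)
    (u : Fin n → M) :
    alt h (fun v => PT.rx (finCongr h') (E fun s => v (Fin.cast h' s))) u =
      alt (h'.trans h) E u := by
  subst h' h
  change alt _ (fun v => PT.rx (Equiv.refl _) (E v)) u = _
  simp only [PT.rx_refl]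

/-- An inner alternation over a family of permutations is absorbed. -/
theorem alt_average {ι : Type*} [Fintype ι] {m n : ℕ} (h : m = n)
    (E : (Fin m → M) → PT k H N m) (π : ι → Equiv.Perm (Fin m)) (u : Fin n → M) :
    alt h (fun v => ∑ i, sgn k (π i) • PT.rx (π i) (E fun s => v (π i s))) u =
      (Fintype.card ι : k) • alt h E u := by
  rw [alt_sum]
  simp only [alt_smul, alt_perm, smul_smul, sgn_mul_self, one_smul]
  rw [Finset.sum_const, Finset.card_univ, Nat.cast_smul_eq_nsmul]

end Alt

/-! ### The Nijenhuis–Richardson product -/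

section Circ

variable {k H : Type*} [Field k] [Ring H] [Bialgebra k H] [Coalgebra.IsCocomm k H]
variable {M N : Type*} [AddCommGroup M] [Module k M] [Module H M]
variable [AddCommGroup N] [Module k N] [Module H N]

variable (k H) in
/-- `H^{⊗m}`-multilinearity. -/
structure IsHMultilinear {m : ℕ} (E : (Fin m → M) → PT k H N m) : Prop where
  add : ∀ u i x y, E (Function.update u i (x + y)) =
    E (Function.update u i x) + E (Function.update u i y)
  smul : ∀ u i (c : k) x, E (Function.update u i (c • x)) = c • E (Function.update u i x)
  slot : ∀ u i (a : H), E (Function.update u i (a • u i)) = PT.act (slot i a) (E u)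

/-- A skew-symmetric `H^{⊗n}`-linear function as a cochain. -/
def toCochain {n : ℕ} (E : (Fin n → M) → PT k H N n) (hE : IsHMultilinear k H E)
    (hs : ∀ σ, SkewUnder E σ) : Cochain k H M N n :=
  ⟨{ toFun := E
     map_update_add' := fun u i x y => by convert hE.add u i x y
     map_update_smul' := fun u i c x => by convert hE.smul u i c x },
    fun u i a => by exact hE.slot u i a, fun σ u => hs σ u⟩

theorem cochain_ext {n : ℕ} {f g : Cochain k H M N n} (h : ∀ u, f u = g u) : f = g :=
  Subtype.ext (MultilinearMap.ext h)

theorem cochain_multilinear {n : ℕ} (f : Cochain k H M N n) : IsHMultilinear k H fun u => f u :=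
  ⟨fun u i x y => f.1.map_update_add u i x y, fun u i c x => f.1.map_update_smul u i c x, f.2.1⟩

theorem cochain_add_apply {n : ℕ} (f g : Cochain k H M N n) (u : Fin n → M) :
    (f + g) u = f u + g u := rfl

theorem cochain_smul_apply {n : ℕ} (c : k) (f : Cochain k H M N n) (u : Fin n → M) :
    (c • f) u = c • f u := rfl

theorem IsHMultilinear.const_smul {m : ℕ} {E : (Fin m → M) → PT k H N m}
    (hE : IsHMultilinear k H E) (c : k) : IsHMultilinear k H fun u => c • E u :=
  ⟨fun u i x y => by rw [hE.add, smul_add], fun u i c' x => by rw [hE.smul, smul_comm],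
    fun u i a => by rw [hE.slot, PT.act_smul]⟩

theorem IsHMultilinear.alt {m n : ℕ} (h : m = n) {E : (Fin m → M) → PT k H N m}
    (hE : IsHMultilinear k H E) : IsHMultilinear k H (alt h E) := by
  subst h
  have key : ∀ (u : Fin m → M) (i : Fin m) (x : M) (σ : Equiv.Perm (Fin m)),
      (fun s => Function.update u i x (σ (Fin.cast rfl s))) =
        Function.update (fun s => u (σ s)) (σ.symm i) x := fun u i x σ =>
    Function.update_comp_equiv u σ i x
  refine ⟨fun u i x y => ?_, fun u i c x => ?_, fun u i a => ?_⟩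
  · simp only [LiePseudo.alt, altTerm, key, hE.add, map_add, smul_add, Finset.sum_add_distrib]
  · simp only [LiePseudo.alt, altTerm, key, hE.smul, map_smul, Finset.smul_sum, smul_comm c]
  · simp only [LiePseudo.alt, altTerm, key, PT.act_sum, PT.act_smul]
    refine Finset.sum_congr rfl fun σ _ => ?_
    have := hE.slot (fun s => u (σ s)) (σ.symm i) a
    simp only [Equiv.apply_symm_apply] at this
    rw [this, PT.act_slot_rx]
    simp

/-- `f(g(u₁, …, uₘ), uₘ₊₁, …, uₘ₊ₙ)`. -/
def nest {m n : ℕ} (f : Cochain k H M N (n + 1)) (g : Cochain k H M M m) (u : Fin (m + n) → M) :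
    PT k H N (m + n) :=
  ins f (fun s => u (Fin.natAdd m s)) (g fun s => u (Fin.castAdd n s))

theorem update_castAdd {X : Type*} {m n : ℕ} (u : Fin (m + n) → X) (i : Fin m) (x : X) :
    (fun s => Function.update u (Fin.castAdd n i) x (Fin.castAdd n s)) =
      Function.update (fun s => u (Fin.castAdd n s)) i x ∧
    (fun s => Function.update u (Fin.castAdd n i) x (Fin.natAdd m s)) =
      fun s => u (Fin.natAdd m s) :=
  ⟨Function.update_comp_eq_of_injective u (Fin.castAdd_injective m n) i x,
    Function.update_comp_eq_of_notMem_range u x (by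
      rintro ⟨s, hs⟩
      exact castAdd_ne_natAdd _ _ hs.symm)⟩

theorem update_natAdd {X : Type*} {m n : ℕ} (u : Fin (m + n) → X) (i : Fin n) (x : X) :
    (fun s => Function.update u (Fin.natAdd m i) x (Fin.natAdd m s)) =
      Function.update (fun s => u (Fin.natAdd m s)) i x ∧
    (fun s => Function.update u (Fin.natAdd m i) x (Fin.castAdd n s)) =
      fun s => u (Fin.castAdd n s) :=
  ⟨Function.update_comp_eq_of_injective u (Fin.natAdd_injective n m) i x,
    Function.update_comp_eq_of_notMem_range u x (by
      rintro ⟨s, hs⟩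
      exact castAdd_ne_natAdd _ _ hs)⟩

theorem nest_multilinear {m n : ℕ} (f : Cochain k H M N (n + 1)) (g : Cochain k H M M m) :
    IsHMultilinear k H (nest f g) := by
  have hg := cochain_multilinear g
  refine ⟨fun u i x y => ?_, fun u i c x => ?_, fun u i a => ?_⟩
  · induction i using Fin.addCases with
    | left i => simp only [nest, (update_castAdd u i _).1, (update_castAdd u i _).2, hg.add, map_add]
    | right i =>
      simp only [nest, (update_natAdd u i _).1, (update_natAdd u i _).2, ins_update_add]
  · induction i using Fin.addCases with
    | left i =>
      simp only [nest, (update_castAdd u i _).1, (update_castAdd u i _).2, hg.smul, map_smul]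
    | right i =>
      simp only [nest, (update_natAdd u i _).1, (update_natAdd u i _).2, ins_update_smul]
  · induction i using Fin.addCases with
    | left i =>
      have := hg.slot (fun s => u (Fin.castAdd n s)) i a
      simp only [nest, (update_castAdd u i _).1, (update_castAdd u i _).2, this, ins_act,
        place_slot]
    | right i =>
      have := ins_slot_smul f (fun s => u (Fin.natAdd m s)) i a (g fun s => u (Fin.castAdd n s))
      simp only [nest, (update_natAdd u i _).1, (update_natAdd u i _).2, this]

/-- The arguments of `g` and the remaining arguments of `f` form two blocks, each inheriting
skewness from its cochain. This makes the factorial normalisation equivalent to summing over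
unshuffles. -/
theorem nest_skew {m n : ℕ} (f : Cochain k H M N (n + 1)) (g : Cochain k H M M m)
    (τ : Equiv.Perm (Fin m)) (τ' : Equiv.Perm (Fin n)) :
    SkewUnder (nest f g) (blockEquiv τ τ') := fun u => by
  rw [nest, nest, cochain_skew g τ, map_smul, ins_rx, ins_skew f τ', map_smul, smul_smul,
    sgn_blockEquiv, PT.rx_rx]
  simp only [blockEquiv_castAdd, blockEquiv_natAdd]
  congr 2
  congr 1
  ext s : 1
  refine Fin.addCases (fun s => ?_) (fun s => ?_) s <;> simp

/-- Skewness under all permutations of a block of arguments. -/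
theorem SkewUnder.of_block {X : Type*} {m n : ℕ} {E : (Fin n → X) → PT k H N n} (j : Fin m → Fin n)
    (hj : Function.Injective j) (e : Equiv.Perm (Fin m) → Equiv.Perm (Fin n))
    (he : ∀ τ i, e τ (j i) = j (τ i)) (he' : ∀ τ s, (∀ i, j i ≠ s) → e τ s = s)
    (hE : ∀ τ, SkewUnder E (e τ)) {π : Equiv.Perm (Fin n)}
    (hπ : ∀ s, (∀ i, j i ≠ s) → π s = s) : SkewUnder E π := by
  refine SkewUnder.of_swaps (B := fun s => ∃ i, j i = s) ?_ fun s hs => hπ s (by simpa using hs)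
  rintro _ _ hst ⟨s, rfl⟩ ⟨t, rfl⟩
  have : Equiv.swap (j s) (j t) = e (Equiv.swap s t) := by
    ext x : 1
    by_cases hx : ∃ i, j i = x
    · obtain ⟨i, rfl⟩ := hx
      rw [he, hj.swap_apply]
    · simp only [not_exists] at hx
      rw [he' _ _ hx, Equiv.swap_apply_of_ne_of_ne (Ne.symm (hx s)) (Ne.symm (hx t))]
  rw [this]
  exact hE _

theorem SkewUnder.of_left {X : Type*} {m n : ℕ} {E : (Fin (m + n) → X) → PT k H N (m + n)}
    (hE : ∀ τ : Equiv.Perm (Fin m), SkewUnder E (blockEquiv τ (Equiv.refl _)))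
    {π : Equiv.Perm (Fin (m + n))} (hπ : ∀ s : Fin (m + n), m ≤ (s : ℕ) → π s = s) :
    SkewUnder E π := by
  refine SkewUnder.of_block (Fin.castAdd n) (Fin.castAdd_injective m n)
    (fun τ => blockEquiv τ (Equiv.refl _)) (by simp) (fun τ s hs => ?_) hE fun s hs => hπ s ?_
  · induction s using Fin.addCases with
    | left s => exact absurd rfl (hs s)
    | right s => simp
  · induction s using Fin.addCases with
    | left s => exact absurd rfl (hs s)
    | right s => simp

theorem SkewUnder.of_right {X : Type*} {m n : ℕ} {E : (Fin (m + n) → X) → PT k H N (m + n)}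
    (hE : ∀ τ : Equiv.Perm (Fin n), SkewUnder E (blockEquiv (Equiv.refl _) τ))
    {π : Equiv.Perm (Fin (m + n))} (hπ : ∀ s : Fin (m + n), (s : ℕ) < m → π s = s) :
    SkewUnder E π := by
  refine SkewUnder.of_block (Fin.natAdd m) (Fin.natAdd_injective n m)
    (fun τ => blockEquiv (Equiv.refl _) τ) (by simp) (fun τ s hs => ?_) hE fun s hs => hπ s ?_
  · induction s using Fin.addCases with
    | right s => exact absurd rfl (hs s)
    | left s => simp
  · induction s using Fin.addCases with
    | right s => exact absurd rfl (hs s)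
    | left s => simp

variable (k) in
/-- The factor `1 / (m! n!)`. -/
def wt (m n : ℕ) : k := ((m.factorial * n.factorial : ℕ) : k)⁻¹

theorem add_one_add_eq (a b : ℕ) : b + 1 + a = a + b + 1 := by omega

/-- The Nijenhuis–Richardson product of cochains. -/
def circFun {a b : ℕ} (f : Cochain k H M N (a + 1)) (g : Cochain k H M M (b + 1)) :
    Cochain k H M N (a + b + 1) :=
  toCochain (fun u => wt k (b + 1) a • alt (add_one_add_eq a b) (nest f g) u)
    (((nest_multilinear f g).alt (add_one_add_eq a b)).const_smul _) fun σ u => by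
      change wt k (b + 1) a • alt _ _ u = _ • PT.rx σ (wt k (b + 1) a • alt _ _ _)
      rw [alt_skew _ _ σ u, smul_comm, map_smul]

theorem circFun_apply {a b : ℕ} (f : Cochain k H M N (a + 1)) (g : Cochain k H M M (b + 1))
    (u : Fin (a + b + 1) → M) :
    circFun f g u = wt k (b + 1) a • alt (add_one_add_eq a b) (nest f g) u := rfl

/-- The Nijenhuis–Richardson product as a bilinear map. -/
def circ {a b : ℕ} :
    Cochain k H M N (a + 1) →ₗ[k] Cochain k H M M (b + 1) →ₗ[k] Cochain k H M N (a + b + 1) :=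
  LinearMap.mk₂ k circFun
    (fun f f' g => cochain_ext fun u => by
      rw [cochain_add_apply, circFun_apply, circFun_apply, circFun_apply, ← smul_add, ← alt_add]
      congr 2
      exact funext fun v => ins_add _ _ _ _)
    (fun c f g => cochain_ext fun u => by
      rw [cochain_smul_apply, circFun_apply, circFun_apply, smul_comm c (wt k (b + 1) a),
        ← alt_smul _ c]
      congr 2
      exact funext fun v => ins_smul _ _ _ _)
    (fun f g g' => cochain_ext fun u => by
      rw [cochain_add_apply, circFun_apply, circFun_apply, circFun_apply, ← smul_add, ← alt_add]
      congr 2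
      exact funext fun v => map_add (ins f _) _ _)
    (fun c f g => cochain_ext fun u => by
      rw [cochain_smul_apply, circFun_apply, circFun_apply, smul_comm c (wt k (b + 1) a),
        ← alt_smul _ c]
      congr 2
      exact funext fun v => map_smul (ins f _) _ _)

theorem circ_apply {a b : ℕ} (f : Cochain k H M N (a + 1)) (g : Cochain k H M M (b + 1))
    (u : Fin (a + b + 1) → M) :
    circ f g u = wt k (b + 1) a • alt (add_one_add_eq a b) (nest f g) u := rfl

end Circ

/-! ### Signs of block exchanges, and the position of a distinguished argument -/

section PreLie

theorem sign_flip (m n : ℕ) :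
    Equiv.Perm.sign ((finCongr (Nat.add_comm n m)).trans finAddFlip : Equiv.Perm (Fin (n + m))) =
      (-1) ^ (m * n) := by
  rcases Nat.eq_zero_or_pos m with rfl | hm
  · have : ((finCongr (Nat.add_comm n 0)).trans finAddFlip : Equiv.Perm (Fin (n + 0))) = 1 := by
      ext i
      change ((finAddFlip (Fin.cast (Nat.add_comm n 0) i) : Fin (n + 0)) : ℕ) = i
      rw [finAddFlip_val]
      simp
    rw [this]; simp
  · obtain ⟨N, hN⟩ : ∃ N, n + m = N + 1 := ⟨n + m - 1, by omega⟩
    -- Exchanging two blocks is a power of the cyclic rotation, whose sign is known.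
    have e : ((finCongr (Nat.add_comm n m)).trans finAddFlip : Equiv.Perm (Fin (n + m))) =
        finRotate (n + m) ^ n := by
      have key : ∀ j (i : Fin (n + m)), ((finRotate (n + m) ^ j) i : ℕ) = ((i : ℕ) + j) % (n + m) := by
        intro j
        induction j with
        | zero => intro i; simp [Nat.mod_eq_of_lt i.2]
        | succ j ih =>
          intro i
          rw [pow_succ', Equiv.Perm.mul_apply]
          have h2 : ∀ x : Fin (n + m), (finRotate (n + m) x : ℕ) = ((x : ℕ) + 1) % (n + m) := by
            rw [hN]
            intro x
            rw [finRotate_apply, Fin.val_add, Fin.val_one']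
            simp
          rw [h2, ih, Nat.mod_add_mod, add_assoc]
      ext i
      rw [key]
      simp only [Equiv.trans_apply, finAddFlip_val, finCongr_apply, Fin.val_cast]
      split_ifs with h
      · rw [Nat.mod_eq_of_lt (by omega)]
      · rw [Nat.mod_eq_sub_mod (by omega), Nat.mod_eq_of_lt (by omega)]
        omega
    rw [e, map_pow, sign_finRotate, ← pow_mul]
    obtain ⟨m, rfl⟩ : ∃ m', m = m' + 1 := ⟨m - 1, by omega⟩
    -- The exponent differs from the desired one by `n * n` against `n`, which have the same parity.
    have e2 : (n + (m + 1) - 1) * n = m * n + n * n := by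
      rw [show n + (m + 1) - 1 = m + n by omega, add_mul]
    rw [e2, add_mul, pow_add, pow_add, one_mul]
    congr 1
    rcases Nat.even_or_odd n with h | h
    · rw [(h.mul_left n).neg_one_pow, h.neg_one_pow]
    · rw [(h.mul h).neg_one_pow, h.neg_one_pow]

theorem blockEquiv_finCongr {m m' n : ℕ} (h : m = m') :
    blockEquiv (finCongr h) (Equiv.refl (Fin n)) = finCongr (by rw [h]) := by
  subst h
  ext i
  refine Fin.addCases (fun s => ?_) (fun s => ?_) i
  · rw [blockEquiv_castAdd]; rfl
  · rw [blockEquiv_natAdd]; rfl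

variable {k H : Type*} [Field k] [Ring H] [Bialgebra k H] [Coalgebra.IsCocomm k H]
variable {M N : Type*} [AddCommGroup M] [Module k M] [Module H M]
variable [AddCommGroup N] [Module k N] [Module H N]

theorem alt_equiv {X : Type*} {l m n : ℕ} (h : m = n) (hl : l = m) (E : (Fin l → X) → PT k H N l)
    (e : Fin l ≃ Fin m) (u : Fin n → X) :
    alt h (fun v => PT.rx e (E fun s => v (e s))) u =
      sgn k ((finCongr hl.symm).trans e) • alt (hl.trans h) E u := by
  subst hl
  exact alt_perm h E e u

theorem altTerm_mul_left {X : Type*} {m n : ℕ} (h : m = n) (E : (Fin m → X) → PT k H N m)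
    (u : Fin n → X) (τ σ : Equiv.Perm (Fin n)) :
    altTerm h E u (τ * σ) = sgn k τ • PT.rx τ (altTerm h E (fun s => u (τ s)) σ) := by
  rw [altTerm, altTerm, map_smul, smul_smul, sgn_mul, PT.rx_rx]
  rfl

/-- `f(g(k(u'), u''), u''')`. -/
def nest₃ {a b c : ℕ} (f : Cochain k H M N (a + 1)) (g : Cochain k H M M (b + 1))
    (q : Cochain k H M M (c + 1)) (u : Fin (c + 1 + b + a) → M) : PT k H N (c + 1 + b + a) :=
  ins f (fun s => u (Fin.natAdd (c + 1 + b) s)) (nest g q fun s => u (Fin.castAdd a s))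

/-- `f(q(u'), g(u''), u''')`. -/
def fork {n b c : ℕ} (f : Cochain k H M N (n + 2)) (q : Cochain k H M M (c + 1))
    (g : Cochain k H M M (b + 1)) (u : Fin (c + 1 + (b + 1) + n) → M) :
    PT k H N (c + 1 + (b + 1) + n) :=
  ins₂ f (fun s => u (Fin.natAdd (c + 1 + (b + 1)) s))
    (q fun s => u (Fin.castAdd n (Fin.castAdd (b + 1) s)))
    (g fun s => u (Fin.castAdd n (Fin.natAdd (c + 1) s)))

/-- The outer minus sign comes from exchanging two arguments of `f`; the power of -1 is the sign of
exchanging the blocks of `b + 1` and `c + 1` arguments. This is the symmetry behind the pre-Lie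
identity. -/
theorem alt_fork_swap {n b c r : ℕ} (h : c + 1 + (b + 1) + n = r) (h' : b + 1 + (c + 1) + n = r)
    (f : Cochain k H M N (n + 2)) (q : Cochain k H M M (c + 1)) (g : Cochain k H M M (b + 1))
    (u : Fin r → M) :
    alt h (fork f q g) u = -((-1 : k) ^ ((b + 1) * (c + 1)) • alt h' (fork f g q) u) := by
  have e : fork f q g = fun v => -PT.rx (blockEquiv finAddFlip (Equiv.refl _))
      (fork f g q fun s => v (blockEquiv finAddFlip (Equiv.refl _) s)) := by
    funext v
    rw [fork, ins₂_swap, fork]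
    simp
  rw [e, alt_neg, alt_equiv h (by omega)]
  congr 2
  have e2 : (finCongr (by omega : c + 1 + (b + 1) + n = b + 1 + (c + 1) + n)).trans
      (blockEquiv finAddFlip (Equiv.refl _)) = blockEquiv (n := n)
        ((finCongr (Nat.add_comm (c + 1) (b + 1))).trans finAddFlip) (Equiv.refl _) := by
    rw [← blockEquiv_finCongr (Nat.add_comm (c + 1) (b + 1))]
    ext i : 1
    refine Fin.addCases (fun s => ?_) (fun s => ?_) i <;> simp
  rw [e2]
  refine (sgn_blockEquiv _ 1).trans ?_
  rw [sgn_one, mul_one, sgn, sign_flip]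
  simp

theorem spr_shift {c r : ℕ} (x : HT k H c) (τ : Equiv.Perm (Fin r)) (t : PT k H N (r + 1)) :
    PT.spr (block₁ c r) (place _ (Fin.castAdd_injective c r) x) (PT.rx (shiftPerm τ) t) =
      PT.rx (blockEquiv (Equiv.refl _) τ)
        (PT.spr (block₁ c r) (place _ (Fin.castAdd_injective c r) x) t) := by
  rw [PT.spr_rx_of (q := block₁ c r ∘ blockEquiv (Equiv.refl _) τ.symm)]
  · refine (PT.rx_spr_of (fun i => ?_) ?_ _).symm
    · refine Fin.addCases (fun s => ?_) (fun s => ?_) i <;> simp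
    · rw [fibre_symm_place]
      refine place_congr ?_ _ _ _
      ext s : 1
      simp
  · intro i
    refine Fin.addCases (fun s => ?_) (fun s => ?_) i
    · simp [block₁_castAdd]
    · simp [block₁_natAdd]

/-- The cycle belonging to `t` puts the first argument into position `t`. The `b + 1` positions
inside `g` give equal terms by skewness of `g`, and the `a` positions outside give equal terms by
skewness of `f`. For the latter the position directly behind the block of `g` is the representative;
it exists only if `0 < a`. -/
theorem sum_cycleRange_altTerm {a b r : ℕ} (h : b + 1 + a = r + 1) (f : Cochain k H M N (a + 1))
    (g : Cochain k H M M (b + 1)) (u : Fin (r + 1) → M) {A : PT k H N (r + 1)}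
    (hA : ∀ ha : 0 < a, altTerm h (nest f g) u (Fin.cycleRange ⟨b + 1, by omega⟩) = A) :
    ∑ t : Fin (r + 1), altTerm h (nest f g) u t.cycleRange =
      ((b + 1 : ℕ) : k) • PT.rx (finCongr h) (nest f g fun s => u (Fin.cast h s)) + (a : k) • A := by
  have h0 : altTerm h (nest f g) u 1 =
      PT.rx (finCongr h) (nest f g fun s => u (Fin.cast h s)) := by
    rw [altTerm, sgn_one, one_smul]; rfl
  have h1 : ∀ t : Fin (r + 1), (t : ℕ) < b + 1 → altTerm h (nest f g) u t.cycleRange =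
      altTerm h (nest f g) u 1 := by
    intro t ht
    rw [← one_mul t.cycleRange]
    refine altTerm_mul h (SkewUnder.of_left (fun τ => nest_skew f g τ 1) fun s hs => ?_) u 1
    have hgt : t < Fin.cast h s := by
      simp only [Fin.lt_def, Fin.val_cast]
      omega
    ext
    change (t.cycleRange (Fin.cast h s) : ℕ) = s
    rw [Fin.cycleRange_of_gt hgt, Fin.val_cast]
  have h2 : ∀ t : Fin (r + 1), b + 1 ≤ (t : ℕ) → altTerm h (nest f g) u t.cycleRange = A := by
    intro t ht
    rw [← hA (by omega)]
    set t₀ : Fin (r + 1) := ⟨b + 1, by omega⟩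
    -- Both cycles act alike on the first `b + 1` positions, so the quotient permutes only the
    -- remaining arguments of `f`.
    have : t.cycleRange = t₀.cycleRange * (t₀.cycleRange⁻¹ * t.cycleRange) := by group
    rw [this]
    refine altTerm_mul h (SkewUnder.of_right (fun τ => nest_skew f g 1 τ) fun s hs => ?_) u _
    have e : t.cycleRange (Fin.cast h s) = t₀.cycleRange (Fin.cast h s) := by
      ext
      rw [Fin.coe_cycleRange_of_lt, Fin.coe_cycleRange_of_lt]
      · exact hs
      · exact Fin.lt_def.mpr (lt_of_lt_of_le hs ht)
    ext
    change (t₀.cycleRange.symm (t.cycleRange (Fin.cast h s)) : ℕ) = s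
    rw [e, Equiv.symm_apply_apply, Fin.val_cast]
  rw [← Equiv.sum_comp (finCongr h), Fin.sum_univ_add]
  congr 1
  · rw [Finset.sum_congr rfl fun s _ => (h1 _ (by simp; omega)).trans h0, Finset.sum_const,
      Finset.card_univ, Fintype.card_fin, Nat.cast_smul_eq_nsmul]
  · rw [Finset.sum_congr rfl fun s _ => h2 _ (by simp), Finset.sum_const,
      Finset.card_univ, Fintype.card_fin, Nat.cast_smul_eq_nsmul]

end PreLie

/-! ### Iterated Nijenhuis–Richardson products -/

section PreLie

variable {k H : Type*} [Field k] [Ring H] [Bialgebra k H] [Coalgebra.IsCocomm k H]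
variable {M N : Type*} [AddCommGroup M] [Module k M] [Module H M]
variable [AddCommGroup N] [Module k N] [Module H N]

theorem alt_cons {X : Type*} {m r : ℕ} (h : m = r + 1) (E : (Fin m → X) → PT k H N m) (w : X)
    (v : Fin r → X) : alt h E (Fin.cons w v) = ∑ τ : Equiv.Perm (Fin r), sgn k τ •
      PT.rx (shiftPerm τ) (∑ t : Fin (r + 1),
        altTerm h E (Fin.cons w fun s => v (τ s)) t.cycleRange) := by
  rw [alt, sum_perm_succ_inv]
  refine Finset.sum_congr rfl fun τ _ => ?_
  rw [map_sum, Finset.smul_sum]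
  refine Finset.sum_congr rfl fun t _ => ?_
  rw [altTerm_mul_left, sgn_shiftPerm]
  congr 4
  ext s
  cases s using Fin.cases <;> simp

theorem sgn_cycleRange {n : ℕ} (t : Fin n) : sgn k t.cycleRange = (-1) ^ (t : ℕ) := by
  simp [sgn, Fin.sign_cycleRange]

/-- The first argument of the Nijenhuis–Richardson product, inner case. -/
theorem spr_nest {a b c r : ℕ} (h : b + 1 + a = r + 1) (h' : c + b + a = c + r)
    (f : Cochain k H M N (a + 1)) (g : Cochain k H M M (b + 1)) (x : HT k H c) (w : M)
    (v : Fin r → M) :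
    PT.spr (block₁ c r) (place _ (Fin.castAdd_injective c r) x)
      (PT.rx (finCongr h) (nest f g fun s => (Fin.cons w v : Fin (r + 1) → M) (Fin.cast h s))) =
    PT.rx (finCongr h') (ins f (fun s : Fin a => v ⟨b + s, by omega⟩)
      (ins g (fun s : Fin b => v ⟨s, by omega⟩) (PT.mk x w))) := by
  rw [nest, spr_ins h h', ins_mk]
  have e1 : (fun s : Fin a => (Fin.cons w v : Fin (r + 1) → M)
      (Fin.cast h (Fin.natAdd (b + 1) s))) = fun s : Fin a => v ⟨b + s, by omega⟩ := by
    ext s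
    have : Fin.cast h (Fin.natAdd (b + 1) s) = Fin.succ ⟨b + s, by omega⟩ := by
      ext
      simp
      omega
    rw [this, Fin.cons_succ]
  have e2 : (fun s : Fin (b + 1) => (Fin.cons w v : Fin (r + 1) → M)
      (Fin.cast h (Fin.castAdd a s))) =
      Fin.cons w fun s : Fin b => v ⟨s, by omega⟩ := by
    ext s
    cases s using Fin.cases with
    | zero => rfl
    | succ s => rfl
  rw [e1, e2]

/-- The first argument of the Nijenhuis–Richardson product, outer case. -/
theorem spr_altTerm_nest {n b c r : ℕ} (h : b + 1 + (n + 1) = r + 1)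
    (h' : c + (b + 1) + n = c + r) (hb : b + 1 < r + 1)
    (f : Cochain k H M N (n + 2)) (g : Cochain k H M M (b + 1)) (x : HT k H c) (w : M)
    (v : Fin r → M) :
    PT.spr (block₁ c r) (place _ (Fin.castAdd_injective c r) x)
      (altTerm h (nest f g) (Fin.cons w v) (Fin.cycleRange ⟨b + 1, hb⟩)) =
    (-1 : k) ^ b • PT.rx (finCongr h') (ins₂ f (fun s : Fin n => v ⟨b + 1 + s, by omega⟩)
      (PT.mk x w) (g fun s : Fin (b + 1) => v ⟨s, by omega⟩)) := by
  have e1 : (fun s : Fin (n + 1) => (Fin.cons w v : Fin (r + 1) → M)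
      (Fin.cycleRange ⟨b + 1, hb⟩ (Fin.cast h (Fin.natAdd (b + 1) s)))) =
      Fin.cons w fun s : Fin n => v ⟨b + 1 + s, by omega⟩ := by
    ext s
    cases s using Fin.cases with
    | zero =>
      have : (Fin.cycleRange ⟨b + 1, hb⟩ (Fin.cast h (Fin.natAdd (b + 1) 0))) = 0 := by
        ext
        rw [cycleRange_val]
        simp [Fin.ext_iff, Fin.lt_def]
      rw [this]; rfl
    | succ s =>
      have : (Fin.cycleRange ⟨b + 1, hb⟩ (Fin.cast h (Fin.natAdd (b + 1) s.succ))) =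
          Fin.succ ⟨b + 1 + s, by omega⟩ := by
        ext
        rw [cycleRange_val, if_neg (by simp [Fin.lt_def]; omega),
          if_neg (by simp [Fin.ext_iff])]
        simp
        omega
      rw [this]; rfl
  have e2 : (fun s : Fin (b + 1) => (Fin.cons w v : Fin (r + 1) → M)
      (Fin.cycleRange ⟨b + 1, hb⟩ (Fin.cast h (Fin.castAdd (n + 1) s)))) =
      fun s : Fin (b + 1) => v ⟨s, by omega⟩ := by
    ext s
    have : (Fin.cycleRange ⟨b + 1, hb⟩ (Fin.cast h (Fin.castAdd (n + 1) s))) =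
        Fin.succ ⟨s, by omega⟩ := by
      ext
      rw [cycleRange_val]
      simp [Fin.lt_def]
      omega
    rw [this]; rfl
  -- The cycle contributes `(-1)^(b+1)`; the exchange of arguments in `spr_ins_cons` removes one
  -- sign.
  rw [altTerm, nest, e1, e2, map_smul, spr_ins_cons h hb h', sgn_cycleRange, smul_neg, pow_succ]
  simp

/-- Inserting into the first argument of `f ∘ g` requires knowing where that argument went. `Z`
stands for the sum over its possible positions, with the permutations of the other arguments kept
outside. -/
theorem ins_circ {a b c : ℕ} (f : Cochain k H M N (a + 1)) (g : Cochain k H M M (b + 1))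
    (Z : (Fin (a + b) → M) → PT k H M c → PT k H N (c + (a + b)))
    (hZ₀ : ∀ v, Z v 0 = 0) (hZ₁ : ∀ v F F', Z v (F + F') = Z v F + Z v F')
    (hZ : ∀ v x w, PT.spr (block₁ c (a + b)) (place _ (Fin.castAdd_injective c (a + b)) x)
      (∑ t : Fin (a + b + 1), altTerm (add_one_add_eq a b) (nest f g) (Fin.cons w v) t.cycleRange) =
      Z v (PT.mk x w)) (v : Fin (a + b) → M) (F : PT k H M c) :
    ins (circ f g) v F = wt k (b + 1) a • ∑ τ : Equiv.Perm (Fin (a + b)), sgn k τ •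
      PT.rx (blockEquiv (Equiv.refl _) τ) (Z (fun s => v (τ s)) F) := by
  induction F using PT.induction with
  | zero => simp [hZ₀]
  | mk x w =>
    rw [ins_mk, circ_apply, alt_cons, map_smul, map_sum]
    congr 1
    refine Finset.sum_congr rfl fun τ _ => ?_
    rw [map_smul, spr_shift, hZ]
  | add s t hs ht =>
    simp only [map_add, hs, ht, hZ₁, smul_add, Finset.sum_add_distrib]

/-- The inner alternation over the `a + b` other arguments is absorbed by the outer one, at the cost
of the factor `(a + b)!`. -/
theorem circ_circ_of {a b c : ℕ} (f : Cochain k H M N (a + 1)) (g : Cochain k H M M (b + 1))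
    (q : Cochain k H M M (c + 1))
    (Z : (Fin (a + b) → M) → PT k H M (c + 1) → PT k H N (c + 1 + (a + b)))
    (hZ₀ : ∀ v, Z v 0 = 0) (hZ₁ : ∀ v F F', Z v (F + F') = Z v F + Z v F')
    (hZ : ∀ v x w, PT.spr (block₁ (c + 1) (a + b))
      (place _ (Fin.castAdd_injective (c + 1) (a + b)) x)
      (∑ t : Fin (a + b + 1), altTerm (add_one_add_eq a b) (nest f g) (Fin.cons w v) t.cycleRange) =
      Z v (PT.mk x w)) (u : Fin (a + b + c + 1) → M) :
    circ (circ f g) q u = (wt k (c + 1) (a + b) * wt k (b + 1) a * ((a + b).factorial : k)) •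
      alt (add_one_add_eq (a + b) c) (fun y => Z (fun s => y (Fin.natAdd (c + 1) s))
        (q fun s => y (Fin.castAdd (a + b) s))) u := by
  rw [circ_apply]
  have e : nest (circ f g) q = fun y => wt k (b + 1) a • ∑ τ : Equiv.Perm (Fin (a + b)), sgn k (blockEquiv (1 : Equiv.Perm (Fin (c + 1))) τ) •
      PT.rx (blockEquiv (1 : Equiv.Perm (Fin (c + 1))) τ)
        ((fun y => Z (fun s => y (Fin.natAdd (c + 1) s))
        (q fun s => y (Fin.castAdd (a + b) s))) fun s => y (blockEquiv 1 τ s)) := by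
    funext y
    rw [nest, ins_circ f g Z hZ₀ hZ₁ hZ]
    simp only [blockEquiv_castAdd, blockEquiv_natAdd, sgn_blockEquiv, sgn_one, one_mul]
    rfl
  rw [e, alt_smul, alt_average _ (fun y => Z (fun s => y (Fin.natAdd (c + 1) s))
    (q fun s => y (Fin.castAdd (a + b) s))) fun τ : Equiv.Perm (Fin (a + b)) => blockEquiv 1 τ,
    smul_smul, smul_smul, Fintype.card_perm, Fintype.card_fin]

/-- The multiplicity `b + 1` counts the positions inside `g`. The result is the constant that
`circ_right` produces, so that nested terms cancel in the associator. -/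
theorem wt_inner [CharZero k] (a b c : ℕ) : wt k (c + 1) (a + b) * wt k (b + 1) a * ((a + b).factorial : k) *
    ((b + 1 : ℕ) : k) = ((a.factorial * b.factorial * (c + 1).factorial : ℕ) : k)⁻¹ := by
  have h1 : ((a + b).factorial : k) ≠ 0 := by exact_mod_cast Nat.factorial_ne_zero _
  have h2 : ((b + 1 : ℕ) : k) ≠ 0 := by exact_mod_cast Nat.succ_ne_zero b
  rw [wt, wt, Nat.factorial_succ b]
  push_cast at h2 ⊢
  field_simp

theorem wt_outer [CharZero k] (n b c : ℕ) : wt k (c + 1) (n + 1 + b) * wt k (b + 1) (n + 1) *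
    ((n + 1 + b).factorial : k) * ((n + 1 : ℕ) : k) =
      ((n.factorial * (b + 1).factorial * (c + 1).factorial : ℕ) : k)⁻¹ := by
  have h1 : ((n + 1 + b).factorial : k) ≠ 0 := by exact_mod_cast Nat.factorial_ne_zero _
  have h2 : ((n + 1 : ℕ) : k) ≠ 0 := by exact_mod_cast Nat.succ_ne_zero n
  rw [wt, wt, Nat.factorial_succ n]
  push_cast at h2 ⊢
  field_simp

theorem alt_inner {a b c r : ℕ} (h : c + 1 + (a + b) = r) (h' : c + 1 + b + a = c + 1 + (a + b))
    (f : Cochain k H M N (a + 1)) (g : Cochain k H M M (b + 1)) (q : Cochain k H M M (c + 1))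
    (u : Fin r → M) :
    alt h (fun y => PT.rx (finCongr h')
      (ins f (fun s : Fin a => y (Fin.natAdd (c + 1) ⟨b + s, by omega⟩))
        (ins g (fun s : Fin b => y (Fin.natAdd (c + 1) ⟨s, by omega⟩))
          (q fun s => y (Fin.castAdd (a + b) s))))) u = alt (h'.trans h) (nest₃ f g q) u := by
  rw [← alt_cast h h']
  congr 1
  funext y
  rw [nest₃, nest]
  congr 3
  funext s
  congr 1
  ext
  simp [add_assoc]

theorem alt_outer {n b c r : ℕ} (h : c + 1 + (n + 1 + b) = r)
    (h' : c + 1 + (b + 1) + n = c + 1 + (n + 1 + b))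
    (f : Cochain k H M N (n + 2)) (g : Cochain k H M M (b + 1)) (q : Cochain k H M M (c + 1))
    (u : Fin r → M) :
    alt h (fun y => PT.rx (finCongr h')
      (ins₂ f (fun s : Fin n => y (Fin.natAdd (c + 1) ⟨b + 1 + s, by omega⟩))
        (q fun s => y (Fin.castAdd (n + 1 + b) s))
        (g fun s : Fin (b + 1) => y (Fin.natAdd (c + 1) ⟨s, by omega⟩)))) u =
      alt (h'.trans h) (fork f q g) u := by
  rw [← alt_cast h h']
  congr 1
  funext y
  rw [fork]
  congr 3
  funext s
  congr 1
  ext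
  simp [add_assoc]

/-- A cochain with one argument has no room for two insertions, so there is no forked term. -/
theorem circ_circ_zero [CharZero k] {b c : ℕ} (f : Cochain k H M N 1) (g : Cochain k H M M (b + 1))
    (q : Cochain k H M M (c + 1)) (u : Fin (0 + b + c + 1) → M) :
    circ (a := 0 + b) (circ (a := 0) f g) q u =
      (((0).factorial * b.factorial * (c + 1).factorial : ℕ) : k)⁻¹ •
        alt (by omega) (nest₃ (a := 0) f g q) u := by
  rw [circ_circ_of (a := 0) f g q (fun v F => ((b + 1 : ℕ) : k) • PT.rx (finCongr (by omega))
      (ins (n := 0) f (fun s : Fin 0 => v ⟨b + s, by omega⟩)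
        (ins g (fun s : Fin b => v ⟨s, by omega⟩) F)))
    (fun v => by simp) (fun v F F' => by simp only [map_add, smul_add])
    (fun v x w => by
      rw [sum_cycleRange_altTerm (a := 0) _ f g _ (A := 0) fun ha => absurd ha (lt_irrefl 0),
        smul_zero, add_zero, map_smul, spr_nest _ (by omega)]), alt_smul, smul_smul, wt_inner,
    alt_inner]

/-- The inserted `q` lands either inside `g`, giving the nested term, or in another argument of `f`,
giving the forked term. The coefficients come from counting positions and the sign from moving `q`
in front of `g`. -/
theorem circ_circ_succ [CharZero k] {n b c : ℕ} (f : Cochain k H M N (n + 2)) (g : Cochain k H M M (b + 1))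
    (q : Cochain k H M M (c + 1)) (u : Fin (n + 1 + b + c + 1) → M) :
    circ (a := n + 1 + b) (circ (a := n + 1) f g) q u =
      (((n + 1).factorial * b.factorial * (c + 1).factorial : ℕ) : k)⁻¹ •
        alt (by omega) (nest₃ (a := n + 1) f g q) u +
      ((-1) ^ b * ((n.factorial * (b + 1).factorial * (c + 1).factorial : ℕ) : k)⁻¹) •
        alt (by omega) (fork f q g) u := by
  rw [circ_circ_of (a := n + 1) f g q (fun v F =>
      ((b + 1 : ℕ) : k) • PT.rx (finCongr (by omega))
        (ins f (fun s : Fin (n + 1) => v ⟨b + s, by omega⟩)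
          (ins g (fun s : Fin b => v ⟨s, by omega⟩) F)) +
      ((n + 1 : ℕ) : k) • (-1 : k) ^ b • PT.rx (finCongr (by omega))
        (ins₂ f (fun s : Fin n => v ⟨b + 1 + s, by omega⟩) F
          (g fun s : Fin (b + 1) => v ⟨s, by omega⟩)))
    (fun v => by simp [ins₂_zero_left])
    (fun v F F' => by simp only [map_add, smul_add, ins₂_add_left]; abel)
    (fun v x w => by
      rw [sum_cycleRange_altTerm (a := n + 1) _ f g _ (A := altTerm (add_one_add_eq (n + 1) b)
        (nest f g) (Fin.cons w v) (Fin.cycleRange ⟨b + 1, by omega⟩)) fun _ => rfl,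
        map_add, map_smul, map_smul, spr_nest _ (by omega), spr_altTerm_nest _ (by omega)]),
    alt_add, alt_smul, alt_smul, alt_smul, smul_add, smul_smul, smul_smul, smul_smul, wt_inner,
    alt_inner, alt_outer, ← wt_outer]
  congr 2
  ring

/-- Here `q` is already inside `g`, and the alternation defining `g ∘ q` is absorbed by the outer
one. -/
theorem circ_right [CharZero k] {a b c : ℕ} (f : Cochain k H M N (a + 1)) (g : Cochain k H M M (b + 1))
    (q : Cochain k H M M (c + 1)) (u : Fin (a + (b + c) + 1) → M) :
    circ f (circ g q) u = ((a.factorial * b.factorial * (c + 1).factorial : ℕ) : k)⁻¹ •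
        alt (by omega) (nest₃ f g q) u := by
  have h : c + 1 + b + a = b + c + 1 + a := by omega
  have e : nest f (circ g q) = fun y => wt k (c + 1) b • ∑ τ : Equiv.Perm (Fin (b + c + 1)),
      sgn k (blockEquiv τ (1 : Equiv.Perm (Fin a))) •
      PT.rx (blockEquiv τ (1 : Equiv.Perm (Fin a)))
        ((fun y => PT.rx (finCongr h) (nest₃ f g q fun s => y (Fin.cast h s)))
          fun s => y (blockEquiv τ 1 s)) := by
    funext y
    rw [nest, circ_apply, map_smul, alt, map_sum]
    congr 1
    refine Finset.sum_congr rfl fun τ _ => ?_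
    rw [altTerm, map_smul, ins_rx, sgn_blockEquiv, sgn_one, mul_one, PT.rx_rx]
    congr 1
    have e1 : (finCongr h).trans (blockEquiv τ (1 : Equiv.Perm (Fin a))) =
        blockEquiv ((finCongr (add_one_add_eq b c)).trans τ) (Equiv.refl _) := by
      rw [← blockEquiv_finCongr (add_one_add_eq b c)]
      ext i : 1
      refine Fin.addCases (fun s => ?_) (fun s => ?_) i <;> simp
    have e2 : ∀ i, Fin.cast h (Fin.castAdd a i) = Fin.castAdd a (Fin.cast (add_one_add_eq b c) i) :=
      fun i => rfl
    have e3 : ∀ i, Fin.cast h (Fin.natAdd (c + 1 + b) i) = Fin.natAdd (b + c + 1) i :=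
      fun i => by ext; simp
    rw [e1, nest₃]
    simp only [e2, e3, blockEquiv_castAdd, blockEquiv_natAdd]
    rfl
  rw [circ_apply, e, alt_smul, alt_average _ (fun y => PT.rx (finCongr h) (nest₃ f g q fun s => y (Fin.cast h s)))
      fun τ : Equiv.Perm (Fin (b + c + 1)) => blockEquiv τ (1 : Equiv.Perm (Fin a)), alt_cast, smul_smul, smul_smul, Fintype.card_perm,
    Fintype.card_fin]
  congr 1
  have h1 : ((b + c + 1).factorial : k) ≠ 0 := by exact_mod_cast Nat.factorial_ne_zero _
  rw [wt, wt]
  push_cast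
  field_simp

end PreLie

/-! ### Graded pre-Lie algebras and their commutators -/

section Abstract

/-- A graded (right-symmetric) pre-Lie product. -/
structure IsGradedPreLie {k A : Type*} [Field k] [AddCommGroup A] [Module k A]
    (m : A →ₗ[k] A →ₗ[k] A) (D : ℕ → Submodule k A) : Prop where
  mul_mem : ∀ {a b x y}, x ∈ D a → y ∈ D b → m x y ∈ D (a + b)
  preLie : ∀ {a b c x y z}, x ∈ D a → y ∈ D b → z ∈ D c →
    m (m x y) z - m x (m y z) = (-1 : k) ^ (b * c) • (m (m x z) y - m x (m z y))

variable {k A : Type*} [Field k] [AddCommGroup A] [Module k A]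
variable (m : A →ₗ[k] A →ₗ[k] A) {D : ℕ → Submodule k A}

/-- The graded commutator of elements of degrees `a` and `b`. -/
def lie (a b : ℕ) (x y : A) : A := m x y - (-1 : k) ^ (a * b) • m y x

variable {m}

theorem neg_one_pow_mul_self (a : ℕ) : (-1 : k) ^ a * (-1) ^ a = 1 := by
  rw [← mul_pow]; simp

theorem lie_mem (hm : IsGradedPreLie m D) {a b : ℕ} {x y : A} (hx : x ∈ D a) (hy : y ∈ D b) :
    lie m a b x y ∈ D (a + b) := by
  refine Submodule.sub_mem _ (hm.mul_mem hx hy) (Submodule.smul_mem _ _ ?_)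
  rw [add_comm]
  exact hm.mul_mem hy hx

theorem lie_skew (a b : ℕ) (x y : A) : lie m a b x y = -((-1 : k) ^ (a * b) • lie m b a y x) := by
  rw [lie, lie, smul_sub, smul_smul, mul_comm b a, neg_one_pow_mul_self, one_smul]
  abel

theorem lie_smul_left (a b : ℕ) (c : k) (x y : A) : lie m a b (c • x) y = c • lie m a b x y := by
  simp only [lie, map_smul, LinearMap.smul_apply, smul_sub]
  rw [smul_comm]

theorem lie_smul_right (a b : ℕ) (c : k) (x y : A) : lie m a b x (c • y) = c • lie m a b x y := by
  simp only [lie, map_smul, LinearMap.smul_apply, smul_sub]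
  rw [smul_comm]

theorem lie_add_left (a b : ℕ) (x x' y : A) :
    lie m a b (x + x') y = lie m a b x y + lie m a b x' y := by
  simp only [lie, map_add, LinearMap.add_apply, smul_add]
  abel

theorem lie_add_right (a b : ℕ) (x y y' : A) :
    lie m a b x (y + y') = lie m a b x y + lie m a b x y' := by
  simp only [lie, map_add, LinearMap.add_apply, smul_add]
  abel

theorem lie_zero_left (a b : ℕ) (y : A) : lie m a b 0 y = 0 := by simp [lie]

theorem lie_zero_right (a b : ℕ) (y : A) : lie m a b y 0 = 0 := by simp [lie]

/-- Expanding the commutators leaves associators only. The pre-Lie identity with each of the three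
elements in first place makes them cancel. -/
theorem lie_jacobi (hm : IsGradedPreLie m D) {a b c : ℕ} {x y z : A} (hx : x ∈ D a) (hy : y ∈ D b)
    (hz : z ∈ D c) : lie m a (b + c) x (lie m b c y z) =
      lie m (a + b) c (lie m a b x y) z + (-1 : k) ^ (a * b) • lie m b (a + c) y (lie m a c x z) := by
  have h1 := hm.preLie hx hy hz
  have h2 := hm.preLie hy hx hz
  have h3 := hm.preLie hz hx hy
  simp only [lie, map_sub, map_smul, LinearMap.sub_apply, LinearMap.smul_apply, mul_add, add_mul,
    pow_add, mul_comm b a, mul_comm c a, mul_comm c b] at *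
  -- All signs are monomials in these three powers of -1, so eight sign cases remain, each a linear
  -- combination of the three identities.
  rcases neg_one_pow_eq_or k (a * b) with e1 | e1 <;>
  rcases neg_one_pow_eq_or k (a * c) with e2 | e2 <;>
  rcases neg_one_pow_eq_or k (b * c) with e3 | e3 <;>
  simp only [e1, e2, e3] at * <;>
  first
  | linear_combination (norm := module) -h1 + h2 - h3
  | linear_combination (norm := module) -h1 + h2 + h3
  | linear_combination (norm := module) -h1 - h2 - h3
  | linear_combination (norm := module) -h1 - h2 + h3

end Abstract

/-! ### Derived brackets and twisting -/

section Derived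

variable {k A : Type*} [Field k] [AddCommGroup A] [Module k A]
variable {m : A →ₗ[k] A →ₗ[k] A} {D : ℕ → Submodule k A}

/-- A square-zero element of degree one acts as a differential. -/
theorem lie_lie_self [CharZero k] (hm : IsGradedPreLie m D) {X x : A} {a : ℕ} (hX : X ∈ D 1)
    (h : lie m 1 1 X X = 0) (hx : x ∈ D a) : lie m 1 (1 + a) X (lie m 1 a X x) = 0 := by
  have h1 := lie_jacobi hm hX hX hx
  rw [h, lie_zero_left, zero_add, mul_one, pow_one] at h1
  -- Jacobi for the odd element X gives [X, [X, x]] = -[X, [X, x]].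
  have h2 : (2 : k) • lie m 1 (1 + a) X (lie m 1 a X x) = 0 := by
    linear_combination (norm := module) h1
  exact (smul_eq_zero.mp h2).resolve_left two_ne_zero

theorem lie_lie_comm (hm : IsGradedPreLie m D) {X Y x : A} {a : ℕ} (hX : X ∈ D 1) (hY : Y ∈ D 1)
    (h : lie m 1 1 X Y = 0) (hx : x ∈ D a) :
    lie m 1 (1 + a) X (lie m 1 a Y x) = -lie m 1 (1 + a) Y (lie m 1 a X x) := by
  have h1 := lie_jacobi hm hX hY hx
  rw [h, lie_zero_left, zero_add, mul_one, pow_one] at h1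
  rw [h1, neg_smul, one_smul]

/-- The derived bracket of elements of degrees `a` and `b`. -/
def derived (m : A →ₗ[k] A →ₗ[k] A) (X : A) (a b : ℕ) (x y : A) : A :=
  (-1 : k) ^ a • lie m (1 + a) b (lie m 1 a X x) y

/-- Of the four terms of the double commutator, `y (x X)` vanishes by hypothesis, and the pre-Lie
identity turns `(x X) y` into `x (X y)`, as the associator of `x, y, X` is zero. The three survivors
are the three sums of the bracket formula. -/
theorem derived_eq (hm : IsGradedPreLie m D) {X x y : A} {a b : ℕ} (hX : X ∈ D 1) (hx : x ∈ D a)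
    (hy : y ∈ D b) (hxy : m x y = 0) (hxX : m x (m y X) = 0) (hyX : m y (m x X) = 0) :
    derived m X a b x y = -m x (m X y) + (-1 : k) ^ ((a + 1) * (b + 1)) • m y (m X x) +
      (-1 : k) ^ a • m (m X x) y := by
  have h := hm.preLie hx hX hy
  rw [hxy, hxX, map_zero, LinearMap.zero_apply, sub_zero, smul_zero, sub_eq_zero] at h
  simp only [derived, lie, map_sub, map_smul, LinearMap.sub_apply, LinearMap.smul_apply, h, hyX,
    smul_zero, sub_zero]
  simp only [mul_add, add_mul, pow_add, one_mul, mul_one, pow_one]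
  rcases neg_one_pow_eq_or k (a * b) with e1 | e1 <;>
  rcases neg_one_pow_eq_or k a with e2 | e2 <;>
  rcases neg_one_pow_eq_or k b with e3 | e3 <;>
  simp only [e1, e2, e3] at * <;> module

/-- Apply [X, ·] to [x, y] = 0. A derived bracket is skew only on commuting elements. -/
theorem derived_skew (hm : IsGradedPreLie m D) {X x y : A} {a b : ℕ} (hX : X ∈ D 1) (hx : x ∈ D a)
    (hy : y ∈ D b) (hxy : lie m a b x y = 0) :
    derived m X a b x y = -((-1 : k) ^ ((a + 1) * (b + 1)) • derived m X b a y x) := by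
  have h1 := lie_jacobi hm hX hx hy
  rw [hxy, lie_zero_right, lie_skew a (1 + b)] at h1
  rw [derived, derived]
  simp only [mul_add, add_mul, pow_add, one_mul, mul_one, pow_one] at *
  rcases neg_one_pow_eq_or k (a * b) with e1 | e1 <;>
  rcases neg_one_pow_eq_or k a with e2 | e2 <;>
  rcases neg_one_pow_eq_or k b with e3 | e3 <;>
  simp only [e1, e2, e3] at * <;>
  first
  | linear_combination (norm := module) h1
  | linear_combination (norm := module) -h1

/-- Since [Y, X] = 0, the operators [Y, ·] and [X, ·] anticommute; the rest is the derivation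
property of [Y, ·]. -/
theorem derived_leibniz (hm : IsGradedPreLie m D) {X Y x y : A} {a b : ℕ} (hY : Y ∈ D 1)
    (hX : X ∈ D 1) (hYX : lie m 1 1 Y X = 0) (hx : x ∈ D a) (hy : y ∈ D b) :
    lie m 1 (1 + a + b) Y (derived m X a b x y) =
      derived m X (1 + a) b (lie m 1 a Y x) y +
        (-1 : k) ^ (a + 1) • derived m X a (1 + b) x (lie m 1 b Y y) := by
  have h1 := lie_jacobi hm hY (lie_mem hm hX hx) hy
  rw [lie_lie_comm hm hY hX hYX hx, ← neg_one_smul k, lie_smul_left] at h1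
  rw [derived, derived, derived, lie_smul_right, h1]
  simp only [pow_add, pow_one, one_mul]
  rcases neg_one_pow_eq_or k a with e2 | e2 <;>
  simp only [e2] at * <;> module

/-- This is Jacobi for [X, x], [X, y] and z, rewritten with [X, [[X, x], y]] = ±[[X, x], [X, y]],
which holds because [X, [X, x]] = 0. -/
theorem derived_jacobi [CharZero k] (hm : IsGradedPreLie m D) {X x y z : A} {a b c : ℕ}
    (hX : X ∈ D 1) (hXX : lie m 1 1 X X = 0) (hx : x ∈ D a) (hy : y ∈ D b) (hz : z ∈ D c) :
    derived m X a (1 + b + c) x (derived m X b c y z) =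
      derived m X (1 + a + b) c (derived m X a b x y) z +
        (-1 : k) ^ ((a + 1) * (b + 1)) •
          derived m X b (1 + a + c) y (derived m X a c x z) := by
  have h1 := lie_jacobi hm (lie_mem hm hX hx) (lie_mem hm hX hy) hz
  have h2 := lie_jacobi hm hX (lie_mem hm hX hx) hy
  rw [lie_lie_self hm hX hXX hx, lie_zero_left, zero_add] at h2
  simp only [derived, lie_smul_right, lie_smul_left]
  rw [h1, h2, lie_smul_left, show 1 + (1 + a + b) = 1 + a + (1 + b) by ring]
  clear h1 h2
  simp only [mul_add, add_mul, pow_add, one_mul, mul_one, pow_one] at *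
  rcases neg_one_pow_eq_or k (a * b) with e1 | e1 <;>
  rcases neg_one_pow_eq_or k a with e2 | e2 <;>
  rcases neg_one_pow_eq_or k b with e3 | e3 <;>
  simp only [e1, e2, e3] at * <;> module

/-- A graded space embedded compatibly into a graded pre-Lie algebra, with the differential
`[Y, ·]` and a derived bracket, is a differential graded Lie algebra. -/
theorem isDGLieAlgebra_of_derived [CharZero k] (hm : IsGradedPreLie m D) {X Y : A} (hX : X ∈ D 1)
    (hY : Y ∈ D 1) (hXX : lie m 1 1 X X = 0) (hYY : lie m 1 1 Y Y = 0) (hYX : lie m 1 1 Y X = 0)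
    {V : ℕ → Type*} [∀ n, AddCommGroup (V n)] [∀ n, Module k (V n)] (φ : ∀ n, V n →ₗ[k] A)
    (hφ : ∀ n x, φ n x ∈ D n) (hinj : Function.Injective (DirectSum.toModule k ℕ A φ))
    (hS : ∀ p q x y, m (φ p x) (φ q y) = 0)
    (d : ∀ p, V p →ₗ[k] V (p + 1)) (br : ∀ p q, V p →ₗ[k] V q →ₗ[k] V (p + q + 1))
    (hd : ∀ p x, φ _ (d p x) = lie m 1 p Y (φ p x))
    (hbr : ∀ p q x y, φ _ (br p q x y) = derived m X p q (φ p x) (φ q y)) :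
    IsDGLieAlgebra d br where
  d_d p x := by
    apply (DirectSum.of_injective (β := V) (p + 1 + 1))
    apply hinj
    have h := lie_lie_self hm hY hYY (hφ p x)
    rw [map_zero, map_zero, ← DirectSum.lof_eq_of k, DirectSum.toModule_lof, hd, hd, add_comm p 1, h]
  skew p q x y := by
    apply hinj
    simp only [map_neg, map_smul]
    simp only [← DirectSum.lof_eq_of k, DirectSum.toModule_lof, hbr]
    exact derived_skew hm hX (hφ p x) (hφ q y) (by rw [lie, hS, hS, smul_zero, sub_zero])
  leibniz p q x y := by
    apply hinj
    simp only [map_add, map_smul]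
    simp only [← DirectSum.lof_eq_of k, DirectSum.toModule_lof, hbr, hd]
    have h := derived_leibniz hm hY hX hYX (hφ p x) (hφ q y)
    rw [add_comm 1 p, add_comm 1 q, add_right_comm] at h
    exact h
  jacobi p q r x y z := by
    apply hinj
    simp only [map_add, map_smul]
    simp only [← DirectSum.lof_eq_of k, DirectSum.toModule_lof, hbr]
    have h := derived_jacobi hm hX hXX (hφ p x) (hφ q y) (hφ r z)
    rw [show 1 + q + r = q + r + 1 by ring, show 1 + p + q = p + q + 1 by ring,
      show 1 + p + r = p + r + 1 by ring] at h
    exact h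

/-- Twisting the differential by a Maurer–Cartan element. -/
theorem lie_twist [CharZero k] (hm : IsGradedPreLie m D) {X Y x : A} (hX : X ∈ D 1)
    (hY : Y ∈ D 1) (hXX : lie m 1 1 X X = 0) (hYY : lie m 1 1 Y Y = 0) (hYX : lie m 1 1 Y X = 0)
    (hx : x ∈ D 0) (h : lie m 1 0 Y x + (1 / 2 : k) • derived m X 0 0 x x = 0) :
    lie m 1 1 (Y + lie m 1 0 X x) (Y + lie m 1 0 X x) = 0 ∧ lie m 1 1 (Y + lie m 1 0 X x) X = 0 := by
  have hXx := lie_lie_self hm hX hXX hx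
  have hYx := lie_lie_comm hm hY hX hYX hx
  have hx1 : lie m 1 0 X x ∈ D 1 := lie_mem hm hX hx
  have h1 := lie_jacobi hm hX hx1 hx
  rw [add_zero] at hXx hYx
  rw [hXx, lie_zero_left, zero_add, mul_one, pow_one] at h1
  have hs : ∀ u v : A, lie m 1 1 u v = lie m 1 1 v u := fun u v => by
    rw [lie_skew]; simp
  have h3 := congrArg (lie m 1 1 X) h
  rw [lie_add_right, lie_smul_right, derived, pow_zero, one_smul, lie_zero_right] at h3
  simp only [add_zero] at h1
  rw [h1] at h3
  constructor
  · rw [lie_add_left, lie_add_right, lie_add_right, hYY, hs (lie m 1 0 X x) Y, hYx]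
    -- With Z = [X, x], the square of Y + Z is 2[Y, Z] + [Z, Z]. Here [Y, Z] = -[X, [Y, x]] and [Z,
    -- Z] = -[X, [Z, x]], so it is -2 times [X, ·] of the Maurer–Cartan equation.
    linear_combination (norm := skip) (-2 : k) • h3
    module
  · rw [lie_add_left, hYX, hs, hXx, zero_add]

end Derived

/-! ### The pre-Lie algebra of all cochains -/

section Total

variable {k H : Type*} [Field k] [Ring H] [Bialgebra k H] [Coalgebra.IsCocomm k H]
variable {M N : Type*} [AddCommGroup M] [Module k M] [Module H M]
variable [AddCommGroup N] [Module k N] [Module H N]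

/-- Transport of cochains along an equality of degrees. -/
def castC {a b : ℕ} (h : a = b) (X : Cochain k H M N (a + 1)) : Cochain k H M N (b + 1) := h ▸ X

theorem of_castC {a b : ℕ} (h : a = b) (X : Cochain k H M N (a + 1)) :
    DirectSum.of (fun n => Cochain k H M N (n + 1)) b (castC h X) =
      DirectSum.of (fun n => Cochain k H M N (n + 1)) a X := by
  subst h; rfl

theorem castC_apply {a b : ℕ} (h : a = b) (X : Cochain k H M N (a + 1)) (u : Fin (b + 1) → M) :
    castC h X u = PT.rx (finCongr (by omega)) (X fun s => u (Fin.cast (by omega) s)) := by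
  subst h
  exact (PT.rx_refl _).symm

theorem rx_cast_alt {X : Type*} {l m n : ℕ} (h : m = n) (h' : l = m)
    (E : (Fin l → X) → PT k H N l) (u : Fin n → X) :
    PT.rx (finCongr h) (alt h' E fun s => u (Fin.cast h s)) = alt (h'.trans h) E u := by
  subst h
  exact PT.rx_refl _

variable (k H M) in
/-- The graded space `⨁ C^{n+1}(M, M)`. -/
abbrev TotalSpace : Type _ := DirectSum ℕ fun n => Cochain k H M M (n + 1)

/-- The Nijenhuis–Richardson product on `⨁ C^{n+1}(M, M)`. -/
def circTotal : TotalSpace k H M →ₗ[k] TotalSpace k H M →ₗ[k] TotalSpace k H M :=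
  DirectSum.toModule k ℕ _ fun a => LinearMap.flip <| DirectSum.toModule k ℕ _ fun b =>
    (circ.compr₂ (DirectSum.lof k ℕ (fun n => Cochain k H M M (n + 1)) (a + b))).flip

theorem circTotal_of {a b : ℕ} (f : Cochain k H M M (a + 1)) (g : Cochain k H M M (b + 1)) :
    circTotal (DirectSum.of (fun n => Cochain k H M M (n + 1)) a f)
      (DirectSum.of (fun n => Cochain k H M M (n + 1)) b g) =
      DirectSum.of (fun n => Cochain k H M M (n + 1)) (a + b) (circ f g) := by
  rw [circTotal, ← DirectSum.lof_eq_of k, ← DirectSum.lof_eq_of k, ← DirectSum.lof_eq_of k,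
    DirectSum.toModule_lof, LinearMap.flip_apply, DirectSum.toModule_lof]
  rfl

variable (k H M) in
/-- The component of degree `n` of `⨁ C^{n+1}(M, M)`. -/
def gradedPiece (n : ℕ) : Submodule k (TotalSpace k H M) :=
  LinearMap.range (DirectSum.lof k ℕ (fun n => Cochain k H M M (n + 1)) n)

theorem of_mem_gradedPiece {n : ℕ} (f : Cochain k H M M (n + 1)) :
    DirectSum.of (fun n => Cochain k H M M (n + 1)) n f ∈ gradedPiece k H M n :=
  ⟨f, DirectSum.lof_eq_of k ℕ _ _ _⟩

/-- The nested terms on either side cancel, leaving forked terms that `alt_fork_swap` matches. If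
`f` has a single argument both associators vanish. -/
theorem circ_assoc_symm [CharZero k] {a b c : ℕ} (f : Cochain k H M M (a + 1))
    (g : Cochain k H M M (b + 1)) (q : Cochain k H M M (c + 1)) :
    circ (circ f g) q - castC (by ring) (circ f (circ g q)) =
      (-1 : k) ^ (b * c) • (castC (by ring) (circ (circ f q) g) -
        castC (by ring) (circ f (circ q g))) := by
  refine cochain_ext fun u => ?_
  change circ (circ f g) q u - castC _ _ u = (-1 : k) ^ (b * c) • (castC _ _ u - castC _ _ u)
  rw [castC_apply, castC_apply, castC_apply, circ_right, circ_right]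
  cases a with
  | zero =>
    rw [circ_circ_zero, circ_circ_zero]
    simp only [map_smul, rx_cast_alt, sub_self, smul_zero]
  | succ n =>
    rw [circ_circ_succ, circ_circ_succ]
    simp only [map_add, map_smul, rx_cast_alt, add_sub_cancel_left]
    rw [alt_fork_swap _ (by omega), smul_neg, smul_smul, ← neg_smul, smul_smul]
    congr 1
    rw [show n.factorial * (b + 1).factorial * (c + 1).factorial =
      n.factorial * (c + 1).factorial * (b + 1).factorial by ring]
    simp only [mul_add, add_mul, pow_add, one_mul, mul_one, pow_one]
    rcases neg_one_pow_eq_or k (b * c) with e1 | e1 <;>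
    rcases neg_one_pow_eq_or k b with e2 | e2 <;>
    rcases neg_one_pow_eq_or k c with e3 | e3 <;>
    simp only [e1, e2, e3] <;> ring

theorem circTotal_isGradedPreLie [CharZero k] :
    IsGradedPreLie (k := k) (A := TotalSpace k H M) circTotal (gradedPiece k H M) where
  mul_mem := by
    rintro a b _ _ ⟨f, rfl⟩ ⟨g, rfl⟩
    rw [DirectSum.lof_eq_of, DirectSum.lof_eq_of, circTotal_of]
    exact of_mem_gradedPiece _
  preLie := by
    rintro a b c _ _ _ ⟨f, rfl⟩ ⟨g, rfl⟩ ⟨q, rfl⟩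
    simp only [DirectSum.lof_eq_of, circTotal_of]
    have h := congrArg (DirectSum.lof k ℕ (fun n => Cochain k H M M (n + 1)) (a + b + c))
      (circ_assoc_symm f g q)
    simpa only [map_sub, map_smul, DirectSum.lof_eq_of, of_castC] using h

end Total

/-! ### Compositions of pseudoproducts, and skew pseudoproducts as 2-cochains -/

section Comp

variable {k H : Type*} [Field k] [Ring H] [Bialgebra k H] [Coalgebra.IsCocomm k H]
variable {M N P : Type*} [AddCommGroup M] [Module k M] [Module H M]
variable [AddCommGroup N] [Module k N] [Module H N]
variable [AddCommGroup P] [Module k P] [Module H P]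

namespace Pseudoproduct

/-- `Pseudoproduct.comp` as a bilinear map. -/
def compL (B : Pseudoproduct k H M N P) {m n : ℕ} :
    PT k H M m →ₗ[k] PT k H N n →ₗ[k] PT k H P (m + n) :=
  LinearMap.mk₂ k (fun F G => B.comp F G)
    (fun F F' G => by simp only [comp, map_add, LinearMap.add_apply])
    (fun c F G => by simp only [comp, map_smul, LinearMap.smul_apply])
    (fun F G G' => by simp only [comp, map_add])
    (fun c F G => by simp only [comp, map_smul])

theorem comp_eq (B : Pseudoproduct k H M N P) {m n : ℕ} (F : PT k H M m) (G : PT k H N n) :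
    B.comp F G = B.compL F G := rfl

theorem compL_mk (B : Pseudoproduct k H M N P) {m n : ℕ} (x : HT k H m) (v : M)
    (y : HT k H n) (w : N) :
    B.compL (PT.mk x v) (PT.mk y w) = PT.spr (block₂ m n)
      (place (Fin.castAdd n) (Fin.castAdd_injective m n) x *
        place (Fin.natAdd m) (Fin.natAdd_injective n m) y) (B v w) := B.comp_mk _ _ _ _

theorem compL_unit (B : Pseudoproduct k H M N P) (v : M) (w : N) :
    B.compL (PT.unit v) (PT.unit w) = B v w := by
  rw [PT.unit, PT.unit, compL_mk, map_one, map_one, one_mul]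
  convert PT.spr_id (B v w) using 2
  congr 1
  ext i : 1
  fin_cases i <;> rfl

theorem compL_rx (B : Pseudoproduct k H M N P) {m n m' n' : ℕ} (e : Fin m ≃ Fin m')
    (e' : Fin n ≃ Fin n') (F : PT k H M m) (G : PT k H N n) :
    B.compL (PT.rx e F) (PT.rx e' G) = PT.rx (blockEquiv e e') (B.compL F G) := by
  induction F, G using PT.induction₂ with
  | zero_left G => simp only [map_zero, LinearMap.zero_apply]
  | zero_right F => simp only [map_zero]
  | mk x v y w =>
    rw [PT.rx_mk, PT.rx_mk, compL_mk, compL_mk, PT.rx_spr]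
    refine PT.spr_congr ?_ ?_ _
    · ext l : 1
      rw [Function.comp, blockEquiv_symm]
      refine Fin.addCases (fun s => ?_) (fun s => ?_) l
      · rw [blockEquiv_castAdd, block₂_castAdd, block₂_castAdd]
      · rw [blockEquiv_natAdd, block₂_natAdd, block₂_natAdd]
    · rw [map_mul, fibre_symm_place, fibre_symm_place, fibre_symm_eq_place, fibre_symm_eq_place,
        place_place, place_place]
      congr 1
      · refine place_congr ?_ _ _ _
        ext s : 1
        simp
      · refine place_congr ?_ _ _ _
        ext s : 1
        simp
  | add_left F F' G h h' => simp only [map_add, LinearMap.add_apply, h, h']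
  | add_right F G G' h h' => simp only [map_add, h, h']

theorem compL_rx_left (B : Pseudoproduct k H M N P) {m n m' : ℕ} (e : Fin m ≃ Fin m')
    (F : PT k H M m) (G : PT k H N n) :
    B.compL (PT.rx e F) G = PT.rx (blockEquiv e (Equiv.refl _)) (B.compL F G) := by
  rw [← compL_rx, PT.rx_refl]

theorem compL_rx_right (B : Pseudoproduct k H M N P) {m n n' : ℕ}
    (e' : Fin n ≃ Fin n') (F : PT k H M m) (G : PT k H N n) :
    B.compL F (PT.rx e' G) = PT.rx (blockEquiv (Equiv.refl _) e') (B.compL F G) := by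
  rw [← compL_rx, PT.rx_refl]

theorem spr_block₂_swap {m n : ℕ} (x : HT k H m) (y : HT k H n) (t : PT k H P 2) :
    PT.spr (block₂ m n) (place (Fin.castAdd n) (Fin.castAdd_injective m n) x *
        place (Fin.natAdd m) (Fin.natAdd_injective n m) y) (PT.rx (Equiv.swap 0 1) t) =
      PT.rx finAddFlip (PT.spr (block₂ n m) (place (Fin.castAdd m) (Fin.castAdd_injective n m) y *
        place (Fin.natAdd n) (Fin.natAdd_injective m n) x) t) := by
  rw [PT.spr_rx]
  refine (PT.rx_spr_of (fun i => ?_) ?_ _).symm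
  · induction i using Fin.addCases with
    | left i => rw [finAddFlip_apply_castAdd, block₂_castAdd, Function.comp, block₂_natAdd]; rfl
    | right i => rw [finAddFlip_apply_natAdd, block₂_natAdd, Function.comp, block₂_castAdd]; rfl
  · rw [map_mul, fibre_symm_place, fibre_symm_place]
    refine ((place_place_commute _ _ _ _ (fun s t h => ?_) _ _).eq).trans ?_
    · have := congrArg Fin.val h
      simp at this
      omega
    · congr 1
      · refine place_congr ?_ _ _ _
        ext s : 1
        simp
      · refine place_congr ?_ _ _ _
        ext s : 1
        simp

theorem compL_skew {B : Pseudoproduct k H M M P}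
    (hB : ∀ x y, B x y = -PT.rx (Equiv.swap 0 1) (B y x)) {m n : ℕ} (F : PT k H M m)
    (G : PT k H M n) : B.compL F G = -PT.rx finAddFlip (B.compL G F) := by
  induction F, G using PT.induction₂ with
  | zero_left G => simp only [map_zero, LinearMap.zero_apply, neg_zero]
  | zero_right F => simp only [map_zero, LinearMap.zero_apply, neg_zero]
  | mk x v y w => rw [compL_mk, compL_mk, hB, map_neg, spr_block₂_swap]
  | add_left F F' G h h' => simp only [map_add, LinearMap.add_apply, h, h', neg_add]
  | add_right F G G' h h' => simp only [map_add, LinearMap.add_apply, h, h', neg_add]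

theorem compL_mp {M' N' P' : Type*} [AddCommGroup M'] [Module k M'] [Module H M']
    [AddCommGroup N'] [Module k N'] [Module H N'] [AddCommGroup P'] [Module k P'] [Module H P']
    [IsScalarTower k H M] [IsScalarTower k H N] [IsScalarTower k H P] [IsScalarTower k H M']
    [IsScalarTower k H N'] [IsScalarTower k H P']
    {B : Pseudoproduct k H M N P} {C : Pseudoproduct k H M' N' P'} {i : M' →ₗ[H] M}
    {j : N' →ₗ[H] N} {l : P' →ₗ[H] P}
    (h : ∀ x y, B (i x) (j y) = PT.mp l (C x y)) {m n : ℕ} (F : PT k H M' m) (G : PT k H N' n) :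
    B.compL (PT.mp i F) (PT.mp j G) = PT.mp l (C.compL F G) := by
  induction F, G using PT.induction₂ with
  | zero_left G => simp only [map_zero, LinearMap.zero_apply]
  | zero_right F => simp only [map_zero]
  | mk x v y w => rw [PT.mp_mk, PT.mp_mk, compL_mk, compL_mk, h, PT.mp_spr]
  | add_left F F' G h h' => simp only [map_add, LinearMap.add_apply, h, h']
  | add_right F G G' h h' => simp only [map_add, h, h']

end Pseudoproduct

/-- A skew-symmetric pseudoproduct as a cochain. -/
def ofPseudo (B : Pseudoproduct k H M M P) (hB : ∀ x y, B x y = -PT.rx (Equiv.swap 0 1) (B y x)) :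
    Cochain k H M P 2 :=
  toCochain (fun u => B (u 0) (u 1))
    { add := fun u i x y => by fin_cases i <;> simp
      smul := fun u i c x => by fin_cases i <;> simp
      slot := fun u i a => by
        fin_cases i
        · have := B.map_smul' a 1 (u 0) (u 1)
          rw [one_smul, map_one, mul_one] at this
          simpa using this
        · have := B.map_smul' 1 a (u 0) (u 1)
          rw [one_smul, map_one, one_mul] at this
          simpa using this }
    (fun σ u => by
      have h : σ = 1 ∨ σ = Equiv.swap 0 1 := by revert σ; decide
      rcases h with rfl | rfl
      · rw [sgn_one, one_smul, PT.rx_one]; rfl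
      · rw [sgn, Equiv.Perm.sign_swap (by decide)]
        simpa using hB _ _)

theorem ofPseudo_apply (B : Pseudoproduct k H M M P)
    (hB : ∀ x y, B x y = -PT.rx (Equiv.swap 0 1) (B y x)) (u : Fin 2 → M) :
    ofPseudo B hB u = B (u 0) (u 1) := rfl

/-- This and its companion for two insertions link the cochain calculus to the compositions in which
the axioms of matched pairs are phrased. -/
theorem ins_ofPseudo (B : Pseudoproduct k H M M P)
    (hB : ∀ x y, B x y = -PT.rx (Equiv.swap 0 1) (B y x)) {m : ℕ} (v : Fin 1 → M)
    (F : PT k H M m) : ins (ofPseudo B hB) v F = B.compL F (PT.unit (v 0)) := by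
  induction F using PT.induction with
  | zero => simp
  | mk x w =>
    rw [ins_mk, PT.unit, B.compL_mk, map_one, mul_one, ofPseudo_apply]
    refine PT.spr_congr ?_ rfl _
    ext i : 2
    induction i using Fin.addCases with
    | left i => rw [block₁_castAdd, block₂_castAdd]
    | right i => rw [block₁_natAdd, block₂_natAdd, Subsingleton.elim i 0]; rfl
  | add s t hs ht => simp only [map_add, LinearMap.add_apply, hs, ht]

theorem ins₂_ofPseudo (B : Pseudoproduct k H M M P)
    (hB : ∀ x y, B x y = -PT.rx (Equiv.swap 0 1) (B y x)) {m l : ℕ} (v : Fin 0 → M)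
    (F : PT k H M m) (G : PT k H M l) :
    ins₂ (n := 0) (ofPseudo B hB) v F G = B.compL F G := by
  induction F, G using PT.induction₂ with
  | zero_left G => simp only [map_zero, LinearMap.zero_apply, ins₂_zero_left]
  | zero_right F => simp only [map_zero]
  | mk x w y w' =>
    rw [ins₂_mk, B.compL_mk, ofPseudo_apply]
    refine PT.spr_congr (m := m + l) ?_ rfl _
    ext i
    induction i using Fin.addCases (m := m) (n := l) with
    | left i => rw [block₂_castAdd, block₃_val]; simp
    | right i => rw [block₂_natAdd, block₃_val]; simp
  | add_left F F' G h h' => simp only [map_add, LinearMap.add_apply, ins₂_add_left, h, h']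
  | add_right F G G' h h' => simp only [map_add, h, h']

end Comp

/-! ### The mixed Jacobi identities of a bicrossed product -/

section Total

variable {k H : Type*} [Field k] [Ring H] [Bialgebra k H] [Coalgebra.IsCocomm k H]
variable {W L M : Type*} [AddCommGroup M] [Module k M] [Module H M]
variable [AddCommGroup L] [Module k L] [Module H L]
variable [AddCommGroup W] [Module k W] [Module H W]

namespace Pseudoproduct

/-- `[x * [y * z]] - [[x * y] * z] - (12) [y * [x * z]]`. -/
def jacobiator (B : Pseudoproduct k H W W W) (x y z : W) : PT k H W 3 :=
  B.compL (PT.unit x) (B y z) - B.compL (B x y) (PT.unit z) -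
    PT.rx (Equiv.swap 0 1) (B.compL (PT.unit y) (B x z))

theorem compL_mp_sub [IsScalarTower k H W] [IsScalarTower k H L] [IsScalarTower k H M]
    {B : Pseudoproduct k H W W W} {C : Pseudoproduct k H L M M}
    {C' : Pseudoproduct k H M L L} {i : L →ₗ[H] W} {j : M →ₗ[H] W}
    (h : ∀ x y, B (i x) (j y) =
      PT.mp j (C x y) - PT.mp i (PT.rx (Equiv.swap 0 1) (C' y x))) {m n : ℕ} (F : PT k H L m)
    (G : PT k H M n) :
    B.compL (PT.mp i F) (PT.mp j G) =
      PT.mp j (C.compL F G) - PT.mp i (PT.rx finAddFlip (C'.compL G F)) := by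
  induction F, G using PT.induction₂ with
  | zero_left G => simp only [map_zero, LinearMap.zero_apply, sub_zero]
  | zero_right F => simp only [map_zero, LinearMap.zero_apply, sub_zero]
  | mk x v y w =>
    rw [PT.mp_mk, PT.mp_mk, compL_mk, compL_mk, h, map_sub, compL_mk, ← PT.mp_spr, ← PT.mp_spr,
      spr_block₂_swap]
  | add_left F F' G h h' => simp only [map_add, LinearMap.add_apply, h, h']; abel
  | add_right F G G' h h' => simp only [map_add, LinearMap.add_apply, h, h']; abel

/-- The component in M of the mixed Jacobi identity is the representation identity of `C`, and the
component in L is the compatibility condition. Stated abstractly, it serves both orderings of the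
pair: once with 𝔤 as L, once with 𝔥. -/
theorem jacobiator_eq_zero [IsScalarTower k H W] [IsScalarTower k H L] [IsScalarTower k H M]
    {B : Pseudoproduct k H W W W} (𝓛 : LiePseudoalgebra k H L) {C : Pseudoproduct k H L M M}
    {C' : Pseudoproduct k H M L L} {i : L →ₗ[H] W} {j : M →ₗ[H] W}
    (hB : ∀ x y, B (i x) (i y) = PT.mp i (𝓛.bracket x y))
    (h : ∀ x y, B (i x) (j y) =
      PT.mp j (C x y) - PT.mp i (PT.rx (Equiv.swap 0 1) (C' y x)))
    (hC : IsRepresentation 𝓛 C)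
    (hC' : ∀ u x y, C'.comp (PT.unit u) (𝓛.bracket x y) =
        𝓛.bracket.comp (C' u x) (PT.unit y) +
          PT.reindex (Equiv.swap (0 : Fin 3) 1)
            (𝓛.bracket.comp (PT.unit x) (C' u y) - C'.comp (C x u) (PT.unit y)) +
          PT.reindex cyc (C'.comp (C y u) (PT.unit x))) (x y : L) (v : M) :
    B.jacobiator (i x) (i y) (j v) = 0 := by
  have hBB : ∀ {m n : ℕ} (F : PT k H L m) (G : PT k H L n),
      B.compL (PT.mp i F) (PT.mp i G) = PT.mp i (𝓛.bracket.compL F G) := fun F G =>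
    compL_mp hB F G
  have h1 := congrArg (PT.mp j) (hC x y v)
  -- In the compatibility condition the element of M comes first, in the Jacobiator last; the flip
  -- moves its tensor factor to the end.
  have h2 := congrArg (fun t => PT.mp i (PT.rx (finAddFlip (m := 1) (n := 2)) t)) (hC' v x y)
  simp only [comp_eq, PT.reindex_eq] at h1 h2
  rw [compL_skew 𝓛.skew (C' v x) (PT.unit y)] at h2
  rw [jacobiator, h, h, hB, ← PT.mp_unit, ← PT.mp_unit, ← PT.mp_unit]
  simp only [map_sub, hBB, compL_mp_sub h]
  simp only [compL_rx_right, map_sub, map_add, map_neg, PT.mp_rx, PT.rx_rx] at *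
  have e1 : (Equiv.swap (0 : Fin 3) 1).trans (finAddFlip (m := 1) (n := 2)) =
      blockEquiv (Equiv.refl (Fin 1)) (Equiv.swap (0 : Fin 2) 1) := by decide
  have e2 : cyc.trans (finAddFlip (m := 1) (n := 2)) = finAddFlip (m := 2) (n := 1) := by decide
  have e3 : (finAddFlip (m := 2) (n := 1)).trans (Equiv.swap (0 : Fin 3) 1) =
    (Equiv.swap (0 : Fin 3) 1).trans (finAddFlip (m := 1) (n := 2)) := by decide
  have e4 : (blockEquiv (Equiv.refl (Fin 1)) (Equiv.swap (0 : Fin 2) 1)).trans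
      (Equiv.swap (0 : Fin 3) 1) =
    (finAddFlip (m := 1) (n := 2)).trans (finAddFlip (m := 1) (n := 2)) := by decide
  rw [e2] at h2
  rw [h1, h2, e4, e3, e1]
  abel

end Pseudoproduct

end Total

/-! ### The square of a skew pseudoproduct is its Jacobiator -/

section Square

variable {k H : Type*} [Field k] [Ring H] [Bialgebra k H] [Coalgebra.IsCocomm k H]
variable {W M N : Type*} [AddCommGroup M] [Module k M] [Module H M]
variable [AddCommGroup W] [Module k W] [Module H W]
variable [AddCommGroup N] [Module k N] [Module H N]

/-- An alternation of a function which is skew on two blocks is a sum over unshuffles. -/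
theorem alt_eq_sum_unshuffles {X : Type*} {m n a b : ℕ} (h : m = n) (ha : a ≤ b) (hb : b ≤ n)
    {E : (Fin m → X) → PT k H N m}
    (h₁ : ∀ π : Equiv.Perm (Fin m), (∀ s : Fin m, a ≤ (s : ℕ) → π s = s) → SkewUnder E π)
    (h₂ : ∀ π : Equiv.Perm (Fin m), (∀ s : Fin m, (s : ℕ) < b → π s = s) → SkewUnder E π)
    (u : Fin n → X) :
    alt h E u = ((a.factorial * (n - b).factorial : ℕ) : k) •
      ∑ σ ∈ unshuffles n a b, altTerm h E u σ := by
  subst h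
  rw [alt, sum_unshuffles ha hb, Nat.cast_smul_eq_nsmul]
  · intro σ π hπ
    exact altTerm_mul rfl (h₁ π hπ) u σ
  · intro σ π hπ
    exact altTerm_mul rfl (h₂ π hπ) u σ

theorem circ_eq_sum_unshuffles [CharZero k] {a b : ℕ} (f : Cochain k H M N (a + 1))
    (g : Cochain k H M M (b + 1)) (u : Fin (a + b + 1) → M) :
    circ f g u = ∑ σ ∈ unshuffles (a + b + 1) (b + 1) (b + 1),
      altTerm (add_one_add_eq a b) (nest f g) u σ := by
  rw [circ_apply, alt_eq_sum_unshuffles (a := b + 1) (b := b + 1) _ le_rfl (by omega)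
    (fun π hπ => .of_left (fun τ => nest_skew f g τ (Equiv.refl _)) hπ)
    (fun π hπ => .of_right (fun τ => nest_skew f g (Equiv.refl _) τ) hπ), smul_smul, wt,
    show a + b + 1 - (b + 1) = a by omega, inv_mul_cancel₀, one_smul]
  exact Nat.cast_ne_zero.mpr (Nat.mul_ne_zero (Nat.factorial_ne_zero _) (Nat.factorial_ne_zero _))

/-- The square is a sum over the three (2, 1)-unshuffles. In two of its terms skew-symmetry carries
the inner product to the second argument. -/
theorem circ_ofPseudo_self [CharZero k] (B : Pseudoproduct k H W W W)
    (hB : ∀ x y, B x y = -PT.rx (Equiv.swap 0 1) (B y x)) (u : Fin 3 → W) :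
    circ (a := 1) (b := 1) (ofPseudo B hB) (ofPseudo B hB) u =
      -B.jacobiator (u 0) (u 1) (u 2) := by
  have hu : unshuffles 3 2 2 = {1, Equiv.swap 1 2, finRotate 3} := by decide
  refine (circ_eq_sum_unshuffles (a := 1) (b := 1) _ _ u).trans ?_
  change ∑ σ ∈ unshuffles 3 2 2, altTerm (add_one_add_eq 1 1) _ u σ = _
  rw [hu, Finset.sum_insert (by decide), Finset.sum_insert (by decide), Finset.sum_singleton]
  have hn : ∀ v : Fin 3 → W, nest (m := 2) (n := 1) (ofPseudo B hB) (ofPseudo B hB) v =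
      B.compL (B (v 0) (v 1)) (PT.unit (v 2)) := fun v => ins_ofPseudo B hB _ _
  have ht : ∀ σ : Equiv.Perm (Fin 3),
      altTerm (add_one_add_eq 1 1) (nest (m := 2) (n := 1) (ofPseudo B hB) (ofPseudo B hB)) u σ =
      sgn k σ • PT.rx σ (B.compL (B (u (σ 0)) (u (σ 1))) (PT.unit (u (σ 2)))) :=
    fun σ => congrArg (fun t => sgn k σ • PT.rx σ t) (hn fun s => u (σ s))
  have s1 : sgn k (Equiv.swap (1 : Fin 3) 2) = -1 := by
    rw [sgn, Equiv.Perm.sign_swap (by decide)]; simp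
  have s2 : sgn k (finRotate 3) = 1 := by
    rw [sgn, sign_finRotate]; simp
  rw [ht, ht, ht, sgn_one, s1, s2, Pseudoproduct.jacobiator]
  rw [Pseudoproduct.compL_skew hB (B (u (Equiv.swap (1 : Fin 3) 2 0)) _),
    Pseudoproduct.compL_skew hB (B (u (finRotate 3 0)) _)]
  have e1 : (finAddFlip (m := 1) (n := 2)).trans (finRotate 3) = Equiv.refl _ := by decide
  have e2 : (finAddFlip (m := 1) (n := 2)).trans (Equiv.swap (1 : Fin 3) 2) =
    Equiv.swap (0 : Fin 3) 1 := by decide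
  simp only [map_neg, PT.rx_one, PT.rx_rx]
  rw [e1, e2, PT.rx_refl]
  rw [show Equiv.swap (1 : Fin 3) 2 0 = 0 by decide, show Equiv.swap (1 : Fin 3) 2 1 = 2 by decide,
    show Equiv.swap (1 : Fin 3) 2 2 = 1 by decide, show finRotate 3 0 = 1 by decide,
    show finRotate 3 1 = 2 by decide, show finRotate 3 2 = 0 by decide]
  simp only [Equiv.Perm.one_apply]
  module

/-- By additivity only arguments from the two summands matter. The square is a cochain and hence
skew-symmetric, so of the eight patterns of arguments four suffice. -/
theorem circ_ofPseudo_self_eq_zero {X Y : Type*} [CharZero k] (B : Pseudoproduct k H W W W)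
    (hB : ∀ x y, B x y = -PT.rx (Equiv.swap 0 1) (B y x)) (i : X → W) (j : Y → W)
    (hij : ∀ w, ∃ x v, w = i x + j v) (h₁ : ∀ x y z, B.jacobiator (i x) (i y) (i z) = 0)
    (h₂ : ∀ x y v, B.jacobiator (i x) (i y) (j v) = 0)
    (h₃ : ∀ u v x, B.jacobiator (j u) (j v) (i x) = 0)
    (h₄ : ∀ u v w, B.jacobiator (j u) (j v) (j w) = 0) :
    circ (a := 1) (b := 1) (ofPseudo B hB) (ofPseudo B hB) = 0 := by
  have key : ∀ (σ : Equiv.Perm (Fin 3)) (u : Fin 3 → W),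
      B.jacobiator (u (σ 0)) (u (σ 1)) (u (σ 2)) = 0 → B.jacobiator (u 0) (u 1) (u 2) = 0 := by
    intro σ u h
    have h1 := cochain_skew (circ (a := 1) (b := 1) (ofPseudo B hB) (ofPseudo B hB)) σ u
    rwa [circ_ofPseudo_self, circ_ofPseudo_self, h, neg_zero, map_zero, smul_zero,
      neg_eq_zero] at h1
  have h₂' : ∀ x v y, B.jacobiator (i x) (j v) (i y) = 0 := fun x v y =>
    key (Equiv.swap 1 2) ![i x, j v, i y] (h₂ x y v)
  have h₂'' : ∀ v x y, B.jacobiator (j v) (i x) (i y) = 0 := fun v x y =>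
    key (finRotate 3) ![j v, i x, i y] (h₂ x y v)
  have h₃' : ∀ x v y, B.jacobiator (j x) (i v) (j y) = 0 := fun x v y =>
    key (Equiv.swap 1 2) ![j x, i v, j y] (h₃ x y v)
  have h₃'' : ∀ v x y, B.jacobiator (i v) (j x) (j y) = 0 := fun v x y =>
    key (finRotate 3) ![i v, j x, j y] (h₃ x y v)
  have hu : ∀ x y : W, (PT.unit (x + y) : PT k H W 1) = PT.unit x + PT.unit y :=
    fun x y => PT.mk_add_right _ _ _
  refine cochain_ext fun u => ?_
  refine (circ_ofPseudo_self B hB u).trans (neg_eq_zero.mpr ?_)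
  obtain ⟨x, v, h0⟩ := hij (u 0)
  obtain ⟨x', v', h1⟩ := hij (u 1)
  obtain ⟨x'', v'', h2⟩ := hij (u 2)
  have l1 : ∀ a b c d, B.jacobiator (a + b) c d = B.jacobiator a c d + B.jacobiator b c d := by
    intro a b c d
    simp only [Pseudoproduct.jacobiator, map_add, LinearMap.add_apply, hu]
    abel
  have l2 : ∀ a b c d, B.jacobiator c (a + b) d = B.jacobiator c a d + B.jacobiator c b d := by
    intro a b c d
    simp only [Pseudoproduct.jacobiator, map_add, LinearMap.add_apply, hu]
    abel
  have l3 : ∀ a b c d, B.jacobiator c d (a + b) = B.jacobiator c d a + B.jacobiator c d b := by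
    intro a b c d
    simp only [Pseudoproduct.jacobiator, map_add, hu]
    abel
  rw [h0, h1, h2]
  simp only [l1, l2, l3, h₁, h₂, h₃, h₄, h₂', h₂'', h₃', h₃'', add_zero]

end Square

/-! ### The bicrossed product and its two halves -/

section Bicrossed

variable {k H : Type*} [Field k] [Ring H] [Bialgebra k H] [Coalgebra.IsCocomm k H]

section Zero

variable {M N P : Type*} [AddCommGroup M] [Module k M] [Module H M]
variable [AddCommGroup N] [Module k N] [Module H N]
variable [AddCommGroup P] [Module k P] [Module H P]

theorem PT.rx_swap_act (a b : H) (t : PT k H M 2) :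
    PT.rx (Equiv.swap 0 1) (PT.act (slot 0 b * slot 1 a) t) =
      PT.act (slot 0 a * slot 1 b) (PT.rx (Equiv.swap 0 1) t) := by
  have e : slot (k := k) (n := 2) 0 b * slot 1 a = slot 1 a * slot 0 b :=
    (slot_commute (by decide) b a).eq
  rw [e, PT.rx, PT.spr_act, PT.act_spr, map_mul, fibre_symm_slot, fibre_symm_slot, one_mul,
    mul_one, Equiv.swap_apply_left, Equiv.swap_apply_right]

instance : Zero (Pseudoproduct k H M N P) := ⟨⟨0, fun _ _ _ _ => (PT.act_zero _).symm⟩⟩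

theorem Pseudoproduct.zero_apply (x : M) (y : N) : (0 : Pseudoproduct k H M N P) x y = 0 := rfl

theorem Pseudoproduct.compL_zero {m n : ℕ} (F : PT k H M m) (G : PT k H N n) :
    (0 : Pseudoproduct k H M N P).compL F G = 0 := by
  induction F, G using PT.induction₂ with
  | zero_left G => simp only [map_zero, LinearMap.zero_apply]
  | zero_right F => simp only [map_zero]
  | mk x v y w => rw [compL_mk, zero_apply, map_zero]
  | add_left F F' G h h' => simp only [map_add, LinearMap.add_apply, h, h', add_zero]
  | add_right F G G' h h' => simp only [map_add, h, h', add_zero]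

variable (k H M) in
/-- The abelian Lie pseudoalgebra. -/
def LiePseudoalgebra.abelian : LiePseudoalgebra k H M where
  bracket := 0
  skew x y := by
    rw [PT.reindex_eq, Pseudoproduct.zero_apply, Pseudoproduct.zero_apply, map_zero, neg_zero]
  jacobi x y z := by
    simp only [Pseudoproduct.comp_eq, PT.reindex_eq, Pseudoproduct.compL_zero, map_zero, add_zero]

theorem LiePseudoalgebra.abelian_bracket : (abelian k H M).bracket = 0 := rfl

end Zero

variable {𝔤 𝔥 : Type*} [AddCommGroup 𝔤] [Module k 𝔤] [Module H 𝔤]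
variable [AddCommGroup 𝔥] [Module k 𝔥] [Module H 𝔥]

namespace MatchedPair

variable {𝓰 : LiePseudoalgebra k H 𝔤} {𝓱 : LiePseudoalgebra k H 𝔥} (P : MatchedPair 𝓰 𝓱)

/-- Forgetting the bracket of `𝔤` and its action on `𝔥`. -/
def forgetLeft : MatchedPair (LiePseudoalgebra.abelian k H 𝔤) 𝓱 where
  ρ := 0
  η := P.η
  rep_ρ x y m := by
    simp only [Pseudoproduct.comp_eq, PT.reindex_eq, Pseudoproduct.compL_zero, map_zero, sub_zero]
  rep_η := P.rep_η
  compat_ρ x u v := by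
    simp only [Pseudoproduct.comp_eq, PT.reindex_eq, Pseudoproduct.compL_zero, map_zero, sub_zero,
      Pseudoproduct.zero_apply, LinearMap.zero_apply, add_zero]
  compat_η u x y := by
    simp only [Pseudoproduct.comp_eq, PT.reindex_eq, Pseudoproduct.compL_zero, map_zero, sub_zero,
      Pseudoproduct.zero_apply, LinearMap.zero_apply, add_zero, LiePseudoalgebra.abelian_bracket]

/-- Forgetting the bracket of `𝔥` and its action on `𝔤`. -/
def forgetRight : MatchedPair 𝓰 (LiePseudoalgebra.abelian k H 𝔥) where
  ρ := P.ρ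
  η := 0
  rep_ρ := P.rep_ρ
  rep_η x y m := by
    simp only [Pseudoproduct.comp_eq, PT.reindex_eq, Pseudoproduct.compL_zero, map_zero, sub_zero]
  compat_η x u v := by
    simp only [Pseudoproduct.comp_eq, PT.reindex_eq, Pseudoproduct.compL_zero, map_zero, sub_zero,
      Pseudoproduct.zero_apply, LinearMap.zero_apply, add_zero]
  compat_ρ u x y := by
    simp only [Pseudoproduct.comp_eq, PT.reindex_eq, Pseudoproduct.compL_zero, map_zero, sub_zero,
      Pseudoproduct.zero_apply, LinearMap.zero_apply, add_zero, LiePseudoalgebra.abelian_bracket]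

variable [IsScalarTower k H 𝔤] [IsScalarTower k H 𝔥]

/-- The pseudoproduct of the bicrossed product `𝔤 ⋈ 𝔥`. -/
def total : Pseudoproduct k H (𝔤 × 𝔥) (𝔤 × 𝔥) (𝔤 × 𝔥) where
  toFun := LinearMap.mk₂ k (fun x y =>
      PT.mp (LinearMap.inl H 𝔤 𝔥) (𝓰.bracket x.1 y.1 + P.η x.2 y.1 -
        PT.rx (Equiv.swap 0 1) (P.η y.2 x.1)) +
      PT.mp (LinearMap.inr H 𝔤 𝔥) (𝓱.bracket x.2 y.2 + P.ρ x.1 y.2 -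
        PT.rx (Equiv.swap 0 1) (P.ρ y.1 x.2)))
    (fun x x' y => by
      simp only [Prod.fst_add, Prod.snd_add, map_add, map_sub, LinearMap.add_apply]
      abel)
    (fun c x y => by
      simp only [Prod.smul_fst, Prod.smul_snd, map_smul, LinearMap.smul_apply, smul_add, smul_sub,
        map_add, map_sub])
    (fun x y y' => by
      simp only [Prod.fst_add, Prod.snd_add, map_add, map_sub, LinearMap.add_apply]
      abel)
    (fun c x y => by
      simp only [Prod.smul_fst, Prod.smul_snd, map_smul, LinearMap.smul_apply, smul_add, smul_sub,
        map_add, map_sub])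
  map_smul' a b x y := by
    simp only [LinearMap.mk₂_apply, Prod.smul_fst, Prod.smul_snd, Pseudoproduct.map_smul',
      PT.rx_swap_act]
    simp only [PT.act_eq_spr, map_add, map_sub, PT.mp_spr]

theorem total_apply (x y : 𝔤 × 𝔥) : P.total x y =
      PT.mp (LinearMap.inl H 𝔤 𝔥) (𝓰.bracket x.1 y.1 + P.η x.2 y.1 -
        PT.rx (Equiv.swap 0 1) (P.η y.2 x.1)) +
      PT.mp (LinearMap.inr H 𝔤 𝔥) (𝓱.bracket x.2 y.2 + P.ρ x.1 y.2 -
        PT.rx (Equiv.swap 0 1) (P.ρ y.1 x.2)) := rfl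

theorem total_skew (x y : 𝔤 × 𝔥) : P.total x y = -PT.rx (Equiv.swap 0 1) (P.total y x) := by
  have h1 := 𝓰.skew x.1 y.1
  have h2 := 𝓱.skew x.2 y.2
  rw [PT.reindex_eq] at h1 h2
  have e : (Equiv.swap (0 : Fin 2) 1).trans (Equiv.swap 0 1) = Equiv.refl _ := by decide
  simp only [total_apply, map_add, map_sub, ← PT.mp_rx, PT.rx_rx, e, PT.rx_refl, h1, h2, map_neg]
  abel

theorem total_inl_inl (x y : 𝔤) :
    P.total (LinearMap.inl H 𝔤 𝔥 x) (LinearMap.inl H 𝔤 𝔥 y) =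
      PT.mp (LinearMap.inl H 𝔤 𝔥) (𝓰.bracket x y) := by
  simp [total_apply]

theorem total_inr_inr (u v : 𝔥) :
    P.total (LinearMap.inr H 𝔤 𝔥 u) (LinearMap.inr H 𝔤 𝔥 v) =
      PT.mp (LinearMap.inr H 𝔤 𝔥) (𝓱.bracket u v) := by
  simp [total_apply]

theorem total_inl_inr (x : 𝔤) (v : 𝔥) :
    P.total (LinearMap.inl H 𝔤 𝔥 x) (LinearMap.inr H 𝔤 𝔥 v) =
      PT.mp (LinearMap.inr H 𝔤 𝔥) (P.ρ x v) -
        PT.mp (LinearMap.inl H 𝔤 𝔥) (PT.rx (Equiv.swap 0 1) (P.η v x)) := by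
  simp [total_apply]
  abel

theorem total_inr_inl (v : 𝔥) (x : 𝔤) :
    P.total (LinearMap.inr H 𝔤 𝔥 v) (LinearMap.inl H 𝔤 𝔥 x) =
      PT.mp (LinearMap.inl H 𝔤 𝔥) (P.η v x) -
        PT.mp (LinearMap.inr H 𝔤 𝔥) (PT.rx (Equiv.swap 0 1) (P.ρ x v)) := by
  simp [total_apply]
  abel

/-- The bracket of the bicrossed product as a cochain. -/
def structureCochain : Cochain k H (𝔤 × 𝔥) (𝔤 × 𝔥) (1 + 1) := ofPseudo P.total P.total_skew

theorem jacobiator_of_bracket {L W : Type*} [AddCommGroup L] [Module k L] [Module H L]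
    [AddCommGroup W] [Module k W] [Module H W] [IsScalarTower k H L] [IsScalarTower k H W]
    (𝓛 : LiePseudoalgebra k H L) {B : Pseudoproduct k H W W W} {i : L →ₗ[H] W}
    (hB : ∀ x y, B (i x) (i y) = PT.mp i (𝓛.bracket x y)) (x y z : L) :
    B.jacobiator (i x) (i y) (i z) = 0 := by
  have hBB : ∀ {m n : ℕ} (F : PT k H L m) (G : PT k H L n),
      B.compL (PT.mp i F) (PT.mp i G) = PT.mp i (𝓛.bracket.compL F G) := fun F G =>
    Pseudoproduct.compL_mp hB F G
  have h := congrArg (PT.mp i) (𝓛.jacobi x y z)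
  simp only [Pseudoproduct.comp_eq, PT.reindex_eq] at h
  rw [Pseudoproduct.jacobiator, hB, hB, hB, ← PT.mp_unit, ← PT.mp_unit, ← PT.mp_unit, hBB, hBB,
    hBB, h, map_add, PT.mp_rx]
  abel

/-- The four patterns are the Jacobi identity of 𝔤, the axioms for ρ together with the compatibility
for η, the same with the roles exchanged, and the Jacobi identity of 𝔥. -/
theorem circ_structureCochain_self [CharZero k] :
    circ (a := 1) (b := 1) P.structureCochain P.structureCochain = 0 :=
  circ_ofPseudo_self_eq_zero P.total P.total_skew (LinearMap.inl H 𝔤 𝔥) (LinearMap.inr H 𝔤 𝔥)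
    (fun w => ⟨w.1, w.2, by simp⟩)
    (jacobiator_of_bracket 𝓰 P.total_inl_inl)
    (Pseudoproduct.jacobiator_eq_zero 𝓰 P.total_inl_inl P.total_inl_inr P.rep_ρ P.compat_η)
    (Pseudoproduct.jacobiator_eq_zero 𝓱 P.total_inr_inr P.total_inr_inl P.rep_η P.compat_ρ)
    (jacobiator_of_bracket 𝓱 P.total_inr_inr)

theorem structureCochain_eq_add :
    P.structureCochain = P.forgetLeft.structureCochain + P.forgetRight.structureCochain :=
  cochain_ext fun u => by
    change P.total (u 0) (u 1) = P.forgetLeft.total (u 0) (u 1) + P.forgetRight.total (u 0) (u 1)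
    simp only [total_apply, forgetLeft, forgetRight, LiePseudoalgebra.abelian_bracket,
      Pseudoproduct.zero_apply, map_add, map_sub, map_zero]
    abel

/-- Both halves are structure cochains of matched pairs, so they square to zero. Subtracting these
squares from the vanishing square of the sum leaves the cross terms. -/
theorem circ_structureCochain_comm [CharZero k] :
    circ (a := 1) (b := 1) P.forgetLeft.structureCochain P.forgetRight.structureCochain +
      circ (a := 1) (b := 1) P.forgetRight.structureCochain P.forgetLeft.structureCochain = 0 := by
  have h := P.circ_structureCochain_self
  rw [structureCochain_eq_add] at h
  have h1 := P.forgetLeft.circ_structureCochain_self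
  have h2 := P.forgetRight.circ_structureCochain_self
  simp only [map_add, LinearMap.add_apply, h1, h2, zero_add, add_zero] at h
  exact (add_comm _ _).trans h

end MatchedPair

end Bicrossed

/-! ### Embedding `C^n(𝔥, 𝔤)` into the cochains of `𝔤 × 𝔥` -/

section Hat

variable {k H : Type*} [Field k] [Ring H] [Bialgebra k H] [Coalgebra.IsCocomm k H]
variable {𝔤 𝔥 : Type*} [AddCommGroup 𝔤] [Module k 𝔤] [Module H 𝔤]
variable [AddCommGroup 𝔥] [Module k 𝔥] [Module H 𝔥]
variable [IsScalarTower k H 𝔤] [IsScalarTower k H 𝔥]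

/-- Pulling back the arguments and pushing forward the values of a cochain. -/
def mapCochain {M N M' N' : Type*} [AddCommGroup M] [Module k M] [Module H M]
    [AddCommGroup N] [Module k N] [Module H N] [AddCommGroup M'] [Module k M'] [Module H M']
    [AddCommGroup N'] [Module k N'] [Module H N'] [IsScalarTower k H M] [IsScalarTower k H N]
    [IsScalarTower k H M'] [IsScalarTower k H N'] (S : M' →ₗ[H] M) (T : N →ₗ[H] N') {n : ℕ} :
    Cochain k H M N n →ₗ[k] Cochain k H M' N' n where
  toFun f := toCochain (fun u => PT.mp T (f fun s => S (u s)))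
    { add := fun u i x y => by
        have e : ∀ z, (fun s => S (Function.update u i z s)) =
            Function.update (fun s => S (u s)) i (S z) := fun z =>
          funext fun s => Function.apply_update (fun _ => S) u i z s
        rw [e, e, e, map_add, (cochain_multilinear f).add, map_add]
      smul := fun u i c x => by
        have e : ∀ z, (fun s => S (Function.update u i z s)) =
            Function.update (fun s => S (u s)) i (S z) := fun z =>
          funext fun s => Function.apply_update (fun _ => S) u i z s
        rw [e, e, LinearMap.map_smul_of_tower, (cochain_multilinear f).smul, map_smul]
      slot := fun u i a => by
        have e : ∀ z, (fun s => S (Function.update u i z s)) =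
            Function.update (fun s => S (u s)) i (S z) := fun z =>
          funext fun s => Function.apply_update (fun _ => S) u i z s
        rw [e, map_smul, (cochain_multilinear f).slot (fun s => S (u s)), PT.mp_act] }
    (fun σ u => by
      change PT.mp T (f fun s => S (u s)) = sgn k σ • PT.rx σ (PT.mp T (f fun s => S (u (σ s))))
      rw [cochain_skew f σ fun s => S (u s), map_smul, PT.mp_rx])
  map_add' f g := cochain_ext fun u => map_add (PT.mp T) _ _
  map_smul' c f := cochain_ext fun u => map_smul (PT.mp T) _ _

/-- The embedding `C^n(𝔥, 𝔤) → C^n(𝔤 × 𝔥, 𝔤 × 𝔥)`. -/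
def hat {n : ℕ} : Cochain k H 𝔥 𝔤 n →ₗ[k] Cochain k H (𝔤 × 𝔥) (𝔤 × 𝔥) n :=
  mapCochain (LinearMap.snd H 𝔤 𝔥) (LinearMap.inl H 𝔤 𝔥)

/-- The left inverse of `hat`. -/
def unhat {n : ℕ} : Cochain k H (𝔤 × 𝔥) (𝔤 × 𝔥) n →ₗ[k] Cochain k H 𝔥 𝔤 n :=
  mapCochain (LinearMap.inr H 𝔤 𝔥) (LinearMap.fst H 𝔤 𝔥)

theorem hat_apply {n : ℕ} (f : Cochain k H 𝔥 𝔤 n) (u : Fin n → 𝔤 × 𝔥) :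
    hat f u = PT.mp (LinearMap.inl H 𝔤 𝔥) (f fun s => (u s).2) := rfl

theorem unhat_apply {n : ℕ} (f : Cochain k H (𝔤 × 𝔥) (𝔤 × 𝔥) n) (u : Fin n → 𝔥) :
    unhat f u = PT.mp (LinearMap.fst H 𝔤 𝔥) (f fun s => (0, u s)) := rfl

theorem PT.mp_fst_inl {n : ℕ} (t : PT k H 𝔤 n) :
    PT.mp (LinearMap.fst H 𝔤 𝔥) (PT.mp (LinearMap.inl H 𝔤 𝔥) t) = t := by
  rw [PT.mp_mp, LinearMap.fst_comp_inl, PT.mp_id]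

theorem PT.mp_snd_inl {n : ℕ} (t : PT k H 𝔤 n) :
    PT.mp (LinearMap.snd H 𝔤 𝔥) (PT.mp (LinearMap.inl H 𝔤 𝔥) t) = 0 := by
  rw [PT.mp_mp, LinearMap.snd_comp_inl, PT.mp_zero]

theorem PT.mp_snd_inr {n : ℕ} (t : PT k H 𝔥 n) :
    PT.mp (LinearMap.snd H 𝔤 𝔥) (PT.mp (LinearMap.inr H 𝔤 𝔥) t) = t := by
  rw [PT.mp_mp, LinearMap.snd_comp_inr, PT.mp_id]

theorem unhat_hat {n : ℕ} (f : Cochain k H 𝔥 𝔤 n) : unhat (hat f) = f :=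
  cochain_ext fun u => by rw [unhat_apply, hat_apply, PT.mp_fst_inl]

/-- Used to see that a commutator or derived bracket of embedded cochains is again embedded: an
explicit evaluation supplies `E`, which need not be known to be a cochain. -/
theorem hat_unhat {n : ℕ} {G : Cochain k H (𝔤 × 𝔥) (𝔤 × 𝔥) n} {E : (Fin n → 𝔥) → PT k H 𝔤 n}
    (h : ∀ u, G u = PT.mp (LinearMap.inl H 𝔤 𝔥) (E fun s => (u s).2)) : hat (unhat G) = G :=
  cochain_ext fun u => by rw [hat_apply, unhat_apply, h, h, PT.mp_fst_inl]

theorem unhat_eq {n : ℕ} {G : Cochain k H (𝔤 × 𝔥) (𝔤 × 𝔥) n} {E : (Fin n → 𝔥) → PT k H 𝔤 n}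
    (h : ∀ u, G u = PT.mp (LinearMap.inl H 𝔤 𝔥) (E fun s => (u s).2)) (u : Fin n → 𝔥) :
    unhat G u = E u := by rw [unhat_apply, h, PT.mp_fst_inl]

theorem ins_hat {m n : ℕ} (f : Cochain k H 𝔥 𝔤 (n + 1)) (v : Fin n → 𝔤 × 𝔥)
    (F : PT k H (𝔤 × 𝔥) m) :
    ins (hat f) v F = PT.mp (LinearMap.inl H 𝔤 𝔥)
      (ins f (fun s => (v s).2) (PT.mp (LinearMap.snd H 𝔤 𝔥) F)) := by
  induction F using PT.induction with
  | zero => simp only [map_zero]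
  | mk x w =>
    rw [ins_mk, PT.mp_mk, ins_mk, hat_apply, PT.mp_spr]
    congr 4
    funext s
    cases s using Fin.cases <;> rfl
  | add s t hs ht => simp only [map_add, hs, ht]

theorem nest_hat {m n : ℕ} (f : Cochain k H 𝔥 𝔤 (n + 1)) (G : Cochain k H (𝔤 × 𝔥) (𝔤 × 𝔥) m)
    (u : Fin (m + n) → 𝔤 × 𝔥) :
    nest (hat f) G u = PT.mp (LinearMap.inl H 𝔤 𝔥)
      (ins f (fun s => (u (Fin.natAdd m s)).2)
        (PT.mp (LinearMap.snd H 𝔤 𝔥) (G fun s => u (Fin.castAdd n s)))) := ins_hat _ _ _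

/-- The values of the inner cochain lie in 𝔤, where the outer one vanishes. -/
theorem nest_hat_hat {m n : ℕ} (f : Cochain k H 𝔥 𝔤 (n + 1)) (g : Cochain k H 𝔥 𝔤 m)
    (u : Fin (m + n) → 𝔤 × 𝔥) : nest (hat f) (hat g) u = 0 := by
  rw [nest_hat, hat_apply, PT.mp_snd_inl, map_zero, map_zero]

theorem alt_zero {M N : Type*} [AddCommGroup N] [Module k N] [Module H N] {m n : ℕ} (h : m = n)
    (u : Fin n → M) : alt h (fun _ => (0 : PT k H N m)) u = 0 := by
  simp [alt, altTerm]

theorem circ_hat_hat {a b : ℕ} (f : Cochain k H 𝔥 𝔤 (a + 1)) (g : Cochain k H 𝔥 𝔤 (b + 1)) :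
    circ (hat f) (hat g) = 0 :=
  cochain_ext fun u => by
    rw [circ_apply, funext (nest_hat_hat f g), alt_zero, smul_zero]; rfl

theorem alt_mp {X Y M N : Type*} [AddCommGroup M] [Module k M] [Module H M] [IsScalarTower k H M]
    [AddCommGroup N] [Module k N] [Module H N] [IsScalarTower k H N] {m n : ℕ} (h : m = n)
    (T : M →ₗ[H] N) (S : X → Y) (E : (Fin m → Y) → PT k H M m) (u : Fin n → X) :
    alt h (fun v => PT.mp T (E fun s => S (v s))) u = PT.mp T (alt h E fun s => S (u s)) := by
  simp only [alt, altTerm, map_sum, map_smul, PT.mp_rx]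

namespace MatchedPair

variable {𝓰 : LiePseudoalgebra k H 𝔤} {𝓱 : LiePseudoalgebra k H 𝔥} (P : MatchedPair 𝓰 𝓱)

theorem compL_total_inl_inl {m n : ℕ} (F : PT k H 𝔤 m) (G : PT k H 𝔤 n) :
    P.total.compL (PT.mp (LinearMap.inl H 𝔤 𝔥) F) (PT.mp (LinearMap.inl H 𝔤 𝔥) G) =
      PT.mp (LinearMap.inl H 𝔤 𝔥) (𝓰.bracket.compL F G) :=
  Pseudoproduct.compL_mp P.total_inl_inl F G

theorem compL_total_inl_unit {m : ℕ} (F : PT k H 𝔤 m) (w : 𝔤 × 𝔥) :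
    P.total.compL (PT.mp (LinearMap.inl H 𝔤 𝔥) F) (PT.unit w) =
      PT.mp (LinearMap.inl H 𝔤 𝔥) (𝓰.bracket.compL F (PT.unit w.1)) +
      (PT.mp (LinearMap.inr H 𝔤 𝔥) (P.ρ.compL F (PT.unit w.2)) -
        PT.mp (LinearMap.inl H 𝔤 𝔥) (PT.rx finAddFlip (P.η.compL (PT.unit w.2) F))) := by
  have e : (PT.unit w : PT k H (𝔤 × 𝔥) 1) =
      PT.mp (LinearMap.inl H 𝔤 𝔥) (PT.unit w.1) + PT.mp (LinearMap.inr H 𝔤 𝔥) (PT.unit w.2) := by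
    rw [PT.mp_unit, PT.mp_unit, PT.unit, PT.unit, PT.unit, ← PT.mk_add_right]
    simp
  rw [e, map_add, compL_total_inl_inl, Pseudoproduct.compL_mp_sub P.total_inl_inr]

/-- Of the product of an element of 𝔤 with `w`, only ρ has values in 𝔥. This is how ρ enters the
bracket of cochains. -/
theorem mp_snd_compL_total {m : ℕ} (F : PT k H 𝔤 m) (w : 𝔤 × 𝔥) :
    PT.mp (LinearMap.snd H 𝔤 𝔥) (P.total.compL (PT.mp (LinearMap.inl H 𝔤 𝔥) F) (PT.unit w)) =
      P.ρ.compL F (PT.unit w.2) := by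
  rw [compL_total_inl_unit, map_add, map_sub, PT.mp_snd_inl, PT.mp_snd_inl, PT.mp_snd_inr,
    zero_add, sub_zero]

theorem compL_forgetLeft_total {m : ℕ} (F : PT k H 𝔤 m) (w : 𝔤 × 𝔥) :
    P.forgetLeft.total.compL (PT.mp (LinearMap.inl H 𝔤 𝔥) F) (PT.unit w) =
      -PT.mp (LinearMap.inl H 𝔤 𝔥) (PT.rx finAddFlip (P.η.compL (PT.unit w.2) F)) := by
  rw [compL_total_inl_unit, LiePseudoalgebra.abelian_bracket]
  change PT.mp _ ((0 : Pseudoproduct k H 𝔤 𝔤 𝔤).compL _ _) +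
    (PT.mp _ ((0 : Pseudoproduct k H 𝔤 𝔥 𝔥).compL _ _) -
      PT.mp _ (PT.rx finAddFlip (P.η.compL _ _))) = _
  rw [Pseudoproduct.compL_zero, Pseudoproduct.compL_zero, map_zero, map_zero, zero_add, zero_sub]

theorem mp_snd_forgetLeft_total (x y : 𝔤 × 𝔥) :
    PT.mp (LinearMap.snd H 𝔤 𝔥) (P.forgetLeft.total x y) = 𝓱.bracket x.2 y.2 := by
  rw [total_apply, map_add, PT.mp_snd_inl, PT.mp_snd_inr, zero_add]
  change 𝓱.bracket x.2 y.2 + (0 : Pseudoproduct k H 𝔤 𝔥 𝔥) _ _ -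
    PT.rx _ ((0 : Pseudoproduct k H 𝔤 𝔥 𝔥) _ _) = _
  rw [Pseudoproduct.zero_apply, Pseudoproduct.zero_apply, map_zero, add_zero, sub_zero]

end MatchedPair

end Hat

/-! ### The differential and the bracket obtained from the bicrossed product -/

section Embed

variable {k H : Type*} [Field k] [Ring H] [Bialgebra k H] [Coalgebra.IsCocomm k H]
variable {𝔤 𝔥 : Type*} [AddCommGroup 𝔤] [Module k 𝔤] [Module H 𝔤]
variable [AddCommGroup 𝔥] [Module k 𝔥] [Module H 𝔥]

/-- Transport of cochains along an equality of degrees, as a linear map. -/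
def castL {a b : ℕ} (h : a = b) : Cochain k H 𝔥 𝔤 (a + 1) →ₗ[k] Cochain k H 𝔥 𝔤 (b + 1) where
  toFun := castC h
  map_add' x y := by subst h; rfl
  map_smul' c x := by subst h; rfl

theorem castL_eq {a b : ℕ} (h : a = b) (f : Cochain k H 𝔥 𝔤 (a + 1)) :
    castL h f = castC h f := rfl

variable [IsScalarTower k H 𝔤] [IsScalarTower k H 𝔥]

theorem mp_snd_circ_hat {a b : ℕ} (f : Cochain k H 𝔥 𝔤 (a + 1))
    (G : Cochain k H (𝔤 × 𝔥) (𝔤 × 𝔥) (b + 1)) (u : Fin (a + b + 1) → 𝔤 × 𝔥) :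
    PT.mp (LinearMap.snd H 𝔤 𝔥) (circ (hat f) G u) = 0 := by
  rw [circ_apply, map_smul, alt, map_sum, Finset.sum_eq_zero, smul_zero]
  intro σ _
  rw [altTerm, map_smul, PT.mp_rx, nest_hat, PT.mp_snd_inl, map_zero, smul_zero]

theorem circ_hat_circ_hat {a b c : ℕ} (f : Cochain k H 𝔥 𝔤 (a + 1)) (g : Cochain k H 𝔥 𝔤 (b + 1))
    (G : Cochain k H (𝔤 × 𝔥) (𝔤 × 𝔥) (c + 1)) : circ (hat f) (circ (hat g) G) = 0 :=
  cochain_ext fun u => by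
    have e : nest (hat f) (circ (hat g) G) = fun _ => 0 := funext fun v => by
      rw [nest_hat, mp_snd_circ_hat, map_zero, map_zero]
    rw [circ_apply, e, alt_zero, smul_zero]; rfl

/-- The embedding of `⨁ C^{n+1}(𝔥, 𝔤)` into `⨁ C^{n+1}(𝔤 × 𝔥, 𝔤 × 𝔥)` in each degree. -/
def embed (n : ℕ) : Cochain k H 𝔥 𝔤 (n + 1) →ₗ[k] TotalSpace k H (𝔤 × 𝔥) :=
  (DirectSum.lof k ℕ (fun n => Cochain k H (𝔤 × 𝔥) (𝔤 × 𝔥) (n + 1)) n).comp hat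

theorem embed_apply {n : ℕ} (f : Cochain k H 𝔥 𝔤 (n + 1)) :
    embed n f = DirectSum.of (fun n => Cochain k H (𝔤 × 𝔥) (𝔤 × 𝔥) (n + 1)) n (hat f) :=
  DirectSum.lof_eq_of k ℕ _ _ _

theorem embed_mem {n : ℕ} (f : Cochain k H 𝔥 𝔤 (n + 1)) :
    embed n f ∈ gradedPiece k H (𝔤 × 𝔥) n := by
  rw [embed_apply]
  exact of_mem_gradedPiece _

theorem embed_castL {a b : ℕ} (h : a = b) (f : Cochain k H 𝔥 𝔤 (a + 1)) :
    embed b (castL h f) = embed a f := by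
  subst h; rfl

/-- The degreewise retraction `unhat` assembles to a left inverse. Identities of the dg Lie algebra
can thus be verified in the ambient pre-Lie algebra. -/
theorem embed_injective : Function.Injective
    (DirectSum.toModule k ℕ (TotalSpace k H (𝔤 × 𝔥)) (embed (k := k) (H := H) (𝔤 := 𝔤) (𝔥 := 𝔥))) := by
  let U : TotalSpace k H (𝔤 × 𝔥) →ₗ[k] DirectSum ℕ fun n => Cochain k H 𝔥 𝔤 (n + 1) :=
    DirectSum.toModule k ℕ _ fun n =>
      (DirectSum.lof k ℕ (fun n => Cochain k H 𝔥 𝔤 (n + 1)) n).comp unhat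
  have h : U.comp (DirectSum.toModule k ℕ (TotalSpace k H (𝔤 × 𝔥)) embed) = LinearMap.id := by
    refine DirectSum.linearMap_ext k fun n => LinearMap.ext fun f => ?_
    simp only [LinearMap.comp_apply, DirectSum.toModule_lof, LinearMap.id_apply, U, embed,
      unhat_hat]
  exact Function.LeftInverse.injective (g := U) fun x => LinearMap.congr_fun h x

theorem embed_mul {a b : ℕ} (f : Cochain k H 𝔥 𝔤 (a + 1)) (g : Cochain k H 𝔥 𝔤 (b + 1)) :
    circTotal (embed a f) (embed b g) = 0 := by
  rw [embed_apply, embed_apply, circTotal_of, circ_hat_hat, map_zero]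

theorem embed_mul_mul {a b c : ℕ} (f : Cochain k H 𝔥 𝔤 (a + 1)) (g : Cochain k H 𝔥 𝔤 (b + 1))
    (G : Cochain k H (𝔤 × 𝔥) (𝔤 × 𝔥) (c + 1)) : circTotal (embed a f) (circTotal (embed b g)
      (DirectSum.of (fun n => Cochain k H (𝔤 × 𝔥) (𝔤 × 𝔥) (n + 1)) c G)) = 0 := by
  rw [embed_apply, embed_apply, circTotal_of, circTotal_of, circ_hat_circ_hat, map_zero]

theorem derived_embed [CharZero k] {a b : ℕ} (Δ : Cochain k H (𝔤 × 𝔥) (𝔤 × 𝔥) (1 + 1))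
    (f : Cochain k H 𝔥 𝔤 (a + 1)) (g : Cochain k H 𝔥 𝔤 (b + 1)) :
    derived circTotal (DirectSum.of (fun n => Cochain k H (𝔤 × 𝔥) (𝔤 × 𝔥) (n + 1)) 1 Δ) a b
      (embed a f) (embed b g) =
    -DirectSum.of (fun n => Cochain k H (𝔤 × 𝔥) (𝔤 × 𝔥) (n + 1)) _
        (circ (hat f) (circ Δ (hat g))) +
      (-1 : k) ^ ((a + 1) * (b + 1)) •
        DirectSum.of (fun n => Cochain k H (𝔤 × 𝔥) (𝔤 × 𝔥) (n + 1)) _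
        (circ (hat g) (circ Δ (hat f))) +
      (-1 : k) ^ a • DirectSum.of (fun n => Cochain k H (𝔤 × 𝔥) (𝔤 × 𝔥) (n + 1)) _
        (circ (circ Δ (hat f)) (hat g)) := by
  rw [derived_eq circTotal_isGradedPreLie (of_mem_gradedPiece Δ) (embed_mem f) (embed_mem g)
    (embed_mul f g) (embed_mul_mul f g Δ) (embed_mul_mul g f Δ)]
  simp only [embed_apply, circTotal_of]

theorem map_neg_add_smul_add_smul {V A : Type*} [AddCommGroup V] [Module k V] [AddCommGroup A]
    [Module k A] (φ : V →ₗ[k] A) (x y z : V) (c d : k) :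
    φ (-x + c • y + d • z) = -φ x + c • φ y + d • φ z := by
  simp only [map_add, map_neg, map_smul]

namespace MatchedPair

variable {𝓰 : LiePseudoalgebra k H 𝔤} {𝓱 : LiePseudoalgebra k H 𝔥} (P : MatchedPair 𝓰 𝓱)

/-- `η(uₙ, f(u₀, …, uₙ₋₁))`, with its tensor factors in the order of the arguments. -/
def etaLast {n : ℕ} (f : Cochain k H 𝔥 𝔤 n) (u : Fin (n + 1) → 𝔥) : PT k H 𝔤 (n + 1) :=
  PT.rx finAddFlip (P.η.compL (PT.unit (u (Fin.natAdd n 0))) (f fun s => u (Fin.castAdd 1 s)))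

/-- `f(K(u₀, u₁), u₂, …)`. -/
def pairNest (K : 𝔥 → 𝔥 → PT k H 𝔥 2) {n : ℕ} (f : Cochain k H 𝔥 𝔤 (n + 1))
    (u : Fin (2 + n) → 𝔥) : PT k H 𝔤 (2 + n) :=
  ins f (fun s => u (Fin.natAdd 2 s)) (K (u (Fin.castAdd n 0)) (u (Fin.castAdd n 1)))

/-- `f(ρ(g(u₀, …), uₙ₊₁), uₙ₊₂, …)`. -/
def rhoNest {a b : ℕ} (f : Cochain k H 𝔥 𝔤 (a + 1)) (g : Cochain k H 𝔥 𝔤 (b + 1))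
    (u : Fin (b + 1 + 1 + a) → 𝔥) : PT k H 𝔤 (b + 1 + 1 + a) :=
  ins f (fun s => u (Fin.natAdd (b + 1 + 1) s))
    (P.ρ.compL (g fun s => u (Fin.castAdd a (Fin.castAdd 1 s)))
      (PT.unit (u (Fin.castAdd a (Fin.natAdd (b + 1) 0)))))

/-- `[f(u₀, …), g(…, uₙ)]`. -/
def bracketNest (𝓰 : LiePseudoalgebra k H 𝔤) {a b : ℕ} (f : Cochain k H 𝔥 𝔤 (a + 1))
    (g : Cochain k H 𝔥 𝔤 (b + 1)) (u : Fin (a + 1 + (b + 1)) → 𝔥) : PT k H 𝔤 (a + 1 + (b + 1)) :=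
  𝓰.bracket.compL (f fun s => u (Fin.castAdd (b + 1) s)) (g fun s => u (Fin.natAdd (a + 1) s))

/-- The alternation of `etaLast f`. -/
def etaTerm {p : ℕ} (f : Cochain k H 𝔥 𝔤 (p + 1)) (w : Fin (1 + p + 1) → 𝔥) :
    PT k H 𝔤 (1 + p + 1) :=
  (-wt k (p + 1) 1) • alt (add_one_add_eq 1 p) (P.etaLast f) w

/-- The alternation of `pairNest K f`. -/
def pairTerm (K : 𝔥 → 𝔥 → PT k H 𝔥 2) {p : ℕ} (f : Cochain k H 𝔥 𝔤 (p + 1))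
    (w : Fin (p + 1 + 1) → 𝔥) : PT k H 𝔤 (p + 1 + 1) :=
  wt k 2 p • alt (add_one_add_eq p 1) (pairNest K f) w

/-- The alternation of `rhoNest f g`. -/
def rhoTerm {a b : ℕ} (f : Cochain k H 𝔥 𝔤 (a + 1)) (g : Cochain k H 𝔥 𝔤 (b + 1))
    (w : Fin (a + (1 + b) + 1) → 𝔥) : PT k H 𝔤 (a + (1 + b) + 1) :=
  ((a.factorial * (1).factorial * (b + 1).factorial : ℕ) : k)⁻¹ •
    alt (by omega) (P.rhoNest f g) w

/-- The alternation of `bracketNest f g`. -/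
def bracketTerm (𝓰 : LiePseudoalgebra k H 𝔤) {a b : ℕ} (f : Cochain k H 𝔥 𝔤 (a + 1))
    (g : Cochain k H 𝔥 𝔤 (b + 1)) (w : Fin (1 + a + b + 1) → 𝔥) : PT k H 𝔤 (1 + a + b + 1) :=
  (-((-1) ^ a * (-1) ^ ((a + 1) * (b + 1)) *
    (((a + 1).factorial * (b + 1).factorial : ℕ) : k)⁻¹)) • alt (by omega) (bracketNest 𝓰 f g) w

theorem circ_forgetLeft_hat {p : ℕ} (f : Cochain k H 𝔥 𝔤 (p + 1))
    (u : Fin (1 + p + 1) → 𝔤 × 𝔥) :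
    circ P.forgetLeft.structureCochain (hat f) u = PT.mp (LinearMap.inl H 𝔤 𝔥)
      (P.etaTerm f fun s => (u s).2) := by
  have e : nest P.forgetLeft.structureCochain (hat f) = fun v =>
      (-1 : k) • PT.mp (LinearMap.inl H 𝔤 𝔥) (P.etaLast f fun s => (v s).2) := by
    funext v
    rw [nest, structureCochain, ins_ofPseudo, hat_apply, compL_forgetLeft_total, neg_smul,
      one_smul]
    rfl
  rw [circ_apply, e, alt_smul, alt_mp _ _ Prod.snd, smul_smul, ← map_smul, mul_neg_one, etaTerm]

theorem circ_hat_forgetLeft {p : ℕ} (f : Cochain k H 𝔥 𝔤 (p + 1))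
    (u : Fin (p + 1 + 1) → 𝔤 × 𝔥) :
    circ (hat f) P.forgetLeft.structureCochain u = PT.mp (LinearMap.inl H 𝔤 𝔥)
      (pairTerm (fun v w => 𝓱.bracket v w) f fun s => (u s).2) := by
  have e : nest (hat f) P.forgetLeft.structureCochain = fun v =>
      PT.mp (LinearMap.inl H 𝔤 𝔥) (pairNest (fun v w => 𝓱.bracket v w) f fun s => (v s).2) := by
    funext v
    rw [nest_hat, structureCochain, ofPseudo_apply, mp_snd_forgetLeft_total]
    rfl
  rw [circ_apply, e, alt_mp _ _ Prod.snd, ← map_smul, pairTerm]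

theorem circ_hat_circ_total [CharZero k] {a b : ℕ} (f : Cochain k H 𝔥 𝔤 (a + 1))
    (g : Cochain k H 𝔥 𝔤 (b + 1)) (u : Fin (a + (1 + b) + 1) → 𝔤 × 𝔥) :
    circ (hat f) (circ P.structureCochain (hat g)) u = PT.mp (LinearMap.inl H 𝔤 𝔥)
      (P.rhoTerm f g fun s => (u s).2) := by
  have e : nest₃ (hat f) P.structureCochain (hat g) = fun v =>
      PT.mp (LinearMap.inl H 𝔤 𝔥) (P.rhoNest f g fun s => (v s).2) := by
    funext v
    rw [nest₃, nest, structureCochain, ins_ofPseudo, ins_hat, hat_apply, mp_snd_compL_total]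
    rfl
  rw [circ_right, e, alt_mp _ _ Prod.snd, ← map_smul, rhoTerm]

/-- The nested term contains one embedded cochain inside another and vanishes. In the forked term
both arguments of the structure cochain lie in 𝔤, so only the bracket of 𝔤 contributes. -/
theorem circ_circ_total_hat [CharZero k] {a b : ℕ} (f : Cochain k H 𝔥 𝔤 (a + 1))
    (g : Cochain k H 𝔥 𝔤 (b + 1)) (u : Fin (1 + a + b + 1) → 𝔤 × 𝔥) :
    circ (circ P.structureCochain (hat f)) (hat g) u = PT.mp (LinearMap.inl H 𝔤 𝔥)
      (bracketTerm 𝓰 f g fun s => (u s).2) := by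
  have e1 : nest₃ (a := 0 + 1) P.structureCochain (hat f) (hat g) = fun _ => 0 := by
    funext v
    rw [nest₃, nest_hat_hat, map_zero]
  have e2 : fork (n := 0) P.structureCochain (hat f) (hat g) = fun v =>
      PT.mp (LinearMap.inl H 𝔤 𝔥) (bracketNest 𝓰 f g fun s => (v s).2) := by
    funext v
    rw [fork, structureCochain, ins₂_ofPseudo, hat_apply, hat_apply, compL_total_inl_inl]
    rfl
  refine (circ_circ_succ (n := 0) P.structureCochain (hat f) (hat g) u).trans ?_
  refine (congrArg (fun t => _ • t + _) ((congrArg (fun E => alt _ E u) e1).trans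
    (alt_zero _ u))).trans ?_
  refine (congrArg (· + _) (smul_zero _)).trans ((zero_add _).trans ?_)
  rw [alt_fork_swap _ (by omega), e2]
  refine (congrArg (fun t => _ • -(_ • t)) (alt_mp _ _ Prod.snd (bracketNest 𝓰 f g) u)).trans ?_
  rw [smul_neg, smul_smul, ← neg_smul, bracketTerm, map_smul, Nat.factorial_zero, one_mul]
  congr 1
  ring

/-- The differential on `⨁ C^{n+1}(𝔥, 𝔤)`. -/
def differential (p : ℕ) : CochainSpace k H 𝔤 𝔥 p →ₗ[k] CochainSpace k H 𝔤 𝔥 (p + 1) :=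
  -- The graded commutator with the half containing η and the bracket of 𝔥, pulled back along the
  -- embedding.
  (castL (add_comm 1 p)).comp (unhat.comp ((circ P.forgetLeft.structureCochain).comp hat)) -
    (-1 : k) ^ p • unhat.comp ((circ.flip P.forgetLeft.structureCochain).comp hat)

theorem differential_apply {p : ℕ} (f : CochainSpace k H 𝔤 𝔥 p) : P.differential p f =
    castL (add_comm 1 p) (unhat (circ P.forgetLeft.structureCochain (hat f))) -
      (-1 : k) ^ p • unhat (circ (hat f) P.forgetLeft.structureCochain) := rfl

/-- The bracket on `⨁ C^{n+1}(𝔥, 𝔤)`. -/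
def bracket (p q : ℕ) : CochainSpace k H 𝔤 𝔥 p →ₗ[k] CochainSpace k H 𝔤 𝔥 q →ₗ[k]
    CochainSpace k H 𝔤 𝔥 (p + q + 1) :=
  LinearMap.mk₂ k (fun f g =>
    -- The three terms to which `derived_eq` reduces the derived bracket for the half containing ρ
    -- and the bracket of 𝔤.
    -castL (by ring) (unhat (circ (hat f) (circ P.forgetRight.structureCochain (hat g)))) +
      (-1 : k) ^ ((p + 1) * (q + 1)) •
        castL (by ring) (unhat (circ (hat g) (circ P.forgetRight.structureCochain (hat f)))) +
      (-1 : k) ^ p •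
        castL (by ring) (unhat (circ (circ P.forgetRight.structureCochain (hat f)) (hat g))))
    (fun f f' g => by simp only [map_add, LinearMap.add_apply, smul_add]; abel)
    (fun c f g => by
      simp only [map_smul, LinearMap.smul_apply, smul_add, smul_neg]
      simp only [smul_comm c])
    (fun f g g' => by simp only [map_add, LinearMap.add_apply, smul_add]; abel)
    (fun c f g => by
      simp only [map_smul, LinearMap.smul_apply, smul_add, smul_neg]
      simp only [smul_comm c])

theorem bracket_apply {p q : ℕ} (f : CochainSpace k H 𝔤 𝔥 p) (g : CochainSpace k H 𝔤 𝔥 q) :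
    P.bracket p q f g =
    -castL (by ring) (unhat (circ (hat f) (circ P.forgetRight.structureCochain (hat g)))) +
      (-1 : k) ^ ((p + 1) * (q + 1)) •
        castL (by ring) (unhat (circ (hat g) (circ P.forgetRight.structureCochain (hat f)))) +
      (-1 : k) ^ p •
        castL (by ring) (unhat (circ (circ P.forgetRight.structureCochain (hat f)) (hat g))) := rfl

theorem embed_differential {p : ℕ} (f : CochainSpace k H 𝔤 𝔥 p) :
    embed _ (P.differential p f) = lie circTotal 1 p
      (DirectSum.of (fun n => Cochain k H (𝔤 × 𝔥) (𝔤 × 𝔥) (n + 1)) 1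
        P.forgetLeft.structureCochain) (embed p f) := by
  have h1 : embed (p + 1) (castL (add_comm 1 p)
      (unhat (circ P.forgetLeft.structureCochain (hat f)))) = _ :=
    (embed_castL _ _).trans ((embed_apply _).trans
      (congrArg _ (hat_unhat (P.circ_forgetLeft_hat f))))
  have h2 : embed (p + 1) (unhat (circ (hat f) P.forgetLeft.structureCochain)) = _ :=
    (embed_apply _).trans (congrArg _ (hat_unhat (P.circ_hat_forgetLeft f)))
  rw [differential_apply, map_sub, map_smul, h1, h2, lie, embed_apply f, circTotal_of,
    circTotal_of, show 1 * p = p from one_mul p]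

theorem embed_bracket [CharZero k] {p q : ℕ} (f : CochainSpace k H 𝔤 𝔥 p)
    (g : CochainSpace k H 𝔤 𝔥 q) :
    embed _ (P.bracket p q f g) = derived circTotal
      (DirectSum.of (fun n => Cochain k H (𝔤 × 𝔥) (𝔤 × 𝔥) (n + 1)) 1
        P.forgetRight.structureCochain) p q (embed p f) (embed q g) := by
  have h1 := fun {a b c : ℕ} (h : a + (1 + b) = c) (f : Cochain k H 𝔥 𝔤 (a + 1))
      (g : Cochain k H 𝔥 𝔤 (b + 1)) =>
    (embed_castL h (unhat (circ (hat f) (circ P.forgetRight.structureCochain (hat g))))).trans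
      ((embed_apply _).trans (congrArg _ (hat_unhat (P.forgetRight.circ_hat_circ_total f g))))
  have h2 := fun (h : 1 + p + q = p + q + 1) =>
    (embed_castL h (unhat (circ (circ P.forgetRight.structureCochain (hat f)) (hat g)))).trans
      ((embed_apply _).trans (congrArg _ (hat_unhat (P.forgetRight.circ_circ_total_hat f g))))
  rw [bracket_apply, derived_embed]
  refine (map_neg_add_smul_add_smul (k := k) (V := CochainSpace k H 𝔤 𝔥 (p + q + 1))
    (A := TotalSpace k H (𝔤 × 𝔥)) (embed (p + q + 1)) _ _ _ _ _).trans ?_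
  rw [h1, h1, h2]

end MatchedPair

end Embed

/-! ### The differential graded Lie algebra and its twists -/

section DGLA

variable {k H : Type*} [Field k] [Ring H] [Bialgebra k H] [Coalgebra.IsCocomm k H]
variable {𝔤 𝔥 : Type*} [AddCommGroup 𝔤] [Module k 𝔤] [Module H 𝔤]
variable [AddCommGroup 𝔥] [Module k 𝔥] [Module H 𝔥]

theorem lie_of_one {W : Type*} [AddCommGroup W] [Module k W] [Module H W]
    (X Y : Cochain k H W W (1 + 1)) :
    lie circTotal 1 1 (DirectSum.of (fun n => Cochain k H W W (n + 1)) 1 X)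
      (DirectSum.of (fun n => Cochain k H W W (n + 1)) 1 Y) =
      DirectSum.of (fun n => Cochain k H W W (n + 1)) (1 + 1) (circ X Y + circ Y X) := by
  rw [lie, circTotal_of, circTotal_of, mul_one, pow_one, map_add, neg_smul, one_smul,
    sub_neg_eq_add]

namespace MatchedPair

variable [IsScalarTower k H 𝔤] [IsScalarTower k H 𝔥]
variable {𝓰 : LiePseudoalgebra k H 𝔤} {𝓱 : LiePseudoalgebra k H 𝔥} (P : MatchedPair 𝓰 𝓱)

/-- The bracket of the bicrossed product as an element of the total space. -/
def structureElement : TotalSpace k H (𝔤 × 𝔥) :=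
  DirectSum.of (fun n => Cochain k H (𝔤 × 𝔥) (𝔤 × 𝔥) (n + 1)) 1 P.structureCochain

theorem structureElement_mem : P.structureElement ∈ gradedPiece k H (𝔤 × 𝔥) 1 :=
  of_mem_gradedPiece _

theorem lie_structureElement_self [CharZero k] :
    lie circTotal 1 1 P.structureElement P.structureElement = 0 := by
  rw [structureElement, lie_of_one, circ_structureCochain_self, add_zero, map_zero]

theorem lie_structureElement_comm [CharZero k] :
    lie circTotal 1 1 P.forgetLeft.structureElement P.forgetRight.structureElement = 0 := by
  rw [structureElement, structureElement, lie_of_one, circ_structureCochain_comm, map_zero]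

theorem isDGLieAlgebra [CharZero k] : IsDGLieAlgebra P.differential P.bracket :=
  isDGLieAlgebra_of_derived circTotal_isGradedPreLie P.forgetRight.structureElement_mem
    P.forgetLeft.structureElement_mem P.forgetRight.lie_structureElement_self
    P.forgetLeft.lie_structureElement_self P.lie_structureElement_comm embed
    (fun _ => embed_mem) embed_injective (fun _ _ => embed_mul) P.differential P.bracket
    (fun _ => P.embed_differential) (fun _ _ => P.embed_bracket)

/-- The differential twisted by a cochain of degree one. -/
def twistedDifferential (T : CochainSpace k H 𝔤 𝔥 0) (p : ℕ) :
    CochainSpace k H 𝔤 𝔥 p →ₗ[k] CochainSpace k H 𝔤 𝔥 (p + 1) :=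
  P.differential p + (castL (by ring)).comp (P.bracket 0 p T)

theorem twistedDifferential_apply (T : CochainSpace k H 𝔤 𝔥 0) {p : ℕ}
    (f : CochainSpace k H 𝔤 𝔥 p) :
    P.twistedDifferential T p f = P.differential p f + castL (by ring) (P.bracket 0 p T f) := rfl

theorem of_twistedDifferential (T : CochainSpace k H 𝔤 𝔥 0) {p : ℕ}
    (f : CochainSpace k H 𝔤 𝔥 p) :
    DirectSum.of (CochainSpace k H 𝔤 𝔥) _ (P.twistedDifferential T p f) =
      DirectSum.of (CochainSpace k H 𝔤 𝔥) _ (P.differential p f) +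
        DirectSum.of (CochainSpace k H 𝔤 𝔥) _ (P.bracket 0 p T f) := by
  rw [twistedDifferential_apply, map_add]
  exact congrArg _ (of_castC _ _)

/-- The same derived bracket construction applies with Y replaced by Y + [X, T]: in commutator
degree 0 the derived bracket with T is the plain commutator with [X, T], without a sign. -/
theorem twisted_isDGLieAlgebra [CharZero k] {T : CochainSpace k H 𝔤 𝔥 0}
    (hT : IsMaurerCartan P.differential P.bracket T) :
    IsDGLieAlgebra (P.twistedDifferential T) P.bracket := by
  have hT' : lie circTotal 1 0 P.forgetLeft.structureElement (embed 0 T) +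
      (1 / 2 : k) • derived circTotal P.forgetRight.structureElement 0 0 (embed 0 T)
        (embed 0 T) = 0 := by
    have h := congrArg (embed 1) hT
    rw [map_zero] at h
    refine Eq.trans ?_ h
    refine Eq.trans ?_ ((embed 1).map_add _ _).symm
    exact congrArg₂ (· + ·) (P.embed_differential T).symm
      ((congrArg _ (P.embed_bracket T T).symm).trans ((embed 1).map_smul _ _).symm)
  obtain ⟨h1, h2⟩ := lie_twist circTotal_isGradedPreLie P.forgetRight.structureElement_mem
    P.forgetLeft.structureElement_mem P.forgetRight.lie_structureElement_self
    P.forgetLeft.lie_structureElement_self P.lie_structureElement_comm (embed_mem T) hT'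
  have h3 : P.forgetLeft.structureElement + lie circTotal 1 0 P.forgetRight.structureElement
      (embed 0 T) ∈ gradedPiece k H (𝔤 × 𝔥) 1 :=
    add_mem P.forgetLeft.structureElement_mem (lie_mem circTotal_isGradedPreLie
      P.forgetRight.structureElement_mem (embed_mem T))
  refine isDGLieAlgebra_of_derived circTotal_isGradedPreLie P.forgetRight.structureElement_mem
    h3 P.forgetRight.lie_structureElement_self h1 h2 embed
    (fun _ => embed_mem) embed_injective (fun _ _ => embed_mul) _ P.bracket
    (fun p f => ?_) (fun _ _ => P.embed_bracket)
  rw [twistedDifferential_apply, lie_add_left]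
  refine ((embed (p + 1)).map_add _ _).trans ?_
  refine congrArg₂ (· + ·) (P.embed_differential f) ((embed_castL _ _).trans
    ((P.embed_bracket T f).trans ?_))
  rw [derived, pow_zero, one_smul]
  rfl

end MatchedPair

end DGLA

/-! ### Alternations as sums over coset representatives -/

section Sums

theorem front₂_eq {n : ℕ} (i : Fin (n + 2)) (j' : Fin (n + 1)) :
    front₂ i j' = front i * shiftPerm (front j') := by
  have h : ∀ s : Fin (n + 1), finSuccEquiv' (0 : Fin (n + 2)) s.succ = some s := fun s => by
    have := finSuccEquiv'_succAbove (0 : Fin (n + 2)) s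
    rwa [Fin.succAbove_zero] at this
  ext s : 1
  cases s using Fin.cases with
  | zero => simp [front₂]
  | succ s =>
    rw [Equiv.Perm.mul_apply, shiftPerm_succ, front_succ, front₂, Equiv.trans_apply, h,
      Equiv.trans_apply, Equiv.optionCongr_apply, Option.map_some, finSuccEquiv'_symm_some]

theorem front₂_zero {n : ℕ} (i : Fin (n + 2)) (j' : Fin (n + 1)) : front₂ i j' 0 = i := by
  rw [front₂_eq, Equiv.Perm.mul_apply, shiftPerm_zero, front_zero]

theorem front₂_one {n : ℕ} (i : Fin (n + 2)) (j' : Fin (n + 1)) :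
    front₂ i j' 1 = i.succAbove j' := by
  rw [front₂_eq, Equiv.Perm.mul_apply, ← Fin.succ_zero_eq_one, shiftPerm_succ, front_succ,
    front_zero]

theorem front₂_succ_succ {n : ℕ} (i : Fin (n + 2)) (j' : Fin (n + 1)) (s : Fin n) :
    front₂ i j' s.succ.succ = i.succAbove (j'.succAbove s) := by
  rw [front₂_eq, Equiv.Perm.mul_apply, shiftPerm_succ, front_succ, front_succ]

/-- Exchanging the two distinguished arguments is an involution on the pairs `(i, j')`, which lets
ordered pairs be folded into increasing ones. -/
theorem front₂_mul_swap {n : ℕ} (i : Fin (n + 2)) (j' : Fin (n + 1)) :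
    front₂ i j' * Equiv.swap 0 1 = front₂ (i.succAbove j') (j'.predAbove i) := by
  ext s : 1
  rw [Equiv.Perm.mul_apply]
  cases s using Fin.cases with
  | zero => rw [Equiv.swap_apply_left, front₂_one, front₂_zero]
  | succ s =>
    cases s using Fin.cases with
    | zero =>
      rw [Fin.succ_zero_eq_one, Equiv.swap_apply_right, front₂_zero, front₂_one,
        Fin.succAbove_succAbove_predAbove]
    | succ s =>
      rw [Equiv.swap_apply_of_ne_of_ne (Fin.succ_ne_zero _) (by simp [Fin.ext_iff]),
        front₂_succ_succ, front₂_succ_succ, Fin.succAbove_succAbove_succAbove_predAbove]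

/-- Folding a sum over ordered pairs into a sum over increasing pairs. -/
theorem sum_front₂ {A : Type*} [AddCommMonoid A] {n : ℕ} (T : Equiv.Perm (Fin (n + 2)) → A) :
    ∑ i, ∑ j', T (front₂ i j') = ∑ i : Fin (n + 2), ∑ j' : Fin (n + 1),
      if i < i.succAbove j' then T (front₂ i j') + T (front₂ i j' * Equiv.swap 0 1) else 0 := by
  have hinv : Function.Involutive fun x : Fin (n + 2) × Fin (n + 1) =>
      (x.1.succAbove x.2, x.2.predAbove x.1) := fun x => by
    ext : 1
    · exact Fin.succAbove_succAbove_predAbove _ _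
    · exact Fin.predAbove_predAbove_succAbove _ _
  let φ : Equiv.Perm (Fin (n + 2) × Fin (n + 1)) := hinv.toPerm
  have hφ : ∀ x : Fin (n + 2) × Fin (n + 1), φ x = (x.1.succAbove x.2, x.2.predAbove x.1) :=
    fun x => rfl
  rw [← Fintype.sum_prod_type', ← Fintype.sum_prod_type']
  have h1 : ∀ x : Fin (n + 2) × Fin (n + 1), T (front₂ x.1 x.2) =
      (if x.1 < x.1.succAbove x.2 then T (front₂ x.1 x.2) else 0) +
        if x.1 < x.1.succAbove x.2 then 0 else T (front₂ x.1 x.2) := fun x => by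
    split_ifs <;> simp
  have h2 : ∑ x : Fin (n + 2) × Fin (n + 1),
      (if x.1 < x.1.succAbove x.2 then 0 else T (front₂ x.1 x.2)) =
      ∑ x : Fin (n + 2) × Fin (n + 1),
        if x.1 < x.1.succAbove x.2 then T (front₂ x.1 x.2 * Equiv.swap 0 1) else 0 := by
    rw [← Equiv.sum_comp φ]
    refine Finset.sum_congr rfl fun x _ => ?_
    rw [hφ, Fin.succAbove_succAbove_predAbove, front₂_mul_swap]
    have hne : x.1.succAbove x.2 ≠ x.1 := Fin.succAbove_ne _ _
    by_cases hlt : x.1 < x.1.succAbove x.2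
    · rw [if_pos hlt, if_neg (not_lt.mpr hlt.le)]
    · rw [if_neg hlt, if_pos (lt_of_le_of_ne (not_lt.mp hlt) hne)]
  rw [Finset.sum_congr rfl fun x _ => h1 x, Finset.sum_add_distrib, h2, ← Finset.sum_add_distrib]
  refine Finset.sum_congr rfl fun x _ => ?_
  split_ifs <;> simp

theorem back_last {n : ℕ} (i : Fin (n + 1)) : back i (Fin.last n) = i := by
  simp [back]

theorem back_castSucc {n : ℕ} (i : Fin (n + 1)) (s : Fin n) : back i s.castSucc = i.succAbove s := by
  have h : finSuccEquiv' (Fin.last n) s.castSucc = some s := by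
    have := finSuccEquiv'_succAbove (Fin.last n) s
    rwa [Fin.succAbove_last] at this
  rw [back, Equiv.trans_apply, h, finSuccEquiv'_symm_some]

theorem back_eq {n : ℕ} (i : Fin (n + 1)) : back i = front i * finRotate (n + 1) := by
  ext s : 1
  rw [Equiv.Perm.mul_apply]
  refine Fin.lastCases ?_ (fun s => ?_) s
  · rw [back_last, finRotate_last, front_zero]
  · rw [back_castSucc, finRotate_apply, Fin.coeSucc_eq_succ, front_succ]

/-- Conjugation by the rotation carries the stabiliser of 0 to that of the last position, so the
decomposition for the first position can be reused. -/
theorem sum_perm_succ_back {A : Type*} [AddCommMonoid A] {n : ℕ}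
    (T : Equiv.Perm (Fin (n + 1)) → A)
    (h : ∀ σ π, π (Fin.last n) = Fin.last n → T (σ * π) = T σ) :
    ∑ σ, T σ = n.factorial • ∑ i, T (back i) := by
  rw [← Equiv.sum_comp (Equiv.mulRight (finRotate (n + 1))), sum_perm_succ, Finset.smul_sum]
  refine Finset.sum_congr rfl fun i _ => ?_
  rw [Finset.sum_congr rfl fun τ _ => (?_ : _ = T (back i)), Finset.sum_const, Finset.card_univ,
    Fintype.card_perm, Fintype.card_fin]
  have e : front i * shiftPerm τ * finRotate (n + 1) =
      back i * ((finRotate (n + 1))⁻¹ * shiftPerm τ * finRotate (n + 1)) := by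
    rw [back_eq]; group
  refine (congrArg T e).trans (h _ _ ?_)
  rw [Equiv.Perm.mul_apply, Equiv.Perm.mul_apply, finRotate_last, shiftPerm_zero,
    Equiv.Perm.inv_eq_iff_eq, finRotate_last]

variable {k H : Type*} [Field k] [Ring H] [Bialgebra k H] [Coalgebra.IsCocomm k H]
variable {X N : Type*}
variable [AddCommGroup N] [Module k N] [Module H N]

theorem sgn_front {n : ℕ} (i : Fin (n + 1)) : sgn k (front i) = (-1) ^ (i : ℕ) := by
  rw [front_eq, ← sgn_cycleRange (k := k) i, ← sgn_inv]
  rfl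

theorem sgn_front₂ {n : ℕ} (i : Fin (n + 2)) (j' : Fin (n + 1)) :
    sgn k (front₂ i j') = (-1) ^ (i + j' : ℕ) := by
  rw [front₂_eq, sgn_mul, sgn_shiftPerm, sgn_front, sgn_front, pow_add]

theorem sgn_back {n : ℕ} (i : Fin (n + 1)) : sgn k (back i) = (-1) ^ (i + n : ℕ) := by
  rw [back_eq, sgn_mul, sgn_front, pow_add]
  simp [sgn]

/-- Skewness in all arguments but the first makes the summands constant on cosets of the stabiliser
of 0, each of size `n!`. -/
theorem alt_front {n : ℕ} (h : 1 + n = n + 1) {E : (Fin (1 + n) → X) → PT k H N (1 + n)}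
    (hE : ∀ τ : Equiv.Perm (Fin n), SkewUnder E (blockEquiv (Equiv.refl (Fin 1)) τ))
    (u : Fin (n + 1) → X) :
    alt h E u = (n.factorial : k) • ∑ i, altTerm h E u (front i) := by
  rw [alt, sum_perm_succ, Finset.smul_sum]
  refine Finset.sum_congr rfl fun i _ => ?_
  rw [Finset.sum_congr rfl fun τ _ => (?_ : _ = altTerm h E u (front i)), Finset.sum_const,
    Finset.card_univ, Fintype.card_perm, Fintype.card_fin, Nat.cast_smul_eq_nsmul]
  refine altTerm_mul h (.of_right hE fun s hs => ?_) u _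
  have : s = ⟨0, by omega⟩ := Fin.ext (by simpa using hs)
  rw [this]
  ext
  simp [Equiv.permCongr_apply]

theorem alt_front₂ {n : ℕ} (h : 2 + n = n + 2) {E : (Fin (2 + n) → X) → PT k H N (2 + n)}
    (hE : ∀ τ : Equiv.Perm (Fin n), SkewUnder E (blockEquiv (Equiv.refl (Fin 2)) τ))
    (u : Fin (n + 2) → X) :
    alt h E u = (n.factorial : k) • ∑ i, ∑ j', altTerm h E u (front₂ i j') := by
  rw [alt, sum_perm_succ, Finset.smul_sum]
  refine Finset.sum_congr rfl fun i _ => ?_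
  rw [sum_perm_succ, Finset.smul_sum]
  refine Finset.sum_congr rfl fun j _ => ?_
  rw [Finset.sum_congr rfl fun τ _ => (?_ : _ = altTerm h E u (front₂ i j)), Finset.sum_const,
    Finset.card_univ, Fintype.card_perm, Fintype.card_fin, Nat.cast_smul_eq_nsmul]
  have e : front i * shiftPerm (front j * shiftPerm τ) =
      front₂ i j * shiftPerm (shiftPerm τ) := by
    rw [front₂_eq, mul_assoc]
    congr 1
    ext s : 1
    cases s using Fin.cases <;> simp
  rw [e]
  refine altTerm_mul h (.of_right hE fun s hs => ?_) u _
  apply (finCongr h).injective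
  have h2 : finCongr h s = 0 ∨ finCongr h s = Fin.succ 0 := by
    have h0 : ((0 : Fin (n + 1)) : ℕ) = 0 := rfl
    have h0' : ((0 : Fin (n + 2)) : ℕ) = 0 := rfl
    rw [Fin.ext_iff, Fin.ext_iff, Fin.val_succ, h0, h0', finCongr_apply, Fin.val_cast]
    omega
  rw [Equiv.permCongr_apply, Equiv.symm_symm, Equiv.apply_symm_apply]
  rcases h2 with h2 | h2 <;> rw [h2]
  · rw [shiftPerm_zero]
  · rw [shiftPerm_succ, shiftPerm_zero]

theorem alt_back {n : ℕ} {E : (Fin (n + 1) → X) → PT k H N (n + 1)}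
    (hE : ∀ τ : Equiv.Perm (Fin n), SkewUnder E (blockEquiv τ (Equiv.refl (Fin 1))))
    (u : Fin (n + 1) → X) :
    alt rfl E u = (n.factorial : k) • ∑ i, altTerm rfl E u (back i) := by
  rw [alt, sum_perm_succ_back, Nat.cast_smul_eq_nsmul]
  intro σ π hπ
  refine altTerm_mul rfl (.of_left (n := 1) hE fun s hs => ?_) u _
  have : s = Fin.last n := Fin.ext (by simp; omega)
  rw [this]
  exact hπ

end Sums

/-! ### The explicit formula for the differential -/

section Formulas

variable {k H : Type*} [Field k] [Ring H] [Bialgebra k H] [Coalgebra.IsCocomm k H]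
variable {𝔤 𝔥 : Type*} [AddCommGroup 𝔤] [Module k 𝔤] [Module H 𝔤]
variable [AddCommGroup 𝔥] [Module k 𝔥] [Module H 𝔥]

theorem alt_compL_unit {Y Z : Type*} [AddCommGroup Y] [Module k Y] [Module H Y]
    [AddCommGroup Z] [Module k Z] [Module H Z] (B : Pseudoproduct k H Y 𝔤 Z) (S : 𝔥 → Y) {n : ℕ}
    (f : Cochain k H 𝔥 𝔤 n) (h : 1 + n = n + 1) (u : Fin (n + 1) → 𝔥) :
    alt h (fun v => B.compL (PT.unit (S (v (Fin.castAdd n 0)))) (f fun s => v (Fin.natAdd 1 s))) u =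
      (n.factorial : k) • ∑ i : Fin (n + 1), (-1 : k) ^ (i : ℕ) • PT.perm h (front i)
        (B.comp (PT.unit (S (u i))) (f fun s => u (i.succAbove s))) := by
  rw [alt_front h fun τ v => ?_]
  · congr 1
    refine Finset.sum_congr rfl fun i _ => ?_
    rw [altTerm, sgn_front]
    have e0 : front i (Fin.cast h (Fin.castAdd n 0)) = i := front_zero i
    have es : ∀ s, front i (Fin.cast h (Fin.natAdd 1 s)) = i.succAbove s := fun s => by
      rw [← front_succ]
      congr 1
      ext
      simp
    simp only [e0, es]
    rfl
  · rw [cochain_skew f τ, map_smul, B.compL_rx_right, sgn_blockEquiv]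
    simp only [blockEquiv_castAdd, blockEquiv_natAdd, Equiv.refl_apply]
    rw [show sgn k (Equiv.refl (Fin 1)) = 1 from sgn_one, one_mul]

namespace MatchedPair

theorem pairNest_skew (K : 𝔥 → 𝔥 → PT k H 𝔥 2) {n : ℕ} (f : Cochain k H 𝔥 𝔤 (n + 1))
    (τ : Equiv.Perm (Fin n)) : SkewUnder (pairNest K f) (blockEquiv (Equiv.refl (Fin 2)) τ) := by
  intro v
  rw [pairNest, ins_skew f τ, sgn_blockEquiv, show sgn k (Equiv.refl (Fin 2)) = 1 from sgn_one,
    one_mul, pairNest]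
  simp only [blockEquiv_castAdd, blockEquiv_natAdd, Equiv.refl_apply]

theorem pairNest_swap (K : 𝔥 → 𝔥 → PT k H 𝔥 2) {n : ℕ} (f : Cochain k H 𝔥 𝔤 (n + 1))
    (v : Fin (2 + n) → 𝔥) :
    PT.rx (blockEquiv (Equiv.swap (0 : Fin 2) 1) (Equiv.refl (Fin n)))
      (pairNest K f fun s => v (blockEquiv (Equiv.swap (0 : Fin 2) 1) (Equiv.refl (Fin n)) s)) =
    pairNest (fun x y => PT.rx (Equiv.swap 0 1) (K y x)) f v := by
  rw [pairNest, pairNest, ins_rx]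
  simp only [blockEquiv_castAdd, blockEquiv_natAdd, Equiv.refl_apply, Equiv.swap_apply_left,
    Equiv.swap_apply_right]

theorem altTerm_pairNest_swap (K : 𝔥 → 𝔥 → PT k H 𝔥 2) {n : ℕ} (f : Cochain k H 𝔥 𝔤 (n + 1))
    (h : 2 + n = n + 2) (u : Fin (n + 2) → 𝔥) (σ : Equiv.Perm (Fin (n + 2))) :
    altTerm h (pairNest K f) u (σ * Equiv.swap 0 1) =
      -altTerm h (pairNest (fun x y => PT.rx (Equiv.swap 0 1) (K y x)) f) u σ := by
  have e : ∀ s : Fin (2 + n), Fin.cast h (blockEquiv (Equiv.swap (0 : Fin 2) 1)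
      (Equiv.refl (Fin n)) s) = Equiv.swap 0 1 (Fin.cast h s) := by
    intro s
    induction s using Fin.addCases with
    | left s =>
      rw [blockEquiv_castAdd]
      fin_cases s
      · exact (Equiv.swap_apply_left (0 : Fin (n + 2)) 1).symm
      · exact (Equiv.swap_apply_right (0 : Fin (n + 2)) 1).symm
    | right s =>
      rw [blockEquiv_natAdd, Equiv.refl_apply, Equiv.swap_apply_of_ne_of_ne]
      · simp [Fin.ext_iff]
      · simp [Fin.ext_iff]
  rw [altTerm, altTerm, ← pairNest_swap, PT.rx_rx, sgn_mul]
  have e1 : sgn k (Equiv.swap (0 : Fin (n + 2)) 1) = -1 := by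
    rw [sgn, Equiv.Perm.sign_swap (by simp)]; simp
  rw [e1, mul_neg_one, neg_smul]
  have e2 : (finCongr h).trans (σ * Equiv.swap 0 1) =
      (blockEquiv (Equiv.swap (0 : Fin 2) 1) (Equiv.refl (Fin n))).trans ((finCongr h).trans σ) :=
    Equiv.ext fun s => congrArg σ (e s).symm
  have e3 : (fun s => u ((σ * Equiv.swap 0 1 : Equiv.Perm (Fin (n + 2))) (Fin.cast h s))) = fun s => u (σ (Fin.cast h
      (blockEquiv (Equiv.swap (0 : Fin 2) 1) (Equiv.refl (Fin n)) s))) :=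
    funext fun s => congrArg (fun t => u (σ t)) (e s).symm
  rw [e2, e3]

theorem pairNest_sub (K K' : 𝔥 → 𝔥 → PT k H 𝔥 2) {n : ℕ} (f : Cochain k H 𝔥 𝔤 (n + 1))
    (v : Fin (2 + n) → 𝔥) :
    pairNest (fun x y => K x y - K' x y) f v = pairNest K f v - pairNest K' f v :=
  map_sub (ins f _) _ _

/-- No symmetry of `K` is assumed, so combining the two orders of each pair antisymmetrises it. This
is the source of ρ(T(u), v) - (12) ρ(T(v), u) in the twisted differential. -/
theorem alt_pairNest (K : 𝔥 → 𝔥 → PT k H 𝔥 2) {n : ℕ} (f : Cochain k H 𝔥 𝔤 (n + 1))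
    (h : 2 + n = n + 2) (u : Fin (n + 2) → 𝔥) :
    alt h (pairNest K f) u = (-((n.factorial : k) * (-1) ^ n)) •
      pairSum (fun x y => K x y - PT.rx (Equiv.swap 0 1) (K y x)) f u := by
  rw [alt_front₂ h (pairNest_skew K f), sum_front₂, pairSum, neg_smul, ← smul_neg, mul_smul]
  congr 1
  rw [← Finset.sum_neg_distrib, Finset.smul_sum]
  refine Finset.sum_congr rfl fun i _ => ?_
  rw [← Finset.sum_neg_distrib, Finset.smul_sum]
  refine Finset.sum_congr rfl fun j _ => ?_
  split_ifs with hlt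
  -- For an increasing pair the true second index is `j + 1`; this offset enters the comparison of
  -- signs with `pairSum`.
  · have hj : ((i.succAbove j : Fin (n + 2)) : ℕ) = j + 1 := by
      rw [Fin.succAbove_of_le_castSucc _ _ (not_lt.mp fun hc => ?_), Fin.val_succ]
      rw [Fin.succAbove_of_castSucc_lt _ _ hc] at hlt
      exact absurd hc (not_lt.mpr hlt.le)
    have e0 : front₂ i j (Fin.cast h (Fin.castAdd n 0)) = i := front₂_zero i j
    have e1 : front₂ i j (Fin.cast h (Fin.castAdd n 1)) = i.succAbove j := front₂_one i j
    have es : ∀ s, front₂ i j (Fin.cast h (Fin.natAdd 2 s)) = i.succAbove (j.succAbove s) :=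
      fun s => by
        rw [← front₂_succ_succ]
        congr 1
        ext
        simp only [Fin.val_cast, Fin.val_natAdd, Fin.val_succ]
        omega
    rw [altTerm_pairNest_swap, ← sub_eq_add_neg, altTerm, altTerm, ← smul_sub, ← map_sub,
      ← pairNest_sub, pairNest, sgn_front₂, hj, ← smul_neg, smul_smul, e0, e1]
    simp only [es]
    rw [smul_neg, ← neg_smul]
    congr 1
    rw [show n + 1 + ((i : ℕ) + 1) + ((j : ℕ) + 1 + 1) - 1 = n + (i + j) + 2 + 1 by omega]
    simp only [pow_add, even_two, Even.neg_pow, one_pow, mul_one, pow_one]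
    rw [← mul_assoc, ← mul_assoc, neg_one_pow_mul_self]
    ring
  · rw [neg_zero, smul_zero]

theorem pairSum_two_smul (K : 𝔥 → 𝔥 → PT k H 𝔥 2) {n : ℕ} (f : Cochain k H 𝔥 𝔤 (n + 1))
    (u : Fin (n + 2) → 𝔥) :
    pairSum (fun x y => (2 : k) • K x y) f u = (2 : k) • pairSum K f u := by
  rw [pairSum, pairSum, Finset.smul_sum]
  refine Finset.sum_congr rfl fun i _ => ?_
  rw [Finset.smul_sum]
  refine Finset.sum_congr rfl fun j _ => ?_
  rw [smul_ite, smul_zero, smul_comm (2 : k)]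
  simp only [insert_eq, PT.perm_eq, map_smul]

variable {𝓰 : LiePseudoalgebra k H 𝔤} {𝓱 : LiePseudoalgebra k H 𝔥} (P : MatchedPair 𝓰 𝓱)

theorem alt_etaLast {p : ℕ} (f : Cochain k H 𝔥 𝔤 (p + 1)) (u : Fin (p + 1 + 1) → 𝔥) :
    alt rfl (P.etaLast f) u = ((-1) ^ (p + 1) * ((p + 1).factorial : k)) •
      ∑ i : Fin (p + 2), (-1 : k) ^ (i : ℕ) • PT.perm (by omega) (front i)
        (P.η.comp (PT.unit (u i)) (f fun s => u (i.succAbove s))) := by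
  have e : P.etaLast f = fun v => PT.rx (finAddFlip (m := 1) (n := p + 1))
      ((fun w : Fin (1 + (p + 1)) → 𝔥 => P.η.compL (PT.unit (w (Fin.castAdd (p + 1) 0)))
        (f fun s => w (Fin.natAdd 1 s))) fun s => v (finAddFlip s)) := by
    funext v
    simp only [etaLast, finAddFlip_apply_castAdd, finAddFlip_apply_natAdd]
  rw [e]
  refine (alt_equiv rfl (by omega) (fun w : Fin (1 + (p + 1)) → 𝔥 =>
    P.η.compL (PT.unit (w (Fin.castAdd (p + 1) 0))) (f fun s => w (Fin.natAdd 1 s)))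
    finAddFlip u).trans ?_
  rw [mul_smul, ← alt_compL_unit P.η (fun v : 𝔥 => v) f (by omega) u]
  congr 1
  rw [sgn, sign_flip]
  simp

theorem rhoNest_left {a b : ℕ} (f : Cochain k H 𝔥 𝔤 (a + 1)) (g : Cochain k H 𝔥 𝔤 (b + 1))
    (τ : Equiv.Perm (Fin (b + 1))) : SkewUnder (P.rhoNest f g)
      (blockEquiv (blockEquiv τ (Equiv.refl (Fin 1))) (Equiv.refl (Fin a))) := by
  intro v
  rw [rhoNest, cochain_skew g τ, map_smul, LinearMap.smul_apply, map_smul,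
    Pseudoproduct.compL_rx_left, ins_rx, sgn_blockEquiv, sgn_blockEquiv, rhoNest,
    show sgn k (Equiv.refl (Fin 1)) = 1 from sgn_one,
    show sgn k (Equiv.refl (Fin a)) = 1 from sgn_one, mul_one, mul_one]
  simp only [blockEquiv_castAdd, blockEquiv_natAdd, Equiv.refl_apply]

theorem rhoNest_right {a b : ℕ} (f : Cochain k H 𝔥 𝔤 (a + 1)) (g : Cochain k H 𝔥 𝔤 (b + 1))
    (τ : Equiv.Perm (Fin a)) : SkewUnder (P.rhoNest f g)
      (blockEquiv (Equiv.refl (Fin (b + 1 + 1))) τ) := by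
  intro v
  rw [rhoNest, ins_skew f τ, sgn_blockEquiv, rhoNest,
    show sgn k (Equiv.refl (Fin (b + 1 + 1))) = 1 from sgn_one, one_mul]
  simp only [blockEquiv_castAdd, blockEquiv_natAdd, Equiv.refl_apply]

theorem bracketNest_skew {a b : ℕ} (f : Cochain k H 𝔥 𝔤 (a + 1)) (g : Cochain k H 𝔥 𝔤 (b + 1))
    (τ : Equiv.Perm (Fin (a + 1))) (τ' : Equiv.Perm (Fin (b + 1))) :
    SkewUnder (bracketNest 𝓰 f g) (blockEquiv τ τ') := by
  intro v
  rw [bracketNest, cochain_skew f τ, cochain_skew g τ', map_smul, map_smul, LinearMap.smul_apply,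
    Pseudoproduct.compL_rx, sgn_blockEquiv, bracketNest, smul_smul, mul_comm (sgn k τ')]
  simp only [blockEquiv_castAdd, blockEquiv_natAdd]

variable [IsScalarTower k H 𝔤] [IsScalarTower k H 𝔥]

/-- The sum over one argument comes from composing Y with `f`, the sum over pairs from composing `f`
with Y. The factorials of the normalisation cancel the sizes of the cosets. -/
theorem differential_formula [CharZero k] {p : ℕ} (f : CochainSpace k H 𝔤 𝔥 p)
    (u : Fin (p + 2) → 𝔥) : (P.differential p f) u = P.dFormula f u := by
  have h1 : castL (add_comm 1 p) (unhat (circ P.forgetLeft.structureCochain (hat f))) u =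
      ∑ i : Fin (p + 2), (-1 : k) ^ ((p + 1) + ((i : ℕ) + 1)) •
        PT.perm (by omega) (front i)
          (P.η.comp (PT.unit (u i)) (f fun s => u (i.succAbove s))) := by
    rw [castL_eq, castC_apply, unhat_eq (P.circ_forgetLeft_hat f), etaTerm, map_smul, rx_cast_alt,
      alt_etaLast, smul_smul, Finset.smul_sum]
    refine Finset.sum_congr rfl fun i _ => ?_
    rw [smul_smul]
    congr 1
    rw [wt, Nat.factorial_one, mul_one]
    have : ((p + 1).factorial : k) ≠ 0 := Nat.cast_ne_zero.mpr (Nat.factorial_ne_zero _)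
    field_simp
    ring
  have h2 : unhat (circ (hat f) P.forgetLeft.structureCochain) u =
      (-(-1 : k) ^ p) • pairSum (fun v w => 𝓱.bracket v w) f u := by
    -- The bracket of 𝔥 is already skew, so antisymmetrising doubles it; the 2 cancels against the
    -- factor `2!` in the weight.
    have hs : ∀ x y, 𝓱.bracket x y - PT.rx (Equiv.swap 0 1) (𝓱.bracket y x) =
        (2 : k) • 𝓱.bracket x y := fun x y => by
      have := 𝓱.skew x y
      rw [PT.reindex_eq] at this
      rw [two_smul]
      nth_rewrite 3 [this]
      rw [sub_eq_add_neg]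
    rw [unhat_eq (P.circ_hat_forgetLeft f), pairTerm, alt_pairNest _ f (by omega) u, smul_smul]
    simp only [hs]
    rw [pairSum_two_smul, smul_smul, wt]
    congr 1
    have : (p.factorial : k) ≠ 0 := Nat.cast_ne_zero.mpr (Nat.factorial_ne_zero _)
    rw [Nat.factorial_two]
    push_cast
    field_simp
  rw [differential_apply, dFormula]
  change castL (add_comm 1 p) (unhat (circ P.forgetLeft.structureCochain (hat f))) u -
    (-1 : k) ^ p • (unhat (circ (hat f) P.forgetLeft.structureCochain) u) = _
  rw [h1, h2, smul_smul, mul_neg, neg_one_pow_mul_self, neg_smul, one_smul, sub_neg_eq_add]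

end MatchedPair

end Formulas

/-! ### The explicit formula for the bracket -/

section Formulas

variable {k H : Type*} [Field k] [Ring H] [Bialgebra k H] [Coalgebra.IsCocomm k H]
variable {𝔤 𝔥 : Type*} [AddCommGroup 𝔤] [Module k 𝔤] [Module H 𝔤]
variable [AddCommGroup 𝔥] [Module k 𝔥] [Module H 𝔥]

namespace MatchedPair

variable {𝓰 : LiePseudoalgebra k H 𝔤} {𝓱 : LiePseudoalgebra k H 𝔥} (P : MatchedPair 𝓰 𝓱)

theorem rhoNest_skewUnder {a b : ℕ} (f : Cochain k H 𝔥 𝔤 (a + 1)) (g : Cochain k H 𝔥 𝔤 (b + 1))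
    {π : Equiv.Perm (Fin (b + 1 + 1 + a))} (hπ : ∀ s : Fin (b + 1 + 1 + a), b + 1 ≤ (s : ℕ) → π s = s) :
    SkewUnder (P.rhoNest f g) π := by
  refine SkewUnder.of_block (fun s : Fin (b + 1) => Fin.castAdd a (Fin.castAdd 1 s))
    ((Fin.castAdd_injective _ a).comp (Fin.castAdd_injective _ 1))
    (fun τ => blockEquiv (blockEquiv τ (Equiv.refl _)) (Equiv.refl _)) (by simp)
    (fun τ s hs => ?_) (P.rhoNest_left f g) fun s hs => hπ s ?_
  · induction s using Fin.addCases with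
    | right s => simp
    | left s =>
      induction s using Fin.addCases with
      | left s => exact absurd rfl (hs s)
      | right s => simp
  · by_contra hc
    exact hs ⟨s, by omega⟩ rfl

/-- The argument on which ρ acts belongs to neither skew block, which is why position `b + 1` is
free in these unshuffles. -/
theorem alt_rhoNest {a b n : ℕ} (f : Cochain k H 𝔥 𝔤 (a + 1)) (g : Cochain k H 𝔥 𝔤 (b + 1))
    (h : b + 1 + 1 + a = n) (u : Fin n → 𝔥) :
    alt h (P.rhoNest f g) u = (((b + 1).factorial * a.factorial : ℕ) : k) •
      ∑ σ ∈ unshuffles n (b + 1) (b + 2), sgn k σ • PT.perm h σ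
        (Cochain.insert f
          (P.ρ.comp (g fun s : Fin (b + 1) => u (σ ⟨s, by omega⟩))
            (PT.unit (u (σ ⟨b + 1, by omega⟩))))
          fun s : Fin a => u (σ ⟨b + 2 + s, by omega⟩)) := by
  rw [alt_eq_sum_unshuffles (a := b + 1) (b := b + 2) h (by omega) (by omega)
    (fun π hπ => P.rhoNest_skewUnder f g hπ)
    (fun π hπ => .of_right (P.rhoNest_right f g) hπ), show n - (b + 2) = a by omega]
  rfl

theorem alt_bracketNest {a b n : ℕ} (f : Cochain k H 𝔥 𝔤 (a + 1)) (g : Cochain k H 𝔥 𝔤 (b + 1))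
    (h : a + 1 + (b + 1) = n) (u : Fin n → 𝔥) :
    alt h (bracketNest 𝓰 f g) u = (((a + 1).factorial * (b + 1).factorial : ℕ) : k) •
      ∑ σ ∈ unshuffles n (a + 1) (a + 1), sgn k σ • PT.perm h σ
        (𝓰.bracket.comp
          (f fun s : Fin (a + 1) => u (σ ⟨s, by omega⟩))
          (g fun s : Fin (b + 1) => u (σ ⟨a + 1 + s, by omega⟩))) := by
  rw [alt_eq_sum_unshuffles (a := a + 1) (b := a + 1) h le_rfl (by omega)
    (fun π hπ => .of_left (fun τ => bracketNest_skew f g τ (Equiv.refl _)) hπ)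
    (fun π hπ => .of_right (fun τ => bracketNest_skew f g (Equiv.refl _) τ) hπ),
    show n - (a + 1) = b + 1 by omega]
  rfl

variable [IsScalarTower k H 𝔤] [IsScalarTower k H 𝔥] [CharZero k]

theorem castL_circ_hat_circ_apply {a b n : ℕ} (f : Cochain k H 𝔥 𝔤 (a + 1))
    (g : Cochain k H 𝔥 𝔤 (b + 1)) (h : a + (1 + b) = n) (u : Fin (n + 1) → 𝔥) :
    castL h (unhat (circ (hat f) (circ P.forgetRight.structureCochain (hat g)))) u =
      ((a.factorial * (b + 1).factorial : ℕ) : k)⁻¹ • alt (by omega) (P.rhoNest f g) u := by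
  -- `forgetRight` keeps ρ and the bracket of 𝔤, so its terms agree with those of `P` by definition.
  rw [castL_eq, castC_apply, unhat_eq (P.forgetRight.circ_hat_circ_total f g), rhoTerm, map_smul,
    rx_cast_alt, Nat.factorial_one, mul_one]
  rfl

theorem castL_circ_circ_hat_apply {a b n : ℕ} (f : Cochain k H 𝔥 𝔤 (a + 1))
    (g : Cochain k H 𝔥 𝔤 (b + 1)) (h : 1 + a + b = n) (u : Fin (n + 1) → 𝔥) :
    (-1 : k) ^ a • castL h (unhat (circ (circ P.forgetRight.structureCochain (hat f)) (hat g))) u =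
      (-((-1) ^ ((a + 1) * (b + 1)) * (((a + 1).factorial * (b + 1).factorial : ℕ) : k)⁻¹)) •
        alt (by omega) (bracketNest 𝓰 f g) u := by
  rw [castL_eq, castC_apply, unhat_eq (P.forgetRight.circ_circ_total_hat f g), bracketTerm,
    map_smul, rx_cast_alt, smul_smul]
  congr 1
  rw [mul_neg, mul_assoc, ← mul_assoc, neg_one_pow_mul_self, one_mul]

theorem bracket_apply_eq {p q : ℕ} (f : CochainSpace k H 𝔤 𝔥 p) (g : CochainSpace k H 𝔤 𝔥 q)
    (u : Fin (p + q + 2) → 𝔥) : (P.bracket p q f g) u =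
    -(((p.factorial * (q + 1).factorial : ℕ) : k)⁻¹ • alt (by omega) (P.rhoNest f g) u) +
      (-1 : k) ^ ((p + 1) * (q + 1)) •
        (((q.factorial * (p + 1).factorial : ℕ) : k)⁻¹ • alt (by omega) (P.rhoNest g f) u) +
      (-((-1) ^ ((p + 1) * (q + 1)) * (((p + 1).factorial * (q + 1).factorial : ℕ) : k)⁻¹)) •
        alt (by omega) (bracketNest 𝓰 f g) u := by
  have h1 := P.castL_circ_hat_circ_apply f g (by omega : p + (1 + q) = p + q + 1) u
  have h2 := P.castL_circ_hat_circ_apply g f (by omega : q + (1 + p) = p + q + 1) u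
  have h3 := P.castL_circ_circ_hat_apply f g (by omega : 1 + p + q = p + q + 1) u
  rw [← h1, ← h2, ← h3]
  rfl

theorem bracket_formula {p q : ℕ} (f : CochainSpace k H 𝔤 𝔥 p) (g : CochainSpace k H 𝔤 𝔥 q)
    (u : Fin (p + q + 2) → 𝔥) : (P.bracket p q f g) u = P.bracketFormula f g u := by
  have hf : ∀ m n : ℕ, ((m.factorial * n.factorial : ℕ) : k) ≠ 0 := fun m n =>
    Nat.cast_ne_zero.mpr (Nat.mul_ne_zero (Nat.factorial_ne_zero _) (Nat.factorial_ne_zero _))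
  rw [bracket_apply_eq, alt_rhoNest, alt_rhoNest, alt_bracketNest, mul_comm (q + 1).factorial,
    mul_comm (p + 1).factorial q.factorial, inv_smul_smul₀ (hf _ _), inv_smul_smul₀ (hf _ _),
    neg_smul, mul_smul, inv_smul_smul₀ (hf _ _), ← sub_eq_add_neg]
  rfl

end MatchedPair

end Formulas

/-! ### The explicit formula for the twisted differential -/

section Twist

variable {k H : Type*} [Field k] [Ring H] [Bialgebra k H] [Coalgebra.IsCocomm k H]
variable {𝔤 𝔥 : Type*} [AddCommGroup 𝔤] [Module k 𝔤] [Module H 𝔤]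
variable [AddCommGroup 𝔥] [Module k 𝔥] [Module H 𝔥]
variable [IsScalarTower k H 𝔤] [IsScalarTower k H 𝔥]

theorem ins_ofHom (T : 𝔥 →ₗ[H] 𝔤) {m : ℕ} (v : Fin 0 → 𝔥) (F : PT k H 𝔥 m) :
    ins (n := 0) (Cochain.ofHom T) v F = PT.mp T F := by
  induction F using PT.induction with
  | zero => simp only [map_zero]
  | mk x w =>
    rw [ins_mk, PT.mp_mk]
    change PT.spr _ _ (PT.mk 1 (T w)) = _
    rw [PT.spr_mk, map_one, mul_one]
    congr 1
    exact (fibre_symm_eq_place (Equiv.refl _) x).symm.trans (fibre_id x)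
  | add s t hs ht => simp only [map_add, hs, ht]

theorem sum_neg_one_pow_smul {A : Type*} [AddCommGroup A] [Module k A] {n : ℕ} (m : ℕ)
    (t : Fin n → A) : ∑ i : Fin n, (-1 : k) ^ (i : ℕ) • t i =
      (-(-1 : k) ^ m) • ∑ i : Fin n, (-1 : k) ^ (m + ((i : ℕ) + 1)) • t i := by
  rw [Finset.smul_sum]
  refine Finset.sum_congr rfl fun i _ => ?_
  rw [smul_smul, pow_add, pow_succ, mul_neg_one, mul_neg, neg_mul_neg, ← mul_assoc,
    neg_one_pow_mul_self, one_mul]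

namespace MatchedPair

variable {𝓰 : LiePseudoalgebra k H 𝔤} {𝓱 : LiePseudoalgebra k H 𝔥} (P : MatchedPair 𝓰 𝓱)

/-- With T outside, no free arguments remain beyond the one on which ρ acts. That one is last, so
the cosets are represented by `back`. -/
theorem alt_rhoNest_ofHom_left (T : 𝔥 →ₗ[H] 𝔤) {p : ℕ} (f : Cochain k H 𝔥 𝔤 (p + 1))
    (h : p + 1 + 1 + 0 = p + 2) (u : Fin (p + 2) → 𝔥) :
    alt h (P.rhoNest (a := 0) (Cochain.ofHom T) f) u = ((p + 1).factorial : k) •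
      -∑ i : Fin (p + 2), (-1 : k) ^ ((p + 1) + ((i : ℕ) + 1)) • PT.perm rfl (back i)
        (PT.map T (P.ρ.comp (f fun s => u (i.succAbove s)) (PT.unit (u i)))) := by
  have e : P.rhoNest (a := 0) (Cochain.ofHom T) f = fun v : Fin (p + 1 + 1) → 𝔥 =>
      PT.mp T (P.ρ.compL (f fun s => v s.castSucc) (PT.unit (v (Fin.last (p + 1))))) :=
    funext fun v => ins_ofHom T _ _
  rw [e]
  refine (alt_back (fun τ v => ?_) u).trans ?_
  · rw [cochain_skew f τ, map_smul, LinearMap.smul_apply, map_smul, P.ρ.compL_rx_left, PT.mp_rx,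
      sgn_blockEquiv, show sgn k (Equiv.refl (Fin 1)) = 1 from sgn_one, mul_one]
    have e1 : ∀ s : Fin (p + 1), blockEquiv τ (Equiv.refl (Fin 1)) s.castSucc = (τ s).castSucc :=
      blockEquiv_castAdd τ (Equiv.refl (Fin 1))
    have e2 : blockEquiv τ (Equiv.refl (Fin 1)) (Fin.last (p + 1)) = Fin.last (p + 1) :=
      blockEquiv_natAdd τ (Equiv.refl (Fin 1)) 0
    simp only [e1, e2]
  · congr 1
    rw [← Finset.sum_neg_distrib]
    refine Finset.sum_congr rfl fun i _ => ?_
    have hs : sgn k (back i) = -(-1) ^ ((p + 1) + ((i : ℕ) + 1)) := by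
      rw [sgn_back]
      ring
    rw [altTerm, hs, neg_smul]
    have e0 : back i (Fin.cast rfl (Fin.last (p + 1))) = i := back_last i
    have es : ∀ s : Fin (p + 1), back i (Fin.cast rfl s.castSucc) = i.succAbove s :=
      fun s => back_castSucc i s
    simp only [e0, es]
    rfl

theorem alt_rhoNest_ofHom_right (T : 𝔥 →ₗ[H] 𝔤) {p : ℕ} (f : Cochain k H 𝔥 𝔤 (p + 1))
    (h : 0 + 1 + 1 + p = p + 2) (u : Fin (p + 2) → 𝔥) :
    alt h (P.rhoNest (b := 0) f (Cochain.ofHom T)) u = (-((p.factorial : k) * (-1) ^ p)) •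
      pairSum (fun v w => P.ρ (T v) w - PT.reindex (Equiv.swap 0 1) (P.ρ (T w) v)) f u := by
  have e : P.rhoNest (b := 0) f (Cochain.ofHom T) = pairNest (fun v w => P.ρ (T v) w) f :=
    funext fun v => congrArg (ins f _) (P.ρ.compL_unit _ _)
  exact (congrArg (fun E => alt _ E u) e).trans (alt_pairNest _ f (by omega) u)

theorem alt_bracketNest_ofHom (T : 𝔥 →ₗ[H] 𝔤) {p : ℕ} (f : Cochain k H 𝔥 𝔤 (p + 1))
    (h : 0 + 1 + (p + 1) = p + 2) (u : Fin (p + 2) → 𝔥) :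
    alt h (bracketNest (a := 0) 𝓰 (Cochain.ofHom T) f) u = ((p + 1).factorial : k) •
      (-(-1 : k) ^ (p + 1)) • ∑ i : Fin (p + 2), (-1 : k) ^ ((p + 1) + ((i : ℕ) + 1)) •
        PT.perm (by omega) (front i)
          (𝓰.bracket.comp (PT.unit (T (u i))) (f fun s => u (i.succAbove s))) := by
  rw [← sum_neg_one_pow_smul (p + 1)]
  exact alt_compL_unit 𝓰.bracket T f (by omega) u

theorem castL_bracket_apply [CharZero k] {p q n : ℕ} (f : CochainSpace k H 𝔤 𝔥 p) (g : CochainSpace k H 𝔤 𝔥 q)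
    (h : p + q + 1 = n) (u : Fin (n + 1) → 𝔥) : castL h (P.bracket p q f g) u =
    -(((p.factorial * (q + 1).factorial : ℕ) : k)⁻¹ • alt (by omega) (P.rhoNest f g) u) +
      (-1 : k) ^ ((p + 1) * (q + 1)) •
        (((q.factorial * (p + 1).factorial : ℕ) : k)⁻¹ • alt (by omega) (P.rhoNest g f) u) +
      (-((-1) ^ ((p + 1) * (q + 1)) * (((p + 1).factorial * (q + 1).factorial : ℕ) : k)⁻¹)) •
        alt (by omega) (bracketNest 𝓰 f g) u := by
  subst h
  exact P.bracket_apply_eq f g u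

/-- Besides the differential there are the three terms of the bracket with T: T applied outside ρ, T
inside ρ, and the bracket of 𝔤 with T. They give the last three sums in this order. -/
theorem twistedDifferential_formula [CharZero k] (T : 𝔥 →ₗ[H] 𝔤) {p : ℕ} (f : CochainSpace k H 𝔤 𝔥 p)
    (u : Fin (p + 2) → 𝔥) :
    (P.twistedDifferential (Cochain.ofHom T) p f) u = P.dTwistFormula T f u := by
  have hf : ∀ n : ℕ, (n.factorial : k) ≠ 0 := fun n =>
    Nat.cast_ne_zero.mpr (Nat.factorial_ne_zero _)
  have h1 := P.castL_bracket_apply (p := 0) (Cochain.ofHom T) f (by omega : 0 + p + 1 = p + 1) u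
  rw [P.alt_rhoNest_ofHom_left, P.alt_rhoNest_ofHom_right, alt_bracketNest_ofHom] at h1
  have h2 : (P.twistedDifferential (Cochain.ofHom T) p f) u = (P.differential p f) u +
    castL (by omega : 0 + p + 1 = p + 1) (P.bracket 0 p (Cochain.ofHom T) f) u := rfl
  rw [h2, h1, differential_formula, dFormula, dTwistFormula, ← add_assoc, ← add_assoc]
  refine congrArg₂ (· + ·) (congrArg₂ (· + ·) (congrArg₂ (· + ·) rfl ?_) ?_) ?_
  · rw [Nat.factorial_zero, one_mul, inv_smul_smul₀ (hf _), neg_neg]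
  · rw [zero_add, one_mul, Nat.factorial_one, mul_one, neg_smul, mul_smul, smul_neg,
      inv_smul_smul₀ (hf _), smul_neg, smul_smul, ← neg_smul, pow_succ, mul_neg_one, neg_mul,
      neg_neg, neg_one_pow_mul_self, one_smul]
  · have hc : -((-1 : k) ^ ((0 + 1) * (p + 1)) *
        (((0 + 1).factorial * (p + 1).factorial : ℕ) : k)⁻¹) =
        (-(-1) ^ (p + 1)) * ((p + 1).factorial : k)⁻¹ := by
      rw [zero_add, one_mul, Nat.factorial_one, one_mul, neg_mul]
    rw [hc, mul_smul, inv_smul_smul₀ (hf _), smul_smul, neg_mul_neg, neg_one_pow_mul_self,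
      one_smul]

end MatchedPair

end Twist

/-! ### Cochains of degree one as `H`-linear maps -/

section DegreeOne

variable {k H : Type*} [Field k] [Ring H] [Bialgebra k H]

variable (k H) in
/-- The isomorphism `H^{⊗1} → H`. -/
def HT.oneEquiv : HT k H 1 ≃ₗ[k] H := PiTensorProduct.subsingletonEquiv (0 : Fin 1)

theorem HT.oneEquiv_slot (a : H) : HT.oneEquiv k H (slot 0 a) = a :=
  (PiTensorProduct.subsingletonEquiv_apply_tprod (R := k) (s := fun _ : Fin 1 => H) (0 : Fin 1)
    (Pi.mulSingle (M := fun _ : Fin 1 => H) 0 a)).trans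
    (Pi.mulSingle_eq_same (M := fun _ : Fin 1 => H) 0 a)

theorem HT.slot_oneEquiv (x : HT k H 1) : slot 0 (HT.oneEquiv k H x) = x :=
  (HT.oneEquiv k H).injective (HT.oneEquiv_slot _)

theorem HT.oneEquiv_mul (x y : HT k H 1) :
    HT.oneEquiv k H (x * y) = HT.oneEquiv k H x * HT.oneEquiv k H y := by
  rw [← HT.slot_oneEquiv x, ← HT.slot_oneEquiv y, ← map_mul]
  simp only [HT.oneEquiv_slot]

variable [Coalgebra.IsCocomm k H]
variable {M : Type*} [AddCommGroup M] [Module k M] [Module H M] [IsScalarTower k H M]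

theorem iterCop_one (a : H) : iterCop (k := k) 1 a = slot 0 a := by
  rw [iterCop, ← cop_singleton]; rfl

/-- The isomorphism `H ⊗_H M → M`. -/
def PT.eval : PT k H M 1 →ₗ[k] M :=
  PT.lift (LinearMap.mk₂ k (fun x m => HT.oneEquiv k H x • m)
      (fun x y m => by rw [map_add, add_smul])
      (fun c x m => by rw [map_smul, smul_assoc])
      (fun x m m' => smul_add _ _ _)
      (fun c x m => smul_algebra_smul_comm c _ m))
    (fun x a m => by
      simp only [LinearMap.mk₂_apply]
      rw [HT.oneEquiv_mul, iterCop_one, HT.oneEquiv_slot, mul_smul])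

theorem PT.eval_mk (x : HT k H 1) (m : M) : PT.eval (PT.mk x m) =
    HT.oneEquiv k H x • m := PT.lift_mk _ _ _ _

theorem PT.eval_unit (m : M) : PT.eval (k := k) (H := H) (PT.unit m) = m := by
  rw [PT.unit, PT.eval_mk, ← map_one (slot (k := k) (H := H) (0 : Fin 1)), HT.oneEquiv_slot,
    one_smul]

theorem PT.unit_eval (t : PT k H M 1) : PT.unit (PT.eval t) = t := by
  induction t using PT.induction with
  | zero => rw [map_zero, PT.unit, PT.mk, TensorProduct.tmul_zero, map_zero]
  | mk x m => rw [PT.eval_mk, PT.unit, ← PT.mk_bal, iterCop_one, HT.slot_oneEquiv, one_mul]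
  | add s t hs ht => rw [map_add, PT.unit, PT.mk_add_right]; exact congrArg₂ (· + ·) hs ht

theorem PT.eval_act (a : H) (t : PT k H M 1) :
    PT.eval (PT.act (slot 0 a) t) = a • PT.eval t := by
  induction t using PT.induction with
  | zero => rw [PT.act_zero, map_zero, smul_zero]
  | mk x m => rw [PT.act_mk, PT.eval_mk, PT.eval_mk, HT.oneEquiv_mul, HT.oneEquiv_slot,
      mul_smul]
  | add s t hs ht => rw [PT.act_add, map_add, map_add, smul_add, hs, ht]

variable {𝔤 𝔥 : Type*} [AddCommGroup 𝔤] [Module k 𝔤] [Module H 𝔤] [IsScalarTower k H 𝔤]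
variable [AddCommGroup 𝔥] [Module k 𝔥] [Module H 𝔥] [IsScalarTower k H 𝔥]

theorem ofHom_injective :
    Function.Injective fun T : 𝔥 →ₗ[H] 𝔤 => Cochain.ofHom (k := k) T := fun S T h => by
  refine LinearMap.ext fun v => ?_
  have h1 : PT.unit (k := k) (S v) = PT.unit (T v) :=
    congrArg (fun f : Cochain k H 𝔥 𝔤 1 => f fun _ => v) h
  rw [← PT.eval_unit (k := k) (H := H) (S v), h1, PT.eval_unit]

/-- Evaluate the values of `f` through H ⊗_H 𝔤 ≅ 𝔤; the compatibility of `f` with the single slot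
becomes H-linearity. -/
theorem exists_ofHom (f : Cochain k H 𝔥 𝔤 1) : ∃ T : 𝔥 →ₗ[H] 𝔤, Cochain.ofHom T = f := by
  have hu : ∀ v : 𝔥, (fun _ : Fin 1 => v) = Function.update (fun _ : Fin 1 => (0 : 𝔥)) 0 v :=
    fun v => funext fun i => by rw [Subsingleton.elim i 0, Function.update_self]
  refine ⟨⟨⟨fun v => PT.eval (f fun _ => v), fun v w => ?_⟩, fun a v => ?_⟩, ?_⟩
  · rw [hu (v + w), f.1.map_update_add, map_add, ← hu, ← hu]
  · have h := f.2.1 (fun _ => v) 0 a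
    have e : Function.update (fun _ : Fin 1 => v) 0 (a • v) = fun _ => a • v :=
      funext fun i => by rw [Subsingleton.elim i 0, Function.update_self]
    rw [e] at h
    change PT.eval (f.1 fun _ => a • v) = a • PT.eval (f.1 fun _ => v)
    rw [h, PT.eval_act]
  · refine cochain_ext fun u => ?_
    have : u = fun _ => u 0 := funext fun i => by rw [Subsingleton.elim i 0]
    refine (PT.unit_eval _).trans ?_
    rw [← this]

theorem ofHom_add (S T : 𝔥 →ₗ[H] 𝔤) :
    Cochain.ofHom (k := k) (S + T) = Cochain.ofHom S + Cochain.ofHom T :=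
  cochain_ext fun _ => PT.mk_add_right _ _ _

/-- The bracket is symmetric in degree one, so the two cross terms agree and absorb the factor 1/2.
-/
theorem isMaurerCartan_add [CharZero k] {V : ℕ → Type*} [∀ n, AddCommGroup (V n)]
    [∀ n, Module k (V n)] {d : ∀ p, V p →ₗ[k] V (p + 1)}
    {br : ∀ p q, V p →ₗ[k] V q →ₗ[k] V (p + q + 1)} (h : IsDGLieAlgebra d br) {x : V 0}
    (hx : IsMaurerCartan d br x) (y : V 0) : IsMaurerCartan d br (x + y) ↔
      d 0 y + br 0 0 x y + (1 / 2 : k) • br 0 0 y y = 0 := by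
  have hs : br 0 0 y x = br 0 0 x y := by
    refine DirectSum.of_injective (β := V) (0 + 0 + 1) ?_
    rw [h.skew 0 0 y x]
    simp
  have hx' : d 0 x + (1 / 2 : k) • br 0 0 x x = 0 := hx
  have e : d 0 (x + y) + (1 / 2 : k) • br 0 0 (x + y) (x + y) =
      (d 0 x + (1 / 2 : k) • br 0 0 x x) +
        (d 0 y + br 0 0 x y + (1 / 2 : k) • br 0 0 y y) := by
    simp only [map_add, LinearMap.add_apply, hs, smul_add]
    module
  rw [IsMaurerCartan, e, hx']
  exact iff_of_eq (congrArg (· = 0) (zero_add _))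

end DegreeOne

/-! ### Maurer–Cartan elements and deformation maps -/

section MaurerCartan

variable {k H : Type*} [Field k] [Ring H] [Bialgebra k H] [Coalgebra.IsCocomm k H]
variable {𝔤 𝔥 : Type*} [AddCommGroup 𝔤] [Module k 𝔤] [Module H 𝔤]
variable [AddCommGroup 𝔥] [Module k 𝔥] [Module H 𝔥]

theorem PT.perm_two_one (h : 2 = 2) {σ : Equiv.Perm (Fin 2)} (hσ : σ = 1) (t : PT k H 𝔤 2) :
    PT.perm h σ t = t := by
  subst hσ
  exact PT.rx_one t

theorem PT.perm_two_swap (h : 2 = 2) {σ : Equiv.Perm (Fin 2)} (hσ : σ = Equiv.swap 0 1)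
    (t : PT k H 𝔤 2) : PT.perm h σ t = PT.rx (Equiv.swap 0 1) t := by
  subst hσ
  rfl

theorem sum_front_two (h : 2 = 2) (t : Fin 2 → PT k H 𝔤 2) :
    ∑ i : Fin 2, (-1 : k) ^ ((0 + 1) + ((i : ℕ) + 1)) • PT.perm h (front i) (t i) =
      t 0 - PT.rx (Equiv.swap 0 1) (t 1) := by
  rw [Fin.sum_univ_two, PT.perm_two_one h (by decide), PT.perm_two_swap h (by decide)]
  simp [pow_succ, sub_eq_add_neg]

theorem sum_back_two (h : 2 = 2) (t : Fin 2 → PT k H 𝔤 2) :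
    ∑ i : Fin 2, (-1 : k) ^ ((0 + 1) + ((i : ℕ) + 1)) • PT.perm h (back i) (t i) =
      PT.rx (Equiv.swap 0 1) (t 0) - t 1 := by
  rw [Fin.sum_univ_two, PT.perm_two_swap h (by decide), PT.perm_two_one h (by decide)]
  simp [pow_succ, sub_eq_add_neg]

namespace MatchedPair

variable [IsScalarTower k H 𝔤] [IsScalarTower k H 𝔥]

theorem pairSum_ofHom (K : 𝔥 → 𝔥 → PT k H 𝔥 2) (T : 𝔥 →ₗ[H] 𝔤) (u : Fin 2 → 𝔥) :
    pairSum (n := 0) K (Cochain.ofHom T) u = -PT.mp T (K (u 0) (u 1)) := by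
  rw [pairSum]
  refine (Fin.sum_univ_two _).trans ?_
  refine (congrArg₂ (· + ·) (Fin.sum_univ_one _) (Fin.sum_univ_one _)).trans ?_
  refine (congrArg₂ (· + ·) (if_pos (by decide)) (if_neg (by decide))).trans ?_
  rw [add_zero]
  refine (congrArg _ (PT.perm_two_one _ (by decide) _)).trans ?_
  refine (congrArg _ (ins_ofHom T _ _)).trans ?_
  refine Eq.trans ?_ (neg_one_smul k _)
  congr 1
  simp [pow_succ]

variable {𝓰 : LiePseudoalgebra k H 𝔤} {𝓱 : LiePseudoalgebra k H 𝔥} (P : MatchedPair 𝓰 𝓱)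

theorem dFormula_ofHom (T : 𝔥 →ₗ[H] 𝔤) (u : Fin 2 → 𝔥) :
    P.dFormula (n := 0) (Cochain.ofHom T) u =
      P.η (u 0) (T (u 1)) - PT.rx (Equiv.swap 0 1) (P.η (u 1) (T (u 0))) -
        PT.mp T (𝓱.bracket (u 0) (u 1)) := by
  rw [dFormula, pairSum_ofHom, ← sub_eq_add_neg]
  refine congrArg (· - _) ((sum_front_two rfl _).trans ?_)
  exact congrArg₂ (fun x y => x - PT.rx (Equiv.swap 0 1) y) (P.η.compL_unit _ _)
    (P.η.compL_unit _ _)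

/-- At `f = T` the two kinds of ρ-terms coincide, and so do the two bracket terms by skew-symmetry;
hence the factor 2, which the 1/2 of the Maurer–Cartan equation removes. -/
theorem dTwistFormula_ofHom (T : 𝔥 →ₗ[H] 𝔤) (u : Fin 2 → 𝔥) :
    P.dTwistFormula (n := 0) T (Cochain.ofHom T) u = P.dFormula (n := 0) (Cochain.ofHom T) u +
      (2 : k) • (𝓰.bracket (T (u 0)) (T (u 1)) -
        PT.mp T (P.ρ (T (u 0)) (u 1) - PT.rx (Equiv.swap 0 1) (P.ρ (T (u 1)) (u 0)))) := by
  have h1 : ∑ i : Fin 2, (-1 : k) ^ ((0 + 1) + ((i : ℕ) + 1)) • PT.perm rfl (back i)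
      (PT.map T (P.ρ.comp (PT.unit (T (u (i.succAbove 0)))) (PT.unit (u i)))) =
      -PT.mp T (P.ρ (T (u 0)) (u 1) - PT.rx (Equiv.swap 0 1) (P.ρ (T (u 1)) (u 0))) := by
    refine (sum_back_two rfl _).trans ?_
    refine (congrArg₂ (fun x y => PT.rx (Equiv.swap 0 1) (PT.mp T x) - PT.mp T y)
      (P.ρ.compL_unit _ _) (P.ρ.compL_unit _ _)).trans ?_
    rw [map_sub, neg_sub, PT.mp_rx]
    rfl
  have h2 : ∑ i : Fin 2, (-1 : k) ^ ((0 + 1) + ((i : ℕ) + 1)) • PT.perm rfl (front i)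
      (𝓰.bracket.comp (PT.unit (T (u i))) (PT.unit (T (u (i.succAbove 0))))) =
      (2 : k) • 𝓰.bracket (T (u 0)) (T (u 1)) := by
    refine (sum_front_two rfl _).trans ?_
    refine (congrArg₂ (fun x y => x - PT.rx (Equiv.swap 0 1) y)
      (𝓰.bracket.compL_unit _ _) (𝓰.bracket.compL_unit _ _)).trans ?_
    have h := 𝓰.skew (T (u 0)) (T (u 1))
    rw [PT.reindex_eq] at h
    rw [two_smul, sub_eq_add_neg]
    exact congrArg (_ + ·) h.symm
  rw [dTwistFormula]
  refine (congrArg₂ (· + ·) (congrArg₂ (· + ·) (congrArg₂ (· + ·) rfl h1)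
    (pairSum_ofHom _ T u)) h2).trans ?_
  rw [smul_sub, ← dFormula, two_smul k (PT.mp T _)]
  simp only [PT.reindex_eq]
  abel

theorem isMaurerCartan_iff [CharZero k] (T : 𝔥 →ₗ[H] 𝔤) :
    IsMaurerCartan P.differential P.bracket (Cochain.ofHom T) ↔ P.IsDeformationMap T := by
  have h1 : ∀ u : Fin 2 → 𝔥, (P.bracket 0 0 (Cochain.ofHom T) (Cochain.ofHom T)) u =
      (2 : k) • (𝓰.bracket (T (u 0)) (T (u 1)) -
        PT.mp T (P.ρ (T (u 0)) (u 1) - PT.rx (Equiv.swap 0 1) (P.ρ (T (u 1)) (u 0)))) := by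
    intro u
    -- The bracket of T with itself is the difference of the twisted and the untwisted differential
    -- at T, so no separate evaluation over unshuffles is needed.
    have h := P.twistedDifferential_formula (p := 0) T (Cochain.ofHom T) u
    rw [dTwistFormula_ofHom, ← P.differential_formula (p := 0)] at h
    exact add_left_cancel h
  have h2 : ∀ u : Fin 2 → 𝔥, (P.differential 0 (Cochain.ofHom T) +
      (1 / 2 : k) • P.bracket 0 0 (Cochain.ofHom T) (Cochain.ofHom T)) u =
      𝓰.bracket (T (u 0)) (T (u 1)) + P.η (u 0) (T (u 1)) -
        PT.reindex (Equiv.swap 0 1) (P.η (u 1) (T (u 0))) -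
        PT.map T (𝓱.bracket (u 0) (u 1) + P.ρ (T (u 0)) (u 1) -
          PT.reindex (Equiv.swap 0 1) (P.ρ (T (u 1)) (u 0))) := by
    intro u
    refine (congrArg₂ (fun x y => x + (1 / 2 : k) • y)
      ((P.differential_formula (p := 0) (Cochain.ofHom T) u).trans (P.dFormula_ofHom T u))
      (h1 u)).trans ?_
    rw [smul_smul, one_div, inv_mul_cancel₀ two_ne_zero, one_smul, PT.map_eq]
    simp only [PT.reindex_eq, map_sub, map_add]
    abel
  constructor
  · intro h x y
    have h' : P.differential 0 (Cochain.ofHom T) +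
        (1 / 2 : k) • P.bracket 0 0 (Cochain.ofHom T) (Cochain.ofHom T) = 0 := h
    have := h2 ![x, y]
    rw [h'] at this
    exact sub_eq_zero.mp this.symm
  · intro h
    refine cochain_ext fun u => (h2 u).trans ?_
    exact sub_eq_zero.mpr (h (u 0) (u 1))

/-- In degree 0 of the indexing the twisted differential unfolds to the first two terms of
`isMaurerCartan_add`. -/
theorem isMaurerCartan_twisted_iff [CharZero k] {S T : 𝔥 →ₗ[H] 𝔤} (hT : P.IsDeformationMap T) :
    IsMaurerCartan (P.twistedDifferential (Cochain.ofHom T)) P.bracket (Cochain.ofHom S) ↔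
      P.IsDeformationMap (T + S) := by
  rw [← isMaurerCartan_iff, ofHom_add]
  exact (isMaurerCartan_add P.isDGLieAlgebra ((P.isMaurerCartan_iff T).mpr hT) _).symm

end MatchedPair

end MaurerCartan

end LiePseudo

end

theorem corollary4p16 {k H 𝔤 𝔥 : Type*} [Field k] [CharZero k]
    [Ring H] [HopfAlgebra k H] [Coalgebra.IsCocomm k H]
    [AddCommGroup 𝔤] [Module k 𝔤] [Module H 𝔤] [IsScalarTower k H 𝔤]
    [AddCommGroup 𝔥] [Module k 𝔥] [Module H 𝔥] [IsScalarTower k H 𝔥]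
    (𝓰 : LiePseudo.LiePseudoalgebra k H 𝔤) (𝓱 : LiePseudo.LiePseudoalgebra k H 𝔥)
    (P : LiePseudo.MatchedPair 𝓰 𝓱) :
    ∃ (d : ∀ p, LiePseudo.CochainSpace k H 𝔤 𝔥 p →ₗ[k] LiePseudo.CochainSpace k H 𝔤 𝔥 (p + 1))
      (br : ∀ p q, LiePseudo.CochainSpace k H 𝔤 𝔥 p →ₗ[k] LiePseudo.CochainSpace k H 𝔤 𝔥 q →ₗ[k]
        LiePseudo.CochainSpace k H 𝔤 𝔥 (p + q + 1)),
      (∀ p (f : LiePseudo.CochainSpace k H 𝔤 𝔥 p) (u : Fin (p + 2) → 𝔥),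
        (d p f) u = P.dFormula f u) ∧
      (∀ p q (f₁ : LiePseudo.CochainSpace k H 𝔤 𝔥 p) (f₂ : LiePseudo.CochainSpace k H 𝔤 𝔥 q)
        (u : Fin (p + q + 2) → 𝔥), (br p q f₁ f₂) u = P.bracketFormula f₁ f₂ u) ∧
      LiePseudo.IsDGLieAlgebra d br ∧
      Set.BijOn (fun T : 𝔥 →ₗ[H] 𝔤 => LiePseudo.Cochain.ofHom (k := k) T)
        {T | P.IsDeformationMap T} {f | LiePseudo.IsMaurerCartan d br f} ∧
      ∀ T : 𝔥 →ₗ[H] 𝔤, P.IsDeformationMap T →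
        ∃ dT : ∀ p, LiePseudo.CochainSpace k H 𝔤 𝔥 p →ₗ[k]
            LiePseudo.CochainSpace k H 𝔤 𝔥 (p + 1),
          (∀ p (f : LiePseudo.CochainSpace k H 𝔤 𝔥 p) (u : Fin (p + 2) → 𝔥),
            (dT p f) u = P.dTwistFormula T f u) ∧
          (∀ p (f : LiePseudo.CochainSpace k H 𝔤 𝔥 p),
            DirectSum.of (LiePseudo.CochainSpace k H 𝔤 𝔥) _ (dT p f) =
              DirectSum.of (LiePseudo.CochainSpace k H 𝔤 𝔥) _ (d p f) +
              DirectSum.of (LiePseudo.CochainSpace k H 𝔤 𝔥) _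
                (br 0 p (LiePseudo.Cochain.ofHom T) f)) ∧
          LiePseudo.IsDGLieAlgebra dT br ∧
          Set.BijOn (fun T' : 𝔥 →ₗ[H] 𝔤 => LiePseudo.Cochain.ofHom (k := k) T')
            {T' | P.IsDeformationMap (T + T')} {f | LiePseudo.IsMaurerCartan dT br f} := by
  -- Both bijections follow from pointwise equivalences, because `ofHom` is itself a bijection onto
  -- the cochains of degree one.
  have hon : ∀ (S : Set (𝔥 →ₗ[H] 𝔤)) (R : LiePseudo.CochainSpace k H 𝔤 𝔥 0 → Prop),
      (∀ T, R (LiePseudo.Cochain.ofHom T) ↔ T ∈ S) →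
      Set.BijOn (fun T : 𝔥 →ₗ[H] 𝔤 => LiePseudo.Cochain.ofHom (k := k) T) S {f | R f} :=
    fun S R h => ⟨fun T hT => (h T).mpr hT, LiePseudo.ofHom_injective.injOn, fun f hf => by
      obtain ⟨T, rfl⟩ := LiePseudo.exists_ofHom f
      exact ⟨T, (h T).mp hf, rfl⟩⟩
  refine ⟨P.differential, P.bracket, fun p f u => P.differential_formula f u,
    fun p q f g u => P.bracket_formula f g u, P.isDGLieAlgebra, hon _ _ P.isMaurerCartan_iff,
    fun T hT => ⟨P.twistedDifferential (LiePseudo.Cochain.ofHom T),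
      fun p f u => P.twistedDifferential_formula T f u, fun p f => P.of_twistedDifferential _ f,
      P.twisted_isDGLieAlgebra ((P.isMaurerCartan_iff T).mpr hT),
      hon _ _ fun _ => P.isMaurerCartan_twisted_iff hT⟩⟩
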